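/- Let $K$ be a field of characteristic $0$, let $Q\ge 1$ and $P$ be integers, let $A\in K$ be nonzero and fix a root $A^{1/Q}\in K$ (so that the powers $A^{k/Q}$, $k\in\mathbb Z$, make sense; for instance $K=\mathbb C$, or $A^{1/Q}$ a formal variable). Put $a=A^2$ and $b=P/Q$. On the semi-infinite wedge space (with $\psi_k$ the left wedging with $\underline{k}$, $k\in\mathbb Z+\frac12$, $\psi_k^*$ its adjoint, $E_{ij}={:}\psi_i\psi_j^*{:}$ the normally ordered product, $\alpha_k=\sum_{l}E_{l-k,l}$ for $k\neq 0$, $\mathcal F_2=\sum_k \frac{k^2}{2}E_{kk}$, and $\langle\,\cdot\,\rangle$ the vacuum expectation value) consider the extended Ooguri–Vafa partition function $$Z^{ext}=\Big\langle \exp\Big(\sum_{i\ge1}\tfrac{\alpha_i p_i^*}{i}\Big)\exp(b\hbar\,\mathcal F_2)\exp\Big(\sum_{j\ge1}\tfrac{\alpha_{-j}\tilde p_j}{j}\Big)\Big\rangle,\qquad p_i^*=\frac{A^i-A^{-i}}{e^{\hbar i/2}-e^{-\hbar i/2}},\quad \tilde p_j=Q A^{jb}\,\bar p_{j/Q},$$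 a formal power series in $\bar p_{1/Q},\bar p_{2/Q},\dots$ over $K((\hbar))$. Its connected genus-zero two-point correlators and free energy are $$C^{(0)}_{\mu_1,\mu_2}=[\hbar^0]\,\frac{\partial^2}{\partial\bar p_{\mu_1/Q}\,\partial\bar p_{\mu_2/Q}}\log Z^{ext}\Big|_{\bar p=0},\qquad F_{0,2}=\sum_{\mu_1,\mu_2\ge1}C^{(0)}_{\mu_1,\mu_2}\Lambda_1^{-\mu_1}\Lambda_2^{-\mu_2}.$$ For $m\ge1$ let $$\xi^1_m=(-1)^mA^{(b-1)m}\mathcal P^{(m(b-1),1)}_{m-1}(1-2A^2),\qquad \xi^2_m=(-1)^mA^{(b-1)m}\mathcal P^{(m(b-1)+1,1)}_{m-2}(1-2A^2),$$ where $\mathcal P_n^{(\alpha,\beta)}$ are the Jacobi polynomials ($\mathcal P_{-1}^{(\alpha,\beta)}=0$). Let $$\Lambda_i=\Lambda(U_i),\qquad \Lambda(U)=U\Big(\frac{1-A^{b+1}U}{1-A^{b-1}U}\Big)^{b},$$ expanded at $U=\infty$, where it is $A^{2b}U$ times a power series in $U^{-1}$ with constant term $1$. Then: 1. For all $\mu_1,\mu_2\ge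 1$, $$C^{(0)}_{\mu_1,\mu_2}=\frac{Q^2(a-1)b}{\mu_1+\mu_2}\Big(\big((a+1)+(a-1)b\big)\xi^1_{\mu_1}\xi^1_{\mu_2}+a\big(\xi^1_{\mu_1}\xi^2_{\mu_2}+\xi^2_{\mu_1}\xi^1_{\mu_2}\big)\Big).$$ 2. As formal power series in $U_1^{-1},U_2^{-1}$, $$F_{0,2}(U_1,U_2)=Q^2\big[\log(U_1-U_2)-\log(\Lambda_1-\Lambda_2)+2b\log A\big],$$ where the bracket means $\log\frac{A^{2b}(U_1-U_2)}{\Lambda_1-\Lambda_2}$, the argument of the logarithm being a power series in $U_1^{-1},U_2^{-1}$ with constant term $1$. 3. Consequently the two-point differential agrees with the Bergman kernel, in the sense that $$Q^{-2}\sum_{\mu_1,\mu_2\ge1}C^{(0)}_{\mu_1,\mu_2}\,\mu_1\mu_2\,\frac{d\Lambda_1}{\Lambda_1^{\mu_1+1}}\frac{d\Lambda_2}{\Lambda_2^{\mu_2+1}}=\frac{dU_1\,dU_2}{(U_1-U_2)^2}-\frac{d\Lambda_1\,d\Lambda_2}{(\Lambda_1-\Lambda_2)^2}.$$ -/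

import Mathlib

open scoped Nat

noncomputable section

namespace TorusKnotOV

/-! ### The semi-infinite wedge space

The half-integer `n + 1/2` is encoded by the integer `n`. -/

/-- A decreasing sequence of half-integers `i₁ > i₂ > ⋯` for which `i_k + k - 1/2` is eventually
constant is the same thing as the set of its values: a set of half-integers that has finitely many
positive elements and misses finitely many negative half-integers. -/
def Maya : Type :=
  {S : Set ℤ // (S ∩ Set.Ici 0).Finite ∧ (Set.Iio 0 \ S).Finite}

/-- Put a new wedge factor in. -/
def Maya.insert (k : ℤ) (S : Maya) : Maya :=
  ⟨Insert.insert k S.1,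
    (S.2.1.insert k).subset (by
      rintro x ⟨rfl | hx, hx0⟩
      · exact Set.mem_insert _ _
      · exact Set.mem_insert_of_mem _ ⟨hx, hx0⟩),
    S.2.2.subset (fun _ hx => ⟨hx.1, fun h => hx.2 (Set.mem_insert_of_mem _ h)⟩)⟩

/-- Take a wedge factor out. -/
def Maya.erase (k : ℤ) (S : Maya) : Maya :=
  ⟨S.1 \ {k},
    S.2.1.subset (fun _ hx => ⟨hx.1.1, hx.2⟩),
    (S.2.2.insert k).subset (by
      rintro x ⟨hx0, hx⟩
      by_cases hxk : x = k
      · exact hxk ▸ Set.mem_insert _ _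
      · exact Set.mem_insert_of_mem _ ⟨hx0, fun h => hx ⟨h, hxk⟩⟩)⟩

/-- `-1/2 ∧ -3/2 ∧ -5/2 ∧ ⋯` -/
def Maya.vacuum : Maya :=
  ⟨Set.Iio 0, by
    have h : (Set.Iio (0 : ℤ) ∩ Set.Ici 0) = ∅ := by
      ext x; simp
    rw [h]; exact Set.finite_empty, by simp⟩

/-- The sign picked up when the factor `k` is moved past all larger factors of `S`. -/
def Maya.sign (k : ℤ) (S : Maya) : ℤ := (-1) ^ (S.1 ∩ Set.Ioi k).ncard

/-- The semi-infinite wedge space with coefficients in `R`. The inner product is the one for which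
the wedge products are orthonormal, so that the coefficient of `S` in `v` is `(v_S, v)`. -/
abbrev Fock (R : Type*) [CommRing R] := Maya →₀ R

/-- The basis vector of a wedge product. -/
def basisVec (R : Type*) [CommRing R] (S : Maya) : Fock R := Finsupp.single S 1

/-- The linear operator with prescribed values on the wedge products. -/
def opOfBasis {R : Type*} [CommRing R] (f : Maya → Fock R) : Module.End R (Fock R) :=
  Finsupp.linearCombination R f

open Classical in
/-- `ψ_k`, wedging with the factor `k` from the left. -/
def psi (R : Type*) [CommRing R] (k : ℤ) : Module.End R (Fock R) :=
  opOfBasis fun S => if k ∈ S.1 then 0 else Maya.sign k S • basisVec R (S.insert k)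

open Classical in
/-- `ψ_k^*`, the adjoint of `ψ_k`. -/
def psiStar (R : Type*) [CommRing R] (k : ℤ) : Module.End R (Fock R) :=
  opOfBasis fun S => if k ∈ S.1 then Maya.sign k S • basisVec R (S.erase k) else 0

/-- The two operators are adjoint to each other. -/
theorem psi_adjoint (R : Type*) [CommRing R] (k : ℤ) (S T : Maya) :
    psi R k (basisVec R S) T = psiStar R k (basisVec R T) S := by
  classical
  have key : (k ∉ S.1 ∧ S.insert k = T) ↔ (k ∈ T.1 ∧ T.erase k = S) := by
    constructor
    · rintro ⟨h, rfl⟩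
      refine ⟨Set.mem_insert _ _, Subtype.ext ?_⟩
      ext x
      simp only [Maya.erase, Maya.insert, Set.mem_sdiff, Set.mem_insert_iff, Set.mem_singleton_iff]
      constructor
      · rintro ⟨h1 | h1, h2⟩
        · exact absurd h1 h2
        · exact h1
      · intro hx
        exact ⟨Or.inr hx, fun hk => h (hk ▸ hx)⟩
    · rintro ⟨h, rfl⟩
      refine ⟨fun hk => hk.2 rfl, Subtype.ext ?_⟩
      simp only [Maya.erase, Maya.insert]
      rw [Set.insert_sdiff_singleton, Set.insert_eq_of_mem h]
  have hs : k ∈ T.1 ∧ T.erase k = S → Maya.sign k S = Maya.sign k T := by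
    rintro ⟨_, rfl⟩
    unfold Maya.sign
    congr 2
    ext x
    simp only [Maya.erase, Set.mem_inter_iff, Set.mem_sdiff, Set.mem_singleton_iff, Set.mem_Ioi]
    constructor
    · rintro ⟨⟨h1, _⟩, h2⟩
      exact ⟨h1, h2⟩
    · rintro ⟨h1, h2⟩
      exact ⟨⟨h1, h2.ne'⟩, h2⟩
  simp only [psi, psiStar, opOfBasis, basisVec, Finsupp.linearCombination_single, one_smul]
  by_cases h : k ∈ T.1 ∧ T.erase k = S
  · have h' := key.2 h
    rw [if_neg h'.1, if_pos h.1, h'.2, h.2, hs h]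
    simp
  · have h' := fun hh => h (key.1 hh)
    have e1 : (if k ∈ S.1 then (0 : Fock R)
        else Maya.sign k S • Finsupp.single (S.insert k) 1) T = 0 := by
      split_ifs with hk
      · rfl
      · rw [Finsupp.smul_apply, Finsupp.single_eq_of_ne (fun e => h' ⟨hk, e.symm⟩), smul_zero]
    have e2 : (if k ∈ T.1 then Maya.sign k T • Finsupp.single (T.erase k) 1
        else (0 : Fock R)) S = 0 := by
      split_ifs with hk
      · rw [Finsupp.smul_apply, Finsupp.single_eq_of_ne (fun e => h ⟨hk, e.symm⟩), smul_zero]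
      · rfl
    rw [e1, e2]

/-- The normally ordered products `E_{ij} = :ψ_i ψ_j^*:`. -/
def opE (R : Type*) [CommRing R] (i j : ℤ) : Module.End R (Fock R) :=
  if 0 ≤ j then psi R i * psiStar R j else -(psiStar R j * psi R i)

/-- `α_k = ∑_l E_{l-k,l}` for `k ≠ 0`; on a wedge product only finitely many terms are nonzero. -/
def alpha (R : Type*) [CommRing R] (k : ℤ) : Module.End R (Fock R) :=
  opOfBasis fun S => ∑ᶠ l : ℤ, opE R (l - k) l (basisVec R S)

/-- `𝓕₂ = ∑_k (k²/2) E_{k,k}`, the sum being over the half-integers `k = l + 1/2`; on a wedge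
product only finitely many terms are nonzero. -/
def opF2 (K : Type*) [Field K] : Module.End K (Fock K) :=
  opOfBasis fun S => ∑ᶠ l : ℤ, (((l : K) + 1 / 2) ^ 2 / 2) • opE K l l (basisVec K S)

/-! ### Exponentials of operators and the partition function

The scalars are the formal Laurent series in `ħ` over `K`. -/

/-- The series `exp (c ħ)`. -/
def hexp {K : Type*} [Field K] [CharZero K] (c : K) : LaurentSeries K :=
  ((PowerSeries.rescale c (PowerSeries.exp K) : PowerSeries K) : LaurentSeries K)

/-- `exp (b ħ 𝓕₂)`. The operator `𝓕₂` is diagonal in the basis of wedge products, and so is its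
exponential. -/
def expF2 {K : Type*} [Field K] [CharZero K] (b : K) :
    Module.End (LaurentSeries K) (Fock (LaurentSeries K)) :=
  opOfBasis fun S => hexp (b * opF2 K (basisVec K S) S) • basisVec (LaurentSeries K) S

/-- `∑_{i ≥ 1} α_i p_i / i`; on a wedge product only finitely many terms are nonzero. -/
def gammaPlus {R : Type*} [Field R] (p : ℕ+ → R) : Module.End R (Fock R) :=
  opOfBasis fun S => ∑ᶠ i : ℕ+, (p i / (i : R)) • alpha R (i : ℤ) (basisVec R S)

/-- `exp T v = ∑_n T^n v / n!` for a locally nilpotent operator `T`. -/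
def expLocNilp {R : Type*} [Field R] (T : Module.End R (Fock R)) (v : Fock R) : Fock R :=
  ∑ᶠ n : ℕ, ((n ! : R)⁻¹) • (T ^ n) v

open Classical in
/-- `∑_{j ≥ 1} α_{-j} c_j x_j / j`, a formal power series in the variables `x_1, x_2, …` with
operators as coefficients. -/
def gammaMinus {R : Type*} [Field R] (c : ℕ+ → R) :
    MvPowerSeries ℕ+ (Module.End R (Fock R)) :=
  fun m => ∑ᶠ j : ℕ+, if m = Finsupp.single j 1 then (c j / (j : R)) • alpha R (-(j : ℤ)) else 0

/-- `exp G = ∑_n G^n / n!` for a power series `G` with operators as coefficients and without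
constant term: then `G^n` has no terms of degree less than `n`. -/
def expSeries {R : Type*} [Field R] (G : MvPowerSeries ℕ+ (Module.End R (Fock R))) :
    MvPowerSeries ℕ+ (Module.End R (Fock R)) :=
  fun m => ∑ n ∈ Finset.range (m.degree + 1), ((n ! : R)⁻¹) • MvPowerSeries.coeff m (G ^ n)

/-- `log f`, for a power series `f` with constant term `1`. -/
def logSeries {σ R : Type*} [Field R] [Algebra ℚ R] (f : MvPowerSeries σ R) : MvPowerSeries σ R :=
  PowerSeries.subst (f - 1) (PowerSeries.log R)

section TorusKnot

/- The parameter `B` is `A^{1/Q}`, so that `A = B ^ Q` and `A^{P/Q} = B ^ P`. -/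
variable {K : Type*} [Field K] [CharZero K] (Q : ℕ) (P : ℤ) (B : K)

/-- The extended partition function
`⟨exp (∑ α_i p_i / i) exp (ħ (P/Q) 𝓕₂) exp (∑ α_{-j} p̃_j / j)⟩`, `p̃_j = Q A^{jP/Q} p̄_{j/Q}`,
as a power series in the variables `p̄_{j/Q}`, `j = 1, 2, …` (the variable with index `j`). -/
def Zext (p : ℕ+ → LaurentSeries K) : MvPowerSeries ℕ+ (LaurentSeries K) :=
  fun m =>
    expLocNilp (gammaPlus p)
      (expF2 ((P : K) / (Q : K))
        (MvPowerSeries.coeff m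
          (expSeries (gammaMinus fun j => HahnSeries.C ((Q : K) * B ^ ((j : ℤ) * P))))
          (basisVec (LaurentSeries K) Maya.vacuum)))
      Maya.vacuum

/-- The topological locus `p_i^* = (A^i - A^{-i}) / (e^{ħi/2} - e^{-ħi/2})`. -/
def pTop (i : ℕ+) : LaurentSeries K :=
  HahnSeries.C ((B ^ Q) ^ (i : ℤ) - (B ^ Q) ^ (-(i : ℤ))) /
    (hexp ((i : K) / 2) - hexp (-((i : K) / 2)))

/-- The connected correlator
`C^{(g)}_{μ_1 … μ_n} = [ħ^{2g-2+n}] ∂/∂p̄_{μ_1/Q} ⋯ ∂/∂p̄_{μ_n/Q} log Z^{ext} |_{p̄ = 0}`. -/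
def correlator (g : ℕ) (μ : List ℕ+) : K :=
  (MvPowerSeries.constantCoeff
    (μ.foldr (fun j f => MvPowerSeries.pderiv (LaurentSeries K) j f)
      (logSeries (Zext Q P B (pTop Q B))))).coeff (2 * (g : ℤ) - 2 + μ.length)

/-- The free energy
`F_{g,n} = ∑_{μ_1, …, μ_n ≥ 1} C^{(g)}_{μ_1 … μ_n} Λ_1^{-μ_1} ⋯ Λ_n^{-μ_n}`,
as a power series in the variables `Λ_i^{-1}`. -/
def freeEnergy (g n : ℕ) : MvPowerSeries (Fin n) K :=
  fun e => if h : ∀ i, 0 < e i then correlator Q P B g (List.ofFn fun i => ⟨e i, h i⟩) else 0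

/-- The coefficient of `dΛ_1 ⋯ dΛ_n` in the differential
`Q^{-n} ∑_{μ_1, …, μ_n ≥ 1} C^{(g)}_{μ_1 … μ_n} ∏_i (-μ_i) dΛ_i / Λ_i^{μ_i + 1}`,
as a power series in the variables `Λ_i^{-1}`. -/
def omegaSeries (g n : ℕ) : MvPowerSeries (Fin n) K :=
  fun e =>
    if h : ∀ i, 1 < e i then
      ((Q : K) ^ n)⁻¹ * correlator Q P B g (List.ofFn fun i => ⟨e i - 1, Nat.sub_pos_of_lt (h i)⟩) *
        ∏ i, (-((e i - 1 : ℕ) : K))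
    else 0

/-! ### The spectral curve near `U = ∞`, in the local coordinate `w = 1/U` -/

/-- `(1 - c w)^r` -/
def binPow (c : K) (r : ℚ) : PowerSeries K :=
  PowerSeries.rescale (-c) (PowerSeries.binomialSeries K r)

/-- The expansion at `U = ∞` of `Λ / U = ((1 - A^{P/Q+1} U) / (1 - A^{P/Q-1} U))^{P/Q}`, which is
`A^{2P/Q} ((1 - A^{-P/Q-1} w) / (1 - A^{-P/Q+1} w))^{P/Q}`. -/
def lambdaRatio : PowerSeries K :=
  PowerSeries.C (B ^ (2 * P)) *
    (binPow (B ^ (-(P + Q))) ((P : ℚ) / Q) * binPow (B ^ (-(P - Q))) (-((P : ℚ) / Q)))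

/-- The expansion of `Λ^{-1}` at `U = ∞`. -/
def lambdaInv : PowerSeries K := PowerSeries.X * (lambdaRatio Q P B)⁻¹

/-- The expansion of `dΛ/dU` at `U = ∞`: for `Λ = U ρ(1/U)` it is `ρ(w) - w ρ'(w)`. -/
def lambdaDeriv : PowerSeries K :=
  lambdaRatio Q P B - PowerSeries.X * PowerSeries.derivative K (lambdaRatio Q P B)

/-- Substitution of `Λ_i^{-1} = Λ(U_i)^{-1}`: a power series in the variables `Λ_i^{-1}` becomes a
power series in the variables `w_i = 1/U_i`. -/
def onCurve {n : ℕ} (F : MvPowerSeries (Fin n) K) : MvPowerSeries (Fin n) K :=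
  MvPowerSeries.subst (fun i => PowerSeries.toMvPowerSeries i (lambdaInv Q P B)) F

end TorusKnot

/-- The fraction field of the ring of power series in `w_1 = 1/U_1` and `w_2 = 1/U_2`. -/
abbrev Frac2 (K : Type*) [Field K] := FractionRing (MvPowerSeries (Fin 2) K)

/-- A power series in `w_1, w_2`, seen in the fraction field. -/
def toFrac2 {K : Type*} [Field K] (f : MvPowerSeries (Fin 2) K) : Frac2 K :=
  algebraMap (MvPowerSeries (Fin 2) K) (Frac2 K) f

section TorusKnot2

variable {K : Type*} [Field K] [CharZero K] (Q : ℕ) (P : ℤ) (B : K)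

/-- The coordinate `U_i = 1/w_i`. -/
def coordU (K : Type*) [Field K] (i : Fin 2) : Frac2 K :=
  (toFrac2 (MvPowerSeries.X i : MvPowerSeries (Fin 2) K))⁻¹

/-- `Λ_i = Λ(U_i)`. -/
def coordLambda (i : Fin 2) : Frac2 K :=
  coordU K i * toFrac2 (PowerSeries.toMvPowerSeries i (lambdaRatio Q P B))

/-- `dΛ_i/dU_i`. -/
def coordLambdaDeriv (i : Fin 2) : Frac2 K :=
  toFrac2 (PowerSeries.toMvPowerSeries i (lambdaDeriv Q P B))

end TorusKnot2

/-! ### Jacobi polynomials -/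

/-- The Jacobi polynomial
`𝒫_n^{(α,β)}(x) = Γ(α+n+1) / (Γ(α+1) Γ(n+1)) ₂F₁(-n, 1+α+β+n; α+1; (1-x)/2)`, where
`Γ(α+n+1) / Γ(α+1)` divided by the Pochhammer symbol `(α+1)_s` is written as `(α+s+1)_{n-s}`; it
vanishes for `n < 0`. -/
def jacobi {K : Type*} [Field K] (n : ℤ) (α β x : K) : K :=
  if 0 ≤ n then
    ∑ s ∈ Finset.range (n.toNat + 1),
      (ascPochhammer K s).eval (-(n : K)) * (ascPochhammer K s).eval (1 + α + β + n) *
        (ascPochhammer K (n.toNat - s)).eval (α + s + 1) / ((n.toNat ! : K) * (s ! : K)) *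
        ((1 - x) / 2) ^ s
  else 0

/-- `ξ^1_m = (-1)^m A^{(P/Q-1)m} 𝒫_{m-1}^{(m(P/Q-1), 1)}(1 - 2A²)` with `A = B ^ Q`. -/
def xi1 {K : Type*} [Field K] (Q : ℕ) (P : ℤ) (B : K) (m : ℕ+) : K :=
  (-1) ^ (m : ℕ) * B ^ ((P - Q) * (m : ℤ)) *
    jacobi ((m : ℤ) - 1) ((m : K) * ((P : K) / Q - 1)) 1 (1 - 2 * (B ^ Q) ^ 2)

/-- `ξ^2_m = (-1)^m A^{(P/Q-1)m} 𝒫_{m-2}^{(m(P/Q-1)+1, 1)}(1 - 2A²)` with `A = B ^ Q`. -/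
def xi2 {K : Type*} [Field K] (Q : ℕ) (P : ℤ) (B : K) (m : ℕ+) : K :=
  (-1) ^ (m : ℕ) * B ^ ((P - Q) * (m : ℤ)) *
    jacobi ((m : ℤ) - 2) ((m : K) * ((P : K) / Q - 1) + 1) 1 (1 - 2 * (B ^ Q) ^ 2)

end TorusKnotOV

end

noncomputable section

namespace TorusKnotOV

/-! ### Canonical anticommutation relations -/

namespace Maya

/-! Write `f_m` for the series `((1 - X/A) / (1 - A X))^{bm}`, which is `expOf (logRatio A (b m))`.
It governs both the wedge-space side and the curve, and the theorem comes from comparing the two.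

On the wedge space, conjugation by `exp (∑ α_i p_i / i)` acts on a fermion by multiplying its
generating series by `exp (±g)` with `g = ∑ p_k X^k / k` (`expLocNilp_seriesOp`), and `exp (bħ𝓕₂)`
multiplies `ψ_{k+m} ψ_k^*` by a factor that is geometric in `k` (`shiftFactor_sub`). Together they
turn the matrix elements of `α_{-m}` into coefficients of `exp (g(X) - g(e^{-bmħ} X))`
(`conjAlpha_eq`). Wick's theorem for four fermions splits `⟨α_{-m} α_{-n}⟩` into the disconnected
product, which the logarithm removes, and an exchange term (`vevExp_two`). On the topological locus
the pole of `p_i^*` in `ħ` is compensated by `1 - e^{-bmiħ}`, so the exchange term is regular in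
`ħ`, and its constant term is a quadratic sum of coefficients of `f_m` and `f_n`
(`regularAt_conjSeries`, `correlator_two`).

Multiplied by `m + n`, this sum telescopes (`sum_mul_coeffZ_mul_coeffZ`): both `f_m` and its
derivative are polynomial multiples of the single series `powHat A (b m)`. Only boundary terms
survive, involving the coefficients of index `m - 1` and `m - 2`. Expanding the product of two
binomial series identifies these with Jacobi polynomials (`coeff_mul_negPow_eq_jacobi`), which gives
the first claim.

On the curve put `w = 1/U` and `Λ = U ρ(w)`. Then `ρ^m` is `f_m` up to rescaling (`lambdaRatio_eq`,
`expOf_logRatio_pow`). A residue pairing extracts the coefficients in `Λ_1^{-1}, Λ_2^{-1}` of any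
series in `w_1, w_2` (`coeff_subst_toMvPowerSeries_mul`). For `log (A^{2b} (U_1 - U_2) / (Λ_1 -
Λ_2))`, integration by parts brings in the Euler field `Λ_1 ∂_{Λ_1} + Λ_2 ∂_{Λ_2}`, for which `Λ_1 -
Λ_2` is homogeneous of degree one; what remains is rational, with a cubic numerator
(`curveDen_mul_curveDen_mul_euler`). Its coefficients are the boundary terms found above, so the
free energy is `Q²` times this logarithm. The Bergman kernel is the mixed second derivative of the
same logarithm (`mul_pderiv_pderiv_log_normalizedRatio`). -/

theorem mem_insert {k l : ℤ} {S : Maya} : l ∈ (S.insert k).1 ↔ l = k ∨ l ∈ S.1 := Iff.rfl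

theorem mem_erase {k l : ℤ} {S : Maya} : l ∈ (S.erase k).1 ↔ l ∈ S.1 ∧ l ≠ k := Iff.rfl

theorem ext_mem {S T : Maya} (h : ∀ l, l ∈ S.1 ↔ l ∈ T.1) : S = T := Subtype.ext (Set.ext h)

theorem insert_erase {k : ℤ} {S : Maya} (h : k ∈ S.1) : (S.erase k).insert k = S :=
  ext_mem fun l => by
    rw [mem_insert, mem_erase]
    by_cases hl : l = k
    · subst hl; simp [h]
    · simp [hl]

theorem erase_insert {k : ℤ} {S : Maya} (h : k ∉ S.1) : (S.insert k).erase k = S :=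
  ext_mem fun l => by
    rw [mem_erase, mem_insert]
    by_cases hl : l = k
    · subst hl; simp [h]
    · simp [hl]

theorem finite_inter_Ioi (S : Maya) (k : ℤ) : (S.1 ∩ Set.Ioi k).Finite := by
  refine (S.2.1.union (Set.finite_Ioo k 0)).subset ?_
  rintro x ⟨hx, hk⟩
  by_cases h : 0 ≤ x
  · exact Or.inl ⟨hx, h⟩
  · exact Or.inr ⟨hk, not_le.1 h⟩

theorem sign_insert {i j : ℤ} {S : Maya} (hj : j ∉ S.1) :
    sign i (S.insert j) = if i < j then -sign i S else sign i S := by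
  unfold sign
  split_ifs with h
  · have : (S.insert j).1 ∩ Set.Ioi i = Insert.insert j (S.1 ∩ Set.Ioi i) := by
      ext x
      simp only [Set.mem_inter_iff, mem_insert, Set.mem_Ioi, Set.mem_insert_iff]
      constructor
      · rintro ⟨rfl | hx, h2⟩
        · exact Or.inl rfl
        · exact Or.inr ⟨hx, h2⟩
      · rintro (rfl | hx)
        · exact ⟨Or.inl rfl, h⟩
        · exact ⟨Or.inr hx.1, hx.2⟩
    rw [this, Set.ncard_insert_of_notMem (fun hx => hj hx.1) (finite_inter_Ioi S i), pow_succ]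
    ring
  · congr 2
    ext x
    simp only [Set.mem_inter_iff, mem_insert, Set.mem_Ioi]
    constructor
    · rintro ⟨rfl | hx, h2⟩
      · exact absurd h2 h
      · exact ⟨hx, h2⟩
    · rintro ⟨hx, h2⟩
      exact ⟨Or.inr hx, h2⟩

theorem sign_erase {i j : ℤ} {S : Maya} (hj : j ∈ S.1) :
    sign i (S.erase j) = if i < j then -sign i S else sign i S := by
  have h := sign_insert (i := i) (j := j) (S := S.erase j) (fun h => h.2 rfl)
  rw [insert_erase hj] at h
  split_ifs at h ⊢ <;> rw [h]
  rw [neg_neg]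

theorem sign_mul_self (i : ℤ) (S : Maya) : sign i S * sign i S = 1 := by
  unfold sign
  rw [← pow_add, ← two_mul, pow_mul]; simp

end Maya

section CAR

variable {R : Type*} [CommRing R]

theorem opOfBasis_basisVec (f : Maya → Fock R) (S : Maya) :
    opOfBasis f (basisVec R S) = f S := by
  simp [opOfBasis, basisVec]

theorem end_ext {f g : Module.End R (Fock R)}
    (h : ∀ S, f (basisVec R S) = g (basisVec R S)) : f = g := by
  refine Finsupp.lhom_ext fun S r => ?_
  have : Finsupp.single S r = r • basisVec R S := by simp [basisVec]
  rw [this, map_smul, map_smul, h]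

open Classical in
theorem psi_basisVec (k : ℤ) (S : Maya) :
    psi R k (basisVec R S) = if k ∈ S.1 then 0 else Maya.sign k S • basisVec R (S.insert k) :=
  opOfBasis_basisVec _ S

open Classical in
theorem psiStar_basisVec (k : ℤ) (S : Maya) :
    psiStar R k (basisVec R S) = if k ∈ S.1 then Maya.sign k S • basisVec R (S.erase k) else 0 :=
  opOfBasis_basisVec _ S

theorem psi_of_mem {k : ℤ} {S : Maya} (h : k ∈ S.1) : psi R k (basisVec R S) = 0 := by
  rw [psi_basisVec, if_pos h]

theorem psi_of_notMem {k : ℤ} {S : Maya} (h : k ∉ S.1) :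
    psi R k (basisVec R S) = Maya.sign k S • basisVec R (S.insert k) := by
  rw [psi_basisVec, if_neg h]

theorem psiStar_of_mem {k : ℤ} {S : Maya} (h : k ∈ S.1) :
    psiStar R k (basisVec R S) = Maya.sign k S • basisVec R (S.erase k) := by
  rw [psiStar_basisVec, if_pos h]

theorem psiStar_of_notMem {k : ℤ} {S : Maya} (h : k ∉ S.1) :
    psiStar R k (basisVec R S) = 0 := by
  rw [psiStar_basisVec, if_neg h]

theorem psi_mul_psi (i j : ℤ) : psi R i * psi R j = -(psi R j * psi R i) := by
  refine end_ext fun S => ?_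
  simp only [Module.End.mul_apply, LinearMap.neg_apply]
  by_cases hi : i ∈ S.1
  · by_cases hj : j ∈ S.1
    · rw [psi_of_mem hi, psi_of_mem hj]; simp
    · rw [psi_of_mem hi, psi_of_notMem hj, map_zsmul, psi_of_mem (Maya.mem_insert.2 (Or.inr hi))]
      simp
  by_cases hj : j ∈ S.1
  · rw [psi_of_mem hj, psi_of_notMem hi, map_zsmul, psi_of_mem (Maya.mem_insert.2 (Or.inr hj))]
    simp
  by_cases hij : i = j
  · subst hij
    rw [psi_of_notMem hi, map_zsmul, psi_of_mem (Maya.mem_insert.2 (Or.inl rfl))]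
    simp
  have h1 : i ∉ (S.insert j).1 := by rw [Maya.mem_insert]; tauto
  have h2 : j ∉ (S.insert i).1 := by rw [Maya.mem_insert]; tauto
  have h3 : (S.insert j).insert i = (S.insert i).insert j :=
    Maya.ext_mem fun l => by simp only [Maya.mem_insert]; tauto
  rw [psi_of_notMem hi, psi_of_notMem hj, map_zsmul, map_zsmul, psi_of_notMem h1,
    psi_of_notMem h2, h3, Maya.sign_insert hi, Maya.sign_insert hj, smul_smul, smul_smul, ← neg_smul]
  congr 1
  -- In exactly one of the two orders the factor inserted second has to pass the one inserted first,
  -- so the signs are opposite.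
  rcases lt_or_gt_of_ne hij with h | h
  · rw [if_pos h, if_neg h.le.not_gt]; ring
  · rw [if_pos h, if_neg (not_lt.2 h.le)]; ring

theorem psiStar_mul_psiStar (i j : ℤ) :
    psiStar R i * psiStar R j = -(psiStar R j * psiStar R i) := by
  refine end_ext fun S => ?_
  simp only [Module.End.mul_apply, LinearMap.neg_apply]
  by_cases hi : i ∈ S.1
  swap
  · by_cases hj : j ∈ S.1
    · rw [psiStar_of_notMem hi, psiStar_of_mem hj, map_zsmul,
        psiStar_of_notMem (fun h => hi (Maya.mem_erase.1 h).1)]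
      simp
    · rw [psiStar_of_notMem hi, psiStar_of_notMem hj]; simp
  by_cases hj : j ∈ S.1
  swap
  · rw [psiStar_of_notMem hj, psiStar_of_mem hi, map_zsmul,
      psiStar_of_notMem (fun h => hj (Maya.mem_erase.1 h).1)]
    simp
  by_cases hij : i = j
  · subst hij
    rw [psiStar_of_mem hi, map_zsmul, psiStar_of_notMem (fun h => (Maya.mem_erase.1 h).2 rfl)]
    simp
  have h1 : i ∈ (S.erase j).1 := Maya.mem_erase.2 ⟨hi, hij⟩
  have h2 : j ∈ (S.erase i).1 := Maya.mem_erase.2 ⟨hj, Ne.symm hij⟩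
  have h3 : (S.erase j).erase i = (S.erase i).erase j :=
    Maya.ext_mem fun l => by simp only [Maya.mem_erase]; tauto
  rw [psiStar_of_mem hi, psiStar_of_mem hj, map_zsmul, map_zsmul, psiStar_of_mem h1,
    psiStar_of_mem h2, h3, Maya.sign_erase hi, Maya.sign_erase hj, smul_smul, smul_smul, ← neg_smul]
  congr 1
  rcases lt_or_gt_of_ne hij with h | h
  · rw [if_pos h, if_neg h.le.not_gt]; ring
  · rw [if_pos h, if_neg (not_lt.2 h.le)]; ring

theorem psi_mul_psiStar_add (i j : ℤ) :
    psi R i * psiStar R j + psiStar R j * psi R i = if i = j then 1 else 0 := by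
  refine end_ext fun S => ?_
  by_cases hij : i = j
  · subst hij
    rw [if_pos rfl]
    simp only [Module.End.mul_apply, LinearMap.add_apply, Module.End.one_apply]
    by_cases hi : i ∈ S.1
    · rw [psiStar_of_mem hi, psi_of_mem hi, map_zsmul,
        psi_of_notMem (fun h => (Maya.mem_erase.1 h).2 rfl), Maya.insert_erase hi,
        Maya.sign_erase hi, if_neg (lt_irrefl i), smul_smul, Maya.sign_mul_self]
      simp
    · rw [psiStar_of_notMem hi, psi_of_notMem hi, map_zsmul,
        psiStar_of_mem (Maya.mem_insert.2 (Or.inl rfl)), Maya.erase_insert hi,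
        Maya.sign_insert hi, if_neg (lt_irrefl i), smul_smul, Maya.sign_mul_self]
      simp
  rw [if_neg hij]
  simp only [Module.End.mul_apply, LinearMap.add_apply, LinearMap.zero_apply]
  by_cases hi : i ∈ S.1
  · by_cases hj : j ∈ S.1
    · rw [psi_of_mem hi, psiStar_of_mem hj, map_zsmul, psi_of_mem (Maya.mem_erase.2 ⟨hi, hij⟩)]
      simp
    · rw [psi_of_mem hi, psiStar_of_notMem hj]; simp
  by_cases hj : j ∈ S.1
  swap
  · have h : j ∉ (S.insert i).1 := by rw [Maya.mem_insert]; tauto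
    rw [psiStar_of_notMem hj, psi_of_notMem hi, map_zsmul, psiStar_of_notMem h]
    simp
  have h1 : i ∉ (S.erase j).1 := fun h => hi (Maya.mem_erase.1 h).1
  have h2 : j ∈ (S.insert i).1 := Maya.mem_insert.2 (Or.inr hj)
  have h3 : (S.erase j).insert i = (S.insert i).erase j :=
    Maya.ext_mem fun l => by
      simp only [Maya.mem_erase, Maya.mem_insert]
      constructor
      · rintro (rfl | h)
        · exact ⟨Or.inl rfl, hij⟩
        · exact ⟨Or.inr h.1, h.2⟩
      · tauto
  rw [psi_of_notMem hi, psiStar_of_mem hj, map_zsmul, map_zsmul, psi_of_notMem h1,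
    psiStar_of_mem h2, h3, Maya.sign_insert hi, Maya.sign_erase hj, smul_smul, smul_smul, ← add_smul]
  convert zero_smul ℤ _
  rcases lt_or_gt_of_ne hij with h | h
  · rw [if_pos h, if_neg h.le.not_gt]; ring
  · rw [if_pos h, if_neg (not_lt.2 h.le)]; ring

theorem psi_psi (i j : ℤ) (v : Fock R) : psi R i (psi R j v) = -psi R j (psi R i v) := by
  have := LinearMap.congr_fun (psi_mul_psi (R := R) i j) v
  simpa only [Module.End.mul_apply, LinearMap.neg_apply] using this

theorem psiStar_psiStar (i j : ℤ) (v : Fock R) :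
    psiStar R i (psiStar R j v) = -psiStar R j (psiStar R i v) := by
  have := LinearMap.congr_fun (psiStar_mul_psiStar (R := R) i j) v
  simpa only [Module.End.mul_apply, LinearMap.neg_apply] using this

theorem psi_psiStar (i j : ℤ) (v : Fock R) :
    psi R i (psiStar R j v) = (if i = j then v else 0) - psiStar R j (psi R i v) := by
  have := LinearMap.congr_fun (psi_mul_psiStar_add (R := R) i j) v
  rw [LinearMap.add_apply, Module.End.mul_apply, Module.End.mul_apply] at this
  rw [eq_sub_iff_add_eq, this]
  split_ifs <;> simp

theorem psiStar_psi (i j : ℤ) (v : Fock R) :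
    psiStar R j (psi R i v) = (if i = j then v else 0) - psi R i (psiStar R j v) := by
  rw [psi_psiStar, sub_sub_cancel]

/-- Off the diagonal the two fermions anticommute, so normal ordering has no effect. The case
distinction in `opE` matters only for `𝓕₂`. -/
theorem opE_of_ne {i j : ℤ} (h : i ≠ j) (v : Fock R) : opE R i j v = psi R i (psiStar R j v) := by
  unfold opE
  split_ifs
  · rfl
  · rw [LinearMap.neg_apply, Module.End.mul_apply, psi_psiStar, if_neg h, zero_sub]

/-- The commutator with `E_ij` acts on the `ψ_a` as a matrix unit; on the `ψ_b^*`, in `opE_psiStar`,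
as minus its transpose. -/
theorem opE_psi {i j : ℤ} (h : i ≠ j) (a : ℤ) (v : Fock R) :
    opE R i j (psi R a v) = psi R a (opE R i j v) + if a = j then psi R i v else 0 := by
  rw [opE_of_ne h, opE_of_ne h, psiStar_psi, map_sub, psi_psi i a]
  split_ifs <;> simp [add_comm]

theorem opE_psiStar {i j : ℤ} (h : i ≠ j) (b : ℤ) (v : Fock R) :
    opE R i j (psiStar R b v) = psiStar R b (opE R i j v) - if b = i then psiStar R j v else 0 := by
  rw [opE_of_ne h, opE_of_ne h, psiStar_psiStar, map_neg, psi_psiStar i b]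
  by_cases hb : b = i
  · subst hb; simp
  · rw [if_neg (Ne.symm hb), if_neg hb]; simp

end CAR

end TorusKnotOV

end

noncomputable section

namespace TorusKnotOV

/-! ### Bounded wedge products and the operators `α_k` -/

section Bounded

variable {R : Type*} [CommRing R]

/-- The span of the wedge products that contain all factors below `B` and only factors
below `T`. -/
def bounded (R : Type*) [CommRing R] (B T : ℤ) : Submodule R (Fock R) :=
  Submodule.span R (basisVec R '' {S | Set.Iio B ⊆ S.1 ∧ S.1 ⊆ Set.Iio T})

theorem basisVec_mem_bounded {B T : ℤ} {S : Maya} (h1 : Set.Iio B ⊆ S.1) (h2 : S.1 ⊆ Set.Iio T) :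
    basisVec R S ∈ bounded R B T :=
  Submodule.subset_span ⟨S, ⟨h1, h2⟩, rfl⟩

theorem bounded_mono {B B' T T' : ℤ} (hB : B' ≤ B) (hT : T ≤ T') :
    bounded R B T ≤ bounded R B' T' :=
  Submodule.span_mono (Set.image_mono fun _ h =>
    ⟨(Set.Iio_subset_Iio hB).trans h.1, h.2.trans (Set.Iio_subset_Iio hT)⟩)

theorem vacuum_mem_bounded {B T : ℤ} (hB : B ≤ 0) (hT : 0 ≤ T) :
    basisVec R Maya.vacuum ∈ bounded R B T :=
  basisVec_mem_bounded (Set.Iio_subset_Iio hB) (Set.Iio_subset_Iio hT)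

theorem Maya.exists_bounds (S : Maya) : ∃ B T : ℤ, Set.Iio B ⊆ S.1 ∧ S.1 ⊆ Set.Iio T := by
  obtain ⟨b, hb⟩ := S.2.2.bddBelow
  obtain ⟨t, ht⟩ := S.2.1.bddAbove
  refine ⟨min b 0, max (t + 1) 0, fun x hx => ?_, fun x hx => ?_⟩
  · have hx' := lt_min_iff.1 (Set.mem_Iio.1 hx)
    by_contra h
    exact absurd (hb ⟨hx'.2, h⟩) (not_le.2 hx'.1)
  · by_cases h : 0 ≤ x
    · exact lt_max_of_lt_left (Int.lt_add_one_of_le (ht ⟨hx, h⟩))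
    · exact lt_max_of_lt_right (not_le.1 h)

theorem exists_mem_bounded (v : Fock R) : ∃ B T : ℤ, v ∈ bounded R B T := by
  induction v using Finsupp.induction_linear with
  | zero => exact ⟨0, 0, Submodule.zero_mem _⟩
  | add f g hf hg =>
    obtain ⟨B, T, h⟩ := hf
    obtain ⟨B', T', h'⟩ := hg
    exact ⟨min B B', max T T', Submodule.add_mem _
      (bounded_mono (min_le_left _ _) (le_max_left _ _) h)
      (bounded_mono (min_le_right _ _) (le_max_right _ _) h')⟩
  | single S r =>
    obtain ⟨B, T, h1, h2⟩ := S.exists_bounds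
    refine ⟨B, T, ?_⟩
    have : Finsupp.single S r = r • basisVec R S := by simp [basisVec]
    rw [this]
    exact Submodule.smul_mem _ _ (basisVec_mem_bounded h1 h2)

theorem eq_of_bounded {V : Type*} [AddCommGroup V] [Module R V] {B T : ℤ}
    {f g : Fock R →ₗ[R] V}
    (h : ∀ S : Maya, Set.Iio B ⊆ S.1 → S.1 ⊆ Set.Iio T → f (basisVec R S) = g (basisVec R S))
    {v : Fock R} (hv : v ∈ bounded R B T) : f v = g v := by
  induction hv using Submodule.span_induction with
  | mem x hx => obtain ⟨S, hS, rfl⟩ := hx; exact h S hS.1 hS.2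
  | zero => simp
  | add x y _ _ hx hy => rw [map_add, map_add, hx, hy]
  | smul r x _ hx => rw [map_smul, map_smul, hx]

theorem map_mem_of_bounded {B T : ℤ} {f : Module.End R (Fock R)} {W : Submodule R (Fock R)}
    (h : ∀ S : Maya, Set.Iio B ⊆ S.1 → S.1 ⊆ Set.Iio T → f (basisVec R S) ∈ W)
    {v : Fock R} (hv : v ∈ bounded R B T) : f v ∈ W := by
  have : bounded R B T ≤ W.comap f := Submodule.span_le.2 (by
    rintro _ ⟨S, hS, rfl⟩
    exact h S hS.1 hS.2)
  exact this hv

theorem psi_eq_zero {B T a : ℤ} {v : Fock R} (hv : v ∈ bounded R B T) (ha : a < B) :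
    psi R a v = 0 :=
  eq_of_bounded (g := 0) (fun S h1 _ => by rw [psi_of_mem (h1 ha)]; rfl) hv

theorem psiStar_eq_zero {B T b : ℤ} {v : Fock R} (hv : v ∈ bounded R B T) (hb : T ≤ b) :
    psiStar R b v = 0 :=
  eq_of_bounded (g := 0)
    (fun S _ h2 => by rw [psiStar_of_notMem (fun h => absurd (h2 h) (not_lt.2 hb))]; rfl) hv

theorem psi_mem_bounded {B T a : ℤ} {v : Fock R} (hv : v ∈ bounded R B T) (ha : a < T) :
    psi R a v ∈ bounded R B T := by
  refine map_mem_of_bounded (fun S h1 h2 => ?_) hv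
  rw [psi_basisVec]
  split_ifs with h
  · exact Submodule.zero_mem _
  · refine zsmul_mem (basisVec_mem_bounded (h1.trans (Set.subset_insert _ _)) ?_) _
    exact Set.insert_subset ha h2

theorem psiStar_mem_bounded {B T b : ℤ} {v : Fock R} (hv : v ∈ bounded R B T) (hb : B ≤ b) :
    psiStar R b v ∈ bounded R B T := by
  refine map_mem_of_bounded (fun S h1 h2 => ?_) hv
  rw [psiStar_basisVec]
  split_ifs with h
  · refine zsmul_mem (basisVec_mem_bounded (fun x hx => Maya.mem_erase.2 ⟨h1 hx, ?_⟩) (Set.sdiff_subset.trans h2)) _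
    exact (lt_of_lt_of_le (Set.mem_Iio.1 hx) hb).ne
  · exact Submodule.zero_mem _

/-- On bounded vectors `ψ_l^*` vanishes for `l ≥ T` and `ψ_{l-k}` for `l - k < B`. A finite range of
`l` therefore serves the whole subspace at once, and it may be enlarged freely. -/
theorem alpha_apply {B T k : ℤ} (hk : k ≠ 0) {v : Fock R} (hv : v ∈ bounded R B T)
    {I : Finset ℤ} (hI : ∀ l, l < T → B ≤ l - k → l ∈ I) :
    alpha R k v = ∑ l ∈ I, psi R (l - k) (psiStar R l v) := by
  have key : ∀ S : Maya, Set.Iio B ⊆ S.1 → S.1 ⊆ Set.Iio T → alpha R k (basisVec R S) =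
      (∑ l ∈ I, psi R (l - k) * psiStar R l) (basisVec R S) := by
    intro S h1 h2
    have hS : basisVec R S ∈ bounded R B T := basisVec_mem_bounded h1 h2
    have hne : ∀ l : ℤ, l - k ≠ l := fun l h => hk (by simpa using h)
    rw [alpha, opOfBasis_basisVec, LinearMap.sum_apply]
    rw [finsum_eq_sum_of_support_subset (s := I)]
    · exact Finset.sum_congr rfl fun l _ => opE_of_ne (hne l) _
    · intro l hl
      rw [Function.mem_support, opE_of_ne (hne l)] at hl
      refine hI l ?_ ?_
      · by_contra h
        rw [psiStar_eq_zero hS (not_lt.1 h), map_zero] at hl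
        exact hl rfl
      · by_contra h
        rw [psi_psiStar, if_neg (hne l), psi_eq_zero hS (not_le.1 h)] at hl
        simp at hl
  rw [eq_of_bounded key hv, LinearMap.sum_apply]
  rfl

/-- A factor moved by `k` has to start below `T` and land at or above `B`; there is no such
position. -/
theorem alpha_eq_zero {B T k : ℤ} (hk : k ≠ 0) {v : Fock R} (hv : v ∈ bounded R B T)
    (h : T ≤ B + k) : alpha R k v = 0 := by
  rw [alpha_apply hk hv (I := ∅) (fun l h1 h2 => by lia)]
  simp

theorem alpha_psi {k : ℤ} (hk : k ≠ 0) (a : ℤ) (v : Fock R) :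
    alpha R k (psi R a v) = psi R a (alpha R k v) + psi R (a - k) v := by
  obtain ⟨B, T, hv⟩ := exists_mem_bounded v
  -- The upper bound is raised so that `ψ_a` preserves the subspace, and `a` is put into the index
  -- set because it is the only index with a nonzero commutator.
  have hv' : v ∈ bounded R B (max T (a + 1)) := bounded_mono le_rfl (le_max_left _ _) hv
  have hI : ∀ l, l < max T (a + 1) → B ≤ l - k →
      l ∈ insert a (Finset.Ico (B + k) (max T (a + 1))) := fun l h1 h2 =>
    Finset.mem_insert_of_mem (Finset.mem_Ico.2 ⟨by lia, h1⟩)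
  have hne : ∀ l : ℤ, l - k ≠ l := fun l h => hk (by simpa using h)
  rw [alpha_apply hk (psi_mem_bounded hv' (by lia)) hI, alpha_apply hk hv' hI, map_sum]
  simp_rw [← opE_of_ne (hne _), opE_psi (hne _)]
  rw [Finset.sum_add_distrib, Finset.sum_ite_eq, if_pos (Finset.mem_insert_self _ _)]

theorem alpha_psiStar {k : ℤ} (hk : k ≠ 0) (b : ℤ) (v : Fock R) :
    alpha R k (psiStar R b v) = psiStar R b (alpha R k v) - psiStar R (b + k) v := by
  obtain ⟨B, T, hv⟩ := exists_mem_bounded v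
  have hv' : v ∈ bounded R (min B b) T := bounded_mono (min_le_left _ _) le_rfl hv
  have hI : ∀ l, l < T → min B b ≤ l - k →
      l ∈ insert (b + k) (Finset.Ico (min B b + k) T) := fun l h1 h2 =>
    Finset.mem_insert_of_mem (Finset.mem_Ico.2 ⟨by lia, h1⟩)
  have hne : ∀ l : ℤ, l - k ≠ l := fun l h => hk (by simpa using h)
  have hb : ∀ l : ℤ, b = l - k ↔ b + k = l := fun l => by lia
  rw [alpha_apply hk (psiStar_mem_bounded hv' (min_le_right _ _)) hI, alpha_apply hk hv' hI,
    map_sum]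
  simp_rw [← opE_of_ne (hne _), opE_psiStar (hne _), hb]
  rw [Finset.sum_sub_distrib, Finset.sum_ite_eq, if_pos (Finset.mem_insert_self _ _)]

theorem alpha_mem_bounded {B T k : ℤ} (hk : 0 < k) {v : Fock R} (hv : v ∈ bounded R B T) :
    alpha R k v ∈ bounded R B T := by
  rw [alpha_apply hk.ne' hv (I := Finset.Ico (B + k) T)
    (fun l h1 h2 => Finset.mem_Ico.2 ⟨by lia, h1⟩)]
  refine Submodule.sum_mem _ fun l hl => ?_
  rw [Finset.mem_Ico] at hl
  exact psi_mem_bounded (psiStar_mem_bounded hv (by lia)) (by lia)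

end Bounded

/-! ### The lowering half-vertex generator and its commutators with fermions -/

section GammaPlus

variable {R : Type*} [Field R]

/-- The power series `∑_{k ≥ 1} p_k X^k / k`. -/
def timesSeries (p : ℕ+ → R) : PowerSeries R :=
  PowerSeries.mk fun k => if h : 0 < k then p ⟨k, h⟩ / k else 0

theorem coeff_timesSeries_succ (p : ℕ+ → R) (k : ℕ) :
    PowerSeries.coeff (k + 1) (timesSeries p) = p k.succPNat / ((k + 1 : ℕ) : R) := by
  rw [timesSeries, PowerSeries.coeff_mk, dif_pos k.succ_pos]
  rfl

theorem constantCoeff_timesSeries (p : ℕ+ → R) :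
    PowerSeries.constantCoeff (timesSeries p) = 0 := by
  rw [← PowerSeries.coeff_zero_eq_constantCoeff_apply, timesSeries, PowerSeries.coeff_mk]
  simp

theorem gammaPlus_apply (p : ℕ+ → R) {B T : ℤ} {N : ℕ} (hN : T ≤ B + N) {v : Fock R}
    (hv : v ∈ bounded R B T) :
    gammaPlus p v = ∑ k ∈ Finset.range N,
      PowerSeries.coeff (k + 1) (timesSeries p) • alpha R ((k : ℤ) + 1) v := by
  have key : ∀ S : Maya, Set.Iio B ⊆ S.1 → S.1 ⊆ Set.Iio T → gammaPlus p (basisVec R S) =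
      (∑ k ∈ Finset.range N,
        PowerSeries.coeff (k + 1) (timesSeries p) • alpha R ((k : ℤ) + 1)) (basisVec R S) := by
    intro S h1 h2
    have hS : basisVec R S ∈ bounded R B T := basisVec_mem_bounded h1 h2
    rw [gammaPlus, opOfBasis_basisVec, LinearMap.sum_apply]
    rw [finsum_eq_sum_of_support_subset
      (s := (Finset.range N).map ⟨Nat.succPNat, Nat.succPNat_injective⟩)]
    · rw [Finset.sum_map]
      refine Finset.sum_congr rfl fun k _ => ?_
      rw [coeff_timesSeries_succ]
      simp
    · intro i hi
      rw [Function.mem_support] at hi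
      rw [Finset.coe_map]
      refine ⟨i.natPred, ?_, by simp⟩
      rw [Finset.coe_range, Set.mem_Iio]
      by_contra h
      have hi' : (i.natPred : ℤ) + 1 = (i : ℤ) := by exact_mod_cast i.natPred_add_one
      rw [alpha_eq_zero (by positivity) hS (by lia), smul_zero] at hi
      exact hi rfl
  rw [eq_of_bounded key hv, LinearMap.sum_apply]
  rfl

theorem gammaPlus_mem_bounded (p : ℕ+ → R) {B T : ℤ} {v : Fock R}
    (hv : v ∈ bounded R B T) : gammaPlus p v ∈ bounded R B T := by
  rw [gammaPlus_apply p (N := (T - B).toNat) (by lia) hv]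
  exact Submodule.sum_mem _ fun k _ => Submodule.smul_mem _ _ (alpha_mem_bounded (by positivity) hv)

theorem gammaPlus_psi (p : ℕ+ → R) {B T : ℤ} {N : ℕ} (hN : T ≤ B + N) {v : Fock R}
    (hv : v ∈ bounded R B T) {a : ℤ} (ha : a < T) :
    gammaPlus p (psi R a v) = psi R a (gammaPlus p v) + ∑ k ∈ Finset.range N,
      PowerSeries.coeff (k + 1) (timesSeries p) • psi R (a - ((k : ℤ) + 1)) v := by
  rw [gammaPlus_apply p hN hv, gammaPlus_apply p hN (psi_mem_bounded hv ha), map_sum,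
    ← Finset.sum_add_distrib]
  refine Finset.sum_congr rfl fun k _ => ?_
  rw [map_smul, alpha_psi (by positivity), smul_add]

theorem gammaPlus_psiStar (p : ℕ+ → R) {B T : ℤ} {N : ℕ} (hN : T ≤ B + N) {v : Fock R}
    (hv : v ∈ bounded R B T) {b : ℤ} (hb : B ≤ b) :
    gammaPlus p (psiStar R b v) = psiStar R b (gammaPlus p v) + ∑ k ∈ Finset.range N,
      PowerSeries.coeff (k + 1) (-timesSeries p) • psiStar R (b + ((k : ℤ) + 1)) v := by
  rw [gammaPlus_apply p hN hv, gammaPlus_apply p hN (psiStar_mem_bounded hv hb), map_sum,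
    ← Finset.sum_add_distrib]
  refine Finset.sum_congr rfl fun k _ => ?_
  rw [map_smul, alpha_psiStar (by positivity), smul_sub, map_neg, neg_smul, sub_eq_add_neg]

theorem gammaPlus_vacuum (p : ℕ+ → R) : gammaPlus p (basisVec R Maya.vacuum) = 0 := by
  rw [gammaPlus_apply p (N := 0) (by simp) (vacuum_mem_bounded le_rfl le_rfl)]
  simp

end GammaPlus

end TorusKnotOV

end

noncomputable section

namespace TorusKnotOV

/-! ### Exponentials of locally nilpotent operators -/

section ExpLocNilp

theorem sum_range_antidiagonal {V : Type*} [AddCommMonoid V] (F : ℕ → ℕ → V) (M : ℕ)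
    (hF : ∀ i j, M ≤ i + j → F i j = 0) :
    ∑ n ∈ Finset.range M, ∑ x ∈ Finset.HasAntidiagonal.antidiagonal n, F x.1 x.2 =
      ∑ i ∈ Finset.range M, ∑ j ∈ Finset.range M, F i j := by
  rw [← Finset.sum_product', Finset.sum_sigma']
  refine Finset.sum_bij_ne_zero (fun x _ _ => x.2) ?_ ?_ ?_ ?_
  · rintro ⟨n, i, j⟩ h _
    simp only [Finset.mem_sigma, Finset.mem_range, Finset.HasAntidiagonal.mem_antidiagonal,
      Finset.mem_product] at h ⊢
    lia
  · rintro ⟨n, i, j⟩ h _ ⟨n', i', j'⟩ h' _ e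
    simp only [Finset.mem_sigma, Finset.mem_range, Finset.HasAntidiagonal.mem_antidiagonal] at h h'
    obtain ⟨rfl, rfl⟩ := Prod.mk.inj e
    obtain rfl : n = n' := h.2.symm.trans h'.2
    rfl
  · rintro ⟨i, j⟩ _ h0
    refine ⟨⟨i + j, i, j⟩, ?_, h0, rfl⟩
    simp only [Finset.mem_sigma, Finset.mem_range, Finset.HasAntidiagonal.mem_antidiagonal, and_true]
    by_contra h
    exact h0 (hF i j (not_lt.1 h))
  · intros; rfl

variable {R : Type*} [Field R] {V : Type*} [AddCommGroup V] [Module R V]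

theorem pow_apply_eq_zero {T : Module.End R V} {v : V} {N n : ℕ} (h : (T ^ N) v = 0)
    (hn : N ≤ n) : (T ^ n) v = 0 := by
  rw [← Nat.sub_add_cancel hn, pow_add, Module.End.mul_apply, h, map_zero]

theorem expLocNilp_eq_sum {T : Module.End R (Fock R)} {v : Fock R} {N : ℕ} (h : (T ^ N) v = 0) :
    expLocNilp T v = ∑ n ∈ Finset.range N, ((n ! : R)⁻¹) • (T ^ n) v := by
  refine finsum_eq_sum_of_support_subset _ fun n hn => ?_
  rw [Finset.coe_range, Set.mem_Iio]
  by_contra hN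
  exact hn (by simp only; rw [pow_apply_eq_zero h (not_lt.1 hN), smul_zero])

/-- The operator `∑_{d < C} f_d X_d`. -/
def seriesOp (X : ℕ → Module.End R V) (C : ℕ) (f : PowerSeries R) : Module.End R V :=
  ∑ d ∈ Finset.range C, PowerSeries.coeff d f • X d

theorem seriesOp_apply (X : ℕ → Module.End R V) (C : ℕ) (f : PowerSeries R) (v : V) :
    seriesOp X C f v = ∑ d ∈ Finset.range C, PowerSeries.coeff d f • X d v := by
  simp [seriesOp, LinearMap.sum_apply]

theorem seriesOp_congr (X : ℕ → Module.End R V) {C : ℕ} {f g : PowerSeries R}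
    (h : ∀ d < C, PowerSeries.coeff d f = PowerSeries.coeff d g) :
    seriesOp X C f = seriesOp X C g :=
  Finset.sum_congr rfl fun d hd => by rw [h d (Finset.mem_range.1 hd)]

theorem seriesOp_sum_smul (X : ℕ → Module.End R V) (C : ℕ) (s : Finset ℕ) (c : ℕ → R)
    (f : ℕ → PowerSeries R) :
    seriesOp X C (∑ i ∈ s, c i • f i) = ∑ i ∈ s, c i • seriesOp X C (f i) := by
  simp only [seriesOp, map_sum, Finset.sum_smul, Finset.smul_sum, PowerSeries.coeff_smul,
    smul_assoc]
  exact Finset.sum_comm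

/-- The square of pairs `(j, k)` with both entries below `C` contains pairs of total degree at least
`C`; there `X_{j+k}` kills `v`, so only the triangle of the Cauchy product contributes. -/
theorem seriesOp_mul_apply {X : ℕ → Module.End R V} {C : ℕ} {v : V}
    (hX : ∀ d, C ≤ d → X d v = 0) (g f : PowerSeries R) :
    seriesOp X C (g * f) v = ∑ j ∈ Finset.range C, PowerSeries.coeff j f •
      ∑ k ∈ Finset.range C, PowerSeries.coeff k g • X (j + k) v := by
  rw [mul_comm, seriesOp_apply]
  have h := sum_range_antidiagonal
    (fun i j => (PowerSeries.coeff i f * PowerSeries.coeff j g) • X (i + j) v) C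
    (fun i j hij => by rw [hX _ hij, smul_zero])
  simp only [Finset.smul_sum, smul_smul]
  rw [← h]
  refine Finset.sum_congr rfl fun d _ => ?_
  rw [PowerSeries.coeff_mul, Finset.sum_smul]
  refine Finset.sum_congr rfl fun x hx => ?_
  rw [Finset.HasAntidiagonal.mem_antidiagonal.1 hx]

variable {Γ : Module.End R V} {W : Submodule R V} {X : ℕ → Module.End R V} {C : ℕ}
  {g : PowerSeries R}

/-- The commutator with `Γ` multiplies the symbol `f` by `g`. This replaces operator algebra by
multiplication of power series. -/
theorem apply_seriesOp (hg : PowerSeries.constantCoeff g = 0)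
    (hX : ∀ d, C ≤ d → ∀ w ∈ W, X d w = 0)
    (hΓX : ∀ d, ∀ w ∈ W, Γ (X d w) = X d (Γ w) +
      ∑ k ∈ Finset.range C, PowerSeries.coeff (k + 1) g • X (d + (k + 1)) w)
    (f : PowerSeries R) {w : V} (hw : w ∈ W) :
    Γ (seriesOp X C f w) = seriesOp X C f (Γ w) + seriesOp X C (g * f) w := by
  rw [seriesOp_mul_apply (fun d hd => hX d hd w hw), seriesOp_apply, seriesOp_apply, map_sum,
    ← Finset.sum_add_distrib]
  refine Finset.sum_congr rfl fun d _ => ?_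
  rw [map_smul, hΓX d w hw, smul_add]
  congr 2
  -- The sum over `k ≤ C` is split off at either end: the top term dies because `X_{d+C}` vanishes,
  -- the bottom one because `g` has no constant term.
  have h1 := Finset.sum_range_succ (fun k => PowerSeries.coeff k g • X (d + k) w) C
  have h2 := Finset.sum_range_succ' (fun k => PowerSeries.coeff k g • X (d + k) w) C
  rw [hX (d + C) (Nat.le_add_left _ _) w hw, smul_zero, add_zero] at h1
  rw [PowerSeries.coeff_zero_eq_constantCoeff_apply, hg, zero_smul, add_zero] at h2
  rw [← h1, h2]

/-- The binomial theorem for two commuting operations: letting `Γ` act on `w`, and multiplying the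
symbol by `g`. -/
theorem pow_apply_seriesOp (hg : PowerSeries.constantCoeff g = 0)
    (hΓ : ∀ w ∈ W, Γ w ∈ W) (hX : ∀ d, C ≤ d → ∀ w ∈ W, X d w = 0)
    (hΓX : ∀ d, ∀ w ∈ W, Γ (X d w) = X d (Γ w) +
      ∑ k ∈ Finset.range C, PowerSeries.coeff (k + 1) g • X (d + (k + 1)) w)
    (n : ℕ) : ∀ (f : PowerSeries R), ∀ w ∈ W, (Γ ^ n) (seriesOp X C f w) =
      ∑ x ∈ Finset.HasAntidiagonal.antidiagonal n, n.choose x.1 • seriesOp X C (g ^ x.1 * f) ((Γ ^ x.2) w) := by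
  induction n with
  | zero => intro f w _; simp
  | succ n ih =>
    intro f w hw
    rw [pow_succ, Module.End.mul_apply, apply_seriesOp hg hX hΓX f hw, map_add,
      ih f _ (hΓ w hw), ih (g * f) w hw, Finset.sum_antidiagonal_choose_succ_nsmul
        (fun i j => seriesOp X C (g ^ i * f) ((Γ ^ j) w)) n]
    congr 1
    · refine Finset.sum_congr rfl fun x hx => ?_
      rw [pow_succ, mul_assoc, Nat.choose_symm_of_eq_add (Finset.HasAntidiagonal.mem_antidiagonal.1 hx).symm]

theorem coeff_pow_eq_zero {g : PowerSeries R} (hg : PowerSeries.constantCoeff g = 0) {n i : ℕ}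
    (h : n < i) : PowerSeries.coeff n (g ^ i) = 0 := by
  obtain ⟨h', rfl⟩ := PowerSeries.X_dvd_iff.2 hg
  rw [mul_pow, PowerSeries.coeff_X_pow_mul', if_neg (not_le.2 h)]

variable [CharZero R]

/-- The power series `exp g`. -/
def expOf (g : PowerSeries R) : PowerSeries R := (PowerSeries.exp R).subst g

theorem coeff_expOf {g : PowerSeries R} (hg : PowerSeries.constantCoeff g = 0) {n M : ℕ}
    (h : n < M) : PowerSeries.coeff n (expOf g) =
      ∑ i ∈ Finset.range M, ((i ! : R)⁻¹) * PowerSeries.coeff n (g ^ i) := by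
  rw [expOf, PowerSeries.coeff_subst' (PowerSeries.HasSubst.of_constantCoeff_zero' hg),
    finsum_eq_sum_of_support_subset (s := Finset.range M)]
  · refine Finset.sum_congr rfl fun i _ => ?_
    rw [PowerSeries.coeff_exp, smul_eq_mul]
    simp
  · intro i hi
    rw [Finset.coe_range, Set.mem_Iio]
    by_contra hM
    exact hi (by simp only; rw [coeff_pow_eq_zero hg (by lia), smul_zero])

/-- Since `ad Γ` multiplies symbols by `g`, conjugation by `exp Γ` multiplies them by `exp g`.
Nilpotency holds because `g^i` has no terms of degree below `i`: a binomial term with `i + j ≥ C +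
N` has either `i ≥ C`, and dies by truncation, or `j ≥ N`, and dies because `Γ^N w = 0`. -/
theorem expLocNilp_seriesOp {Γ : Module.End R (Fock R)} {W : Submodule R (Fock R)}
    {X : ℕ → Module.End R (Fock R)}
    (hg : PowerSeries.constantCoeff g = 0)
    (hΓ : ∀ w ∈ W, Γ w ∈ W) (hX : ∀ d, C ≤ d → ∀ w ∈ W, X d w = 0)
    (hΓX : ∀ d, ∀ w ∈ W, Γ (X d w) = X d (Γ w) +
      ∑ k ∈ Finset.range C, PowerSeries.coeff (k + 1) g • X (d + (k + 1)) w)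
    {w : Fock R} (hw : w ∈ W) {N : ℕ} (hN : (Γ ^ N) w = 0) :
    (Γ ^ (C + N)) (seriesOp X C 1 w) = 0 ∧
      expLocNilp Γ (seriesOp X C 1 w) = seriesOp X C (expOf g) (expLocNilp Γ w) := by
  have hW : ∀ j, (Γ ^ j) w ∈ W := fun j => by
    induction j with
    | zero => simpa using hw
    | succ j ih => rw [pow_succ', Module.End.mul_apply]; exact hΓ _ ih
  have hF : ∀ i j, C + N ≤ i + j → seriesOp X C (g ^ i) ((Γ ^ j) w) = 0 := by
    intro i j hij
    by_cases hj : N ≤ j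
    · rw [pow_apply_eq_zero hN hj, map_zero]
    · rw [seriesOp_apply]
      refine Finset.sum_eq_zero fun d hd => ?_
      rw [coeff_pow_eq_zero hg (by have := Finset.mem_range.1 hd; lia), zero_smul]
  have hpow : ∀ n, (Γ ^ n) (seriesOp X C 1 w) = ∑ x ∈ Finset.HasAntidiagonal.antidiagonal n,
      n.choose x.1 • seriesOp X C (g ^ x.1) ((Γ ^ x.2) w) := fun n => by
    simpa using pow_apply_seriesOp hg hΓ hX hΓX n 1 w hw
  have h0 : (Γ ^ (C + N)) (seriesOp X C 1 w) = 0 := by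
    rw [hpow]
    refine Finset.sum_eq_zero fun x hx => ?_
    rw [hF _ _ (Finset.HasAntidiagonal.mem_antidiagonal.1 hx).ge, smul_zero]
  refine ⟨h0, ?_⟩
  have hexp : seriesOp X C (expOf g) = seriesOp X C
      (∑ i ∈ Finset.range (C + N), ((i ! : R)⁻¹) • g ^ i) := by
    refine seriesOp_congr X fun d hd => ?_
    rw [coeff_expOf hg (M := C + N) (by lia), map_sum]
    simp
  rw [expLocNilp_eq_sum h0, hexp, seriesOp_sum_smul, LinearMap.sum_apply,
    expLocNilp_eq_sum (pow_apply_eq_zero hN (Nat.le_add_left N C))]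
  have h := sum_range_antidiagonal
    (fun i j => ((j ! : R)⁻¹ * (i ! : R)⁻¹) • seriesOp X C (g ^ i) ((Γ ^ j) w)) (C + N)
    (fun i j hij => by rw [hF i j hij, smul_zero])
  simp only [LinearMap.smul_apply, map_sum, map_smul, smul_smul]
  rw [← h]
  refine Finset.sum_congr rfl fun n _ => ?_
  rw [hpow, Finset.smul_sum]
  refine Finset.sum_congr rfl fun x hx => ?_
  obtain rfl := Finset.HasAntidiagonal.mem_antidiagonal.1 hx
  rw [← Nat.cast_smul_eq_nsmul R, smul_smul]
  congr 1
  have h1 := Nat.add_choose_mul_factorial_mul_factorial x.1 x.2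
  have h2 : (((x.1 + x.2).choose x.1 : ℕ) : R) * (x.1 ! : R) * (x.2 ! : R) =
      ((x.1 + x.2)! : R) := by rw [Nat.choose_symm_add]; exact_mod_cast h1
  have f1 : (x.1 ! : R) ≠ 0 := Nat.cast_ne_zero.2 (Nat.factorial_ne_zero _)
  have f2 : (x.2 ! : R) ≠ 0 := Nat.cast_ne_zero.2 (Nat.factorial_ne_zero _)
  have f3 : ((x.1 + x.2)! : R) ≠ 0 := Nat.cast_ne_zero.2 (Nat.factorial_ne_zero _)
  field_simp
  rw [← h2]; ring

end ExpLocNilp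

end TorusKnotOV

end

noncomputable section

namespace TorusKnotOV

/-! ### Vacuum expectation values -/

section Vacuum

variable {R : Type*} [CommRing R]

theorem mem_vacuum {k : ℤ} : k ∈ Maya.vacuum.1 ↔ k < 0 := Iff.rfl

theorem psi_vacuum {k : ℤ} (h : k < 0) : psi R k (basisVec R Maya.vacuum) = 0 := psi_of_mem h

theorem psiStar_vacuum {k : ℤ} (h : 0 ≤ k) : psiStar R k (basisVec R Maya.vacuum) = 0 :=
  psiStar_of_notMem (not_lt.2 h)

theorem psi_apply_vacuum {k : ℤ} (h : 0 ≤ k) (v : Fock R) : psi R k v Maya.vacuum = 0 := by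
  obtain ⟨B, T, hv⟩ := exists_mem_bounded v
  refine eq_of_bounded (f := Finsupp.lapply Maya.vacuum ∘ₗ psi R k) (g := 0) (fun S _ _ => ?_) hv
  rw [LinearMap.comp_apply, Finsupp.lapply_apply, LinearMap.zero_apply, psi_basisVec]
  split_ifs with hk
  · rfl
  · have : S.insert k ≠ Maya.vacuum := fun e =>
      absurd (e ▸ Maya.mem_insert.2 (Or.inl rfl) : k ∈ Maya.vacuum.1) (not_lt.2 h)
    rw [Finsupp.smul_apply, basisVec, Finsupp.single_eq_of_ne this.symm, smul_zero]

theorem psiStar_apply_vacuum {k : ℤ} (h : k < 0) (v : Fock R) :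
    psiStar R k v Maya.vacuum = 0 := by
  obtain ⟨B, T, hv⟩ := exists_mem_bounded v
  refine eq_of_bounded (f := Finsupp.lapply Maya.vacuum ∘ₗ psiStar R k) (g := 0)
    (fun S _ _ => ?_) hv
  rw [LinearMap.comp_apply, Finsupp.lapply_apply, LinearMap.zero_apply, psiStar_basisVec]
  split_ifs with hk
  · have : S.erase k ≠ Maya.vacuum := fun e =>
      (Maya.mem_erase.1 (e ▸ mem_vacuum.2 h : k ∈ (S.erase k).1)).2 rfl
    rw [Finsupp.smul_apply, basisVec, Finsupp.single_eq_of_ne this.symm, smul_zero]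
  · rfl

theorem vev_two (i j : ℤ) : psi R i (psiStar R j (basisVec R Maya.vacuum)) Maya.vacuum =
    if i = j then (if i < 0 then 1 else 0) else 0 := by
  by_cases hj : 0 ≤ j
  · rw [psiStar_vacuum hj, map_zero]
    split_ifs <;> first | rfl | lia
  · rw [psi_psiStar, Finsupp.sub_apply, psiStar_apply_vacuum (not_le.1 hj), sub_zero]
    split_ifs <;> first | rfl | lia | simp [basisVec]

/-- Wick's theorem for four fermions. -/
theorem vev_four (i j k l : ℤ) :
    psi R i (psiStar R j (psi R k (psiStar R l (basisVec R Maya.vacuum)))) Maya.vacuum =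
      (if i = j then (if i < 0 then 1 else 0) else 0) *
        (if k = l then (if k < 0 then 1 else 0) else 0) +
      (if i = l then (if i < 0 then 1 else 0) else 0) *
        (if j = k then (if 0 ≤ j then 1 else 0) else 0) := by
  by_cases hl : 0 ≤ l
  · rw [psiStar_vacuum hl, map_zero, map_zero, map_zero]
    split_ifs <;> first | (exfalso; lia) | simp
  -- For `k < 0` the operator `ψ_k` kills the vacuum and the inner pair is a scalar. For `k ≥ 0` it
  -- is moved to the far left instead, where its vacuum component vanishes.
  by_cases hk : k < 0
  · rw [psi_psiStar k l, psi_vacuum hk, map_zero, sub_zero]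
    have h2 := vev_two (R := R) i j
    by_cases hkl : k = l
    · rw [if_pos hkl, if_pos hkl, h2, if_pos hk]
      have : (if j = k then (if 0 ≤ j then (1 : R) else 0) else 0) = 0 := by
        split_ifs <;> first | rfl | lia
      rw [this]; ring
    · rw [if_neg hkl, if_neg hkl, map_zero, map_zero]
      have : (if j = k then (if 0 ≤ j then (1 : R) else 0) else 0) = 0 := by
        split_ifs <;> first | rfl | lia
      rw [this]; simp
  · have hkl : k ≠ l := by lia
    rw [psiStar_psi k j, map_sub, psi_psi i k, sub_neg_eq_add, Finsupp.add_apply,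
      psi_apply_vacuum (not_lt.1 hk), add_zero, if_neg hkl, mul_zero, zero_add]
    by_cases hjk : j = k
    · subst hjk
      rw [if_pos rfl, if_pos rfl, vev_two, if_pos (not_lt.1 hk), mul_one]
    · rw [if_neg (Ne.symm hjk), if_neg hjk]
      simp

end Vacuum

/-! ### Conjugation of fermion products by the exponential -/

section Conjugation

variable {R : Type*} [Field R]

theorem expLocNilp_mem_bounded (p : ℕ+ → R) {B T : ℤ} {v : Fock R} (hv : v ∈ bounded R B T)
    {N : ℕ} (hN : (gammaPlus p ^ N) v = 0) : expLocNilp (gammaPlus p) v ∈ bounded R B T := by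
  rw [expLocNilp_eq_sum hN]
  have h : ∀ n, (gammaPlus p ^ n) v ∈ bounded R B T := fun n => by
    induction n with
    | zero => simpa using hv
    | succ n ih => rw [pow_succ', Module.End.mul_apply]; exact gammaPlus_mem_bounded p ih
  exact Submodule.sum_mem _ fun n _ => Submodule.smul_mem _ _ (h n)

theorem expLocNilp_vacuum (p : ℕ+ → R) :
    expLocNilp (gammaPlus p) (basisVec R Maya.vacuum) = basisVec R Maya.vacuum := by
  rw [expLocNilp_eq_sum (N := 1) (by simpa using gammaPlus_vacuum p)]
  simp

theorem expLocNilp_add {T : Module.End R (Fock R)} {v w : Fock R} {N N' : ℕ}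
    (hv : (T ^ N) v = 0) (hw : (T ^ N') w = 0) :
    (T ^ (N + N')) (v + w) = 0 ∧ expLocNilp T (v + w) = expLocNilp T v + expLocNilp T w := by
  have hv' := pow_apply_eq_zero hv (Nat.le_add_right N N')
  have hw' := pow_apply_eq_zero hw (Nat.le_add_left N' N)
  have h : (T ^ (N + N')) (v + w) = 0 := by rw [map_add, hv', hw', add_zero]
  refine ⟨h, ?_⟩
  rw [expLocNilp_eq_sum h, expLocNilp_eq_sum hv', expLocNilp_eq_sum hw', ← Finset.sum_add_distrib]
  simp

theorem expLocNilp_sum_smul {ι : Type*} {T : Module.End R (Fock R)} (s : Finset ι) (c : ι → R)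
    (v : ι → Fock R) (hv : ∀ i ∈ s, ∃ N, (T ^ N) (v i) = 0) :
    (∃ N, (T ^ N) (∑ i ∈ s, c i • v i) = 0) ∧
      expLocNilp T (∑ i ∈ s, c i • v i) = ∑ i ∈ s, c i • expLocNilp T (v i) := by
  classical
  induction s using Finset.induction_on with
  | empty => exact ⟨⟨0, by simp⟩, by simp [expLocNilp]⟩
  | insert a s ha ih =>
    obtain ⟨⟨N, hN⟩, h⟩ := ih fun i hi => hv i (Finset.mem_insert_of_mem hi)
    obtain ⟨N', hN'⟩ := hv a (Finset.mem_insert_self _ _)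
    have h1 : (T ^ N') (c a • v a) = 0 := by rw [map_smul, hN', smul_zero]
    have h2 := expLocNilp_add h1 hN
    rw [Finset.sum_insert ha, Finset.sum_insert ha]
    refine ⟨⟨_, h2.1⟩, ?_⟩
    rw [h2.2, h, expLocNilp_eq_sum h1, expLocNilp_eq_sum hN', Finset.smul_sum]
    simp only [map_smul, smul_comm (c a)]

/-- The coefficient of `X^n`, `n ∈ ℤ`. -/
def coeffZ (f : PowerSeries R) (n : ℤ) : R := if 0 ≤ n then PowerSeries.coeff n.toNat f else 0

theorem coeffZ_natCast (f : PowerSeries R) (n : ℕ) : coeffZ f n = PowerSeries.coeff n f := by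
  simp [coeffZ]

theorem coeffZ_of_neg (f : PowerSeries R) {n : ℤ} (h : n < 0) : coeffZ f n = 0 := by
  rw [coeffZ, if_neg (not_le.2 h)]

theorem sum_Ico_ite_neg {B T : ℤ} (hT : 0 ≤ T) (f : ℤ → R) :
    ∑ i ∈ Finset.Ico B T, f i * (if i < 0 then 1 else 0) = ∑ i ∈ Finset.Ico B 0, f i := by
  simp only [mul_ite, mul_one, mul_zero]
  rw [← Finset.sum_filter]
  refine Finset.sum_congr ?_ fun _ _ => rfl
  ext i
  simp only [Finset.mem_filter, Finset.mem_Ico]; lia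

theorem sum_Ico_ite_nonneg {B T : ℤ} (hB : B ≤ 0) (f : ℤ → R) :
    ∑ i ∈ Finset.Ico B T, f i * (if 0 ≤ i then 1 else 0) = ∑ i ∈ Finset.Ico 0 T, f i := by
  simp only [mul_ite, mul_one, mul_zero]
  rw [← Finset.sum_filter]
  refine Finset.sum_congr ?_ fun _ _ => rfl
  ext i
  simp only [Finset.mem_filter, Finset.mem_Ico]; lia

theorem sum_sum_ite_eq (s : Finset ℤ) (f g χ : ℤ → R) :
    ∑ i ∈ s, ∑ j ∈ s, f i * g j * (if i = j then χ i else 0) = ∑ i ∈ s, f i * g i * χ i := by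
  refine Finset.sum_congr rfl fun i hi => ?_
  simp only [mul_ite, mul_zero]
  rw [Finset.sum_ite_eq, if_pos hi]

theorem sum_comm_pairs {M : Type*} [AddCommMonoid M] (s s' t t' : Finset ℤ)
    (f : ℤ → ℤ → ℤ → ℤ → M) : ∑ i ∈ s, ∑ j ∈ s', ∑ k ∈ t, ∑ l ∈ t', f i j k l =
      ∑ k ∈ t, ∑ l ∈ t', ∑ i ∈ s, ∑ j ∈ s', f i j k l := by
  have := Finset.sum_comm (s := s ×ˢ s') (t := t ×ˢ t') (f := fun x y => f x.1 x.2 y.1 y.2)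
  simpa only [Finset.sum_product] using this

theorem sum_wick (s : Finset ℤ) (f g f' g' : ℤ → R) (F F' G G' : ℤ → ℤ → R) :
    ∑ i ∈ s, f i * ∑ j ∈ s, g j * ∑ k ∈ s, f' k * ∑ l ∈ s, g' l *
        (F i j * F' k l + G i l * G' j k) =
      (∑ i ∈ s, ∑ j ∈ s, f i * g j * F i j) * (∑ k ∈ s, ∑ l ∈ s, f' k * g' l * F' k l) +
      (∑ i ∈ s, ∑ l ∈ s, f i * g' l * G i l) * (∑ j ∈ s, ∑ k ∈ s, g j * f' k * G' j k) := by
  have comm3 : ∀ t : ℤ → ℤ → ℤ → R, ∑ j ∈ s, ∑ k ∈ s, ∑ l ∈ s, t j k l =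
      ∑ l ∈ s, ∑ j ∈ s, ∑ k ∈ s, t j k l := fun t => by
    have := Finset.sum_comm (s := s ×ˢ s) (t := s) (f := fun x y => t x.1 x.2 y)
    simpa only [Finset.sum_product] using this
  simp only [mul_add, Finset.sum_add_distrib]
  congr 1
  · simp only [Finset.mul_sum, Finset.sum_mul]
    rw [sum_comm_pairs]
    simp only [mul_left_comm, mul_assoc]
  · simp only [Finset.mul_sum, Finset.sum_mul]
    simp only [comm3 (fun j k l => _ * (g j * (f' k * (g' l * (G _ l * G' j k)))))]
    rw [sum_comm_pairs]
    simp only [mul_left_comm, mul_assoc]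

variable [CharZero R]

/-- The case `X_d = ψ_{a-d}` of `expLocNilp_seriesOp`, with symbol `1` for `ψ_a` itself, reindexed
by `i = a - d`. Indices `i > a` are harmless because `coeffZ` vanishes at negative arguments, and
`ψ_{a-d}` with `a - d < B` kills the subspace. -/
theorem expLocNilp_psi (p : ℕ+ → R) {B T a : ℤ} {v : Fock R} (hv : v ∈ bounded R B T)
    (ha : a < T) (hnil : ∃ N, (gammaPlus p ^ N) v = 0) :
    (∃ N, (gammaPlus p ^ N) (psi R a v) = 0) ∧
      expLocNilp (gammaPlus p) (psi R a v) = ∑ i ∈ Finset.Ico B T,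
        coeffZ (expOf (timesSeries p)) (a - i) • psi R i (expLocNilp (gammaPlus p) v) := by
  obtain ⟨N, hN⟩ := hnil
  have hX : ∀ d : ℕ, (T - B).toNat + 1 ≤ d → ∀ w ∈ bounded R B T, psi R (a - d) w = 0 :=
    fun d hd w hw => psi_eq_zero hw (by lia)
  have h := expLocNilp_seriesOp (Γ := gammaPlus p) (X := fun d : ℕ => psi R (a - d))
    (C := (T - B).toNat + 1) (constantCoeff_timesSeries p)
    (fun w hw => gammaPlus_mem_bounded p hw) hX (fun d w hw => by
      rw [gammaPlus_psi p (N := (T - B).toNat + 1) (by lia) hw (by lia)]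
      congr 1
      refine Finset.sum_congr rfl fun k _ => ?_
      congr 3
      push_cast; ring) hv hN
  have h1 : seriesOp (fun d : ℕ => psi R (a - d)) ((T - B).toNat + 1) 1 v = psi R a v := by
    rw [seriesOp_apply, Finset.sum_range_succ']
    simp [PowerSeries.coeff_one]
  rw [h1] at h
  refine ⟨⟨_, h.1⟩, ?_⟩
  rw [h.2, seriesOp_apply]
  have hw := expLocNilp_mem_bounded p hv hN
  symm
  refine Finset.sum_bij_ne_zero (fun i _ _ => (a - i).toNat) ?_ ?_ ?_ ?_
  · intro i hi h0
    rw [Finset.mem_Ico] at hi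
    rw [Finset.mem_range]; lia
  · intro i hi h0 j hj h0' e
    have hi' : 0 ≤ a - i := by
      by_contra hc
      exact h0 (by rw [coeffZ_of_neg _ (not_le.1 hc), zero_smul])
    have hj' : 0 ≤ a - j := by
      by_contra hc
      exact h0' (by rw [coeffZ_of_neg _ (not_le.1 hc), zero_smul])
    lia
  · intro d _ h0
    have hB : B ≤ a - d := by
      by_contra hc
      exact h0 (by rw [psi_eq_zero hw (not_le.1 hc), smul_zero])
    refine ⟨a - d, Finset.mem_Ico.2 ⟨hB, by lia⟩, ?_, by lia⟩
    rw [sub_sub_cancel, coeffZ_natCast]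
    exact h0
  · intro i hi h0
    have hi' : 0 ≤ a - i := by
      by_contra hc
      exact h0 (by rw [coeffZ_of_neg _ (not_le.1 hc), zero_smul])
    rw [coeffZ, if_pos hi']
    congr 3
    lia

/-- The dual case: the commutator shifts the index upwards with a minus sign, hence the symbol `exp
(-g)`. -/
theorem expLocNilp_psiStar (p : ℕ+ → R) {B T b : ℤ} {v : Fock R} (hv : v ∈ bounded R B T)
    (hb : B ≤ b) (hnil : ∃ N, (gammaPlus p ^ N) v = 0) :
    (∃ N, (gammaPlus p ^ N) (psiStar R b v) = 0) ∧
      expLocNilp (gammaPlus p) (psiStar R b v) = ∑ j ∈ Finset.Ico B T,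
        coeffZ (expOf (-timesSeries p)) (j - b) • psiStar R j (expLocNilp (gammaPlus p) v) := by
  obtain ⟨N, hN⟩ := hnil
  have hX : ∀ d : ℕ, (T - B).toNat + 1 ≤ d → ∀ w ∈ bounded R B T, psiStar R (b + d) w = 0 :=
    fun d hd w hw => psiStar_eq_zero hw (by lia)
  have h := expLocNilp_seriesOp (Γ := gammaPlus p) (X := fun d : ℕ => psiStar R (b + d))
    (C := (T - B).toNat + 1) (g := -timesSeries p)
    (by rw [map_neg, constantCoeff_timesSeries, neg_zero])
    (fun w hw => gammaPlus_mem_bounded p hw) hX (fun d w hw => by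
      rw [gammaPlus_psiStar p (N := (T - B).toNat + 1) (by lia) hw (by lia)]
      congr 1
      refine Finset.sum_congr rfl fun k _ => ?_
      congr 3
      push_cast; ring) hv hN
  have h1 : seriesOp (fun d : ℕ => psiStar R (b + d)) ((T - B).toNat + 1) 1 v =
      psiStar R b v := by
    rw [seriesOp_apply, Finset.sum_range_succ']
    simp [PowerSeries.coeff_one]
  rw [h1] at h
  refine ⟨⟨_, h.1⟩, ?_⟩
  rw [h.2, seriesOp_apply]
  have hw := expLocNilp_mem_bounded p hv hN
  symm
  refine Finset.sum_bij_ne_zero (fun j _ _ => (j - b).toNat) ?_ ?_ ?_ ?_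
  · intro i hi h0
    rw [Finset.mem_Ico] at hi
    rw [Finset.mem_range]; lia
  · intro i hi h0 j hj h0' e
    have hi' : 0 ≤ i - b := by
      by_contra hc
      exact h0 (by rw [coeffZ_of_neg _ (not_le.1 hc), zero_smul])
    have hj' : 0 ≤ j - b := by
      by_contra hc
      exact h0' (by rw [coeffZ_of_neg _ (not_le.1 hc), zero_smul])
    lia
  · intro d _ h0
    have hB : b + d < T := by
      by_contra hc
      exact h0 (by rw [psiStar_eq_zero hw (not_lt.1 hc), smul_zero])
    refine ⟨b + d, Finset.mem_Ico.2 ⟨by lia, hB⟩, ?_, by lia⟩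
    rw [add_sub_cancel_left, coeffZ_natCast]
    exact h0
  · intro j hj h0
    have hj' : 0 ≤ j - b := by
      by_contra hc
      exact h0 (by rw [coeffZ_of_neg _ (not_le.1 hc), zero_smul])
    rw [coeffZ, if_pos hj']
    congr 3
    lia

theorem expLocNilp_two (p : ℕ+ → R) {B T a b : ℤ} (hB : B ≤ 0) (hT : 0 ≤ T) (ha : a < T)
    (hb : B ≤ b) :
    (∃ N, (gammaPlus p ^ N) (psi R a (psiStar R b (basisVec R Maya.vacuum))) = 0) ∧
      expLocNilp (gammaPlus p) (psi R a (psiStar R b (basisVec R Maya.vacuum))) Maya.vacuum =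
        ∑ i ∈ Finset.Ico B 0, coeffZ (expOf (timesSeries p)) (a - i) *
          coeffZ (expOf (-timesSeries p)) (i - b) := by
  have h0 := vacuum_mem_bounded (R := R) hB hT
  have h1 := expLocNilp_psiStar p h0 hb ⟨1, by simpa using gammaPlus_vacuum p⟩
  have h2 := expLocNilp_psi p (psiStar_mem_bounded h0 hb) ha h1.1
  refine ⟨h2.1, ?_⟩
  rw [h2.2, h1.2, expLocNilp_vacuum, ← sum_Ico_ite_neg hT]
  rw [← sum_sum_ite_eq (Finset.Ico B T)]
  simp only [map_sum, map_smul, Finsupp.finsetSum_apply, Finsupp.smul_apply, vev_two, smul_eq_mul,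
    Finset.mul_sum, mul_assoc]

/-- The exponential is pushed through all four fermions and then fixes the vacuum, so Wick's theorem
applies to the conjugated fermions. Contractions of type `ψ ψ^*` run over `i < 0`, those of type
`ψ^* ψ` over `j ≥ 0`. -/
theorem expLocNilp_four (p : ℕ+ → R) {B T a b c d : ℤ} (hB : B ≤ 0) (hT : 0 ≤ T) (ha : a < T)
    (hb : B ≤ b) (hc : c < T) (hd : B ≤ d) :
    (∃ N, (gammaPlus p ^ N)
      (psi R a (psiStar R b (psi R c (psiStar R d (basisVec R Maya.vacuum))))) = 0) ∧
      expLocNilp (gammaPlus p)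
        (psi R a (psiStar R b (psi R c (psiStar R d (basisVec R Maya.vacuum))))) Maya.vacuum =
      (∑ i ∈ Finset.Ico B 0, coeffZ (expOf (timesSeries p)) (a - i) *
          coeffZ (expOf (-timesSeries p)) (i - b)) *
        (∑ i ∈ Finset.Ico B 0, coeffZ (expOf (timesSeries p)) (c - i) *
          coeffZ (expOf (-timesSeries p)) (i - d)) +
      (∑ i ∈ Finset.Ico B 0, coeffZ (expOf (timesSeries p)) (a - i) *
          coeffZ (expOf (-timesSeries p)) (i - d)) *
        (∑ j ∈ Finset.Ico 0 T, coeffZ (expOf (-timesSeries p)) (j - b) *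
          coeffZ (expOf (timesSeries p)) (c - j)) := by
  have h0 := vacuum_mem_bounded (R := R) hB hT
  have h1 := expLocNilp_psiStar p h0 hd ⟨1, by simpa using gammaPlus_vacuum p⟩
  have m1 := psiStar_mem_bounded h0 hd
  have h2 := expLocNilp_psi p m1 hc h1.1
  have m2 := psi_mem_bounded m1 hc
  have h3 := expLocNilp_psiStar p m2 hb h2.1
  have h4 := expLocNilp_psi p (psiStar_mem_bounded m2 hb) ha h3.1
  refine ⟨h4.1, ?_⟩
  rw [h4.2, h3.2, h2.2, h1.2, expLocNilp_vacuum]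
  rw [← sum_Ico_ite_neg hT, ← sum_Ico_ite_neg hT, ← sum_Ico_ite_neg hT, ← sum_Ico_ite_nonneg hB]
  rw [← sum_sum_ite_eq (Finset.Ico B T), ← sum_sum_ite_eq (Finset.Ico B T),
    ← sum_sum_ite_eq (Finset.Ico B T), ← sum_sum_ite_eq (Finset.Ico B T)]
  simp only [map_sum, map_smul, Finsupp.finsetSum_apply, Finsupp.smul_apply, vev_four, smul_eq_mul]
  exact sum_wick _ _ _ _ _ _ _ _ _

end Conjugation

end TorusKnotOV

end

noncomputable section

namespace TorusKnotOV

/-! ### The operator `exp (b ħ 𝓕₂)` -/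

section ExpF2

theorem opE_self_basisVec {R : Type*} [CommRing R] (l : ℤ) (S : Maya) [Decidable (l ∈ S.1)] :
    opE R l l (basisVec R S) =
      (if 0 ≤ l then (if l ∈ S.1 then (1 : R) else 0) else (if l ∈ S.1 then 0 else -1)) •
        basisVec R S := by
  have h1 : l ∈ S.1 → psi R l (psiStar R l (basisVec R S)) = basisVec R S := fun h => by
    rw [psi_psiStar, if_pos rfl, psi_of_mem h, map_zero, sub_zero]
  have h2 : l ∉ S.1 → psiStar R l (psi R l (basisVec R S)) = basisVec R S := fun h => by
    rw [psiStar_psi, if_pos rfl, psiStar_of_notMem h, map_zero, sub_zero]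
  unfold opE
  split_ifs with h0 hl hl
  · rw [Module.End.mul_apply, h1 hl, one_smul]
  · rw [Module.End.mul_apply, psiStar_of_notMem hl, map_zero, zero_smul]
  · rw [LinearMap.neg_apply, Module.End.mul_apply, psi_of_mem hl, map_zero, neg_zero, zero_smul]
  · rw [LinearMap.neg_apply, Module.End.mul_apply, h2 hl, neg_smul, one_smul]

variable {K : Type*} [Field K]

/-- The eigenvalue `k²/2` of the half-integer `k = l + 1/2`. -/
def halfSq (K : Type*) [Field K] (l : ℤ) : K := ((l : K) + 1 / 2) ^ 2 / 2

/-- The eigenvalue of `𝓕₂` on a wedge product. -/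
def eigenF2 (K : Type*) [Field K] (S : Maya) : K := opF2 K (basisVec K S) S

open Classical in
theorem eigenF2_eq_sum {S : Maya} {B T : ℤ} (h1 : Set.Iio B ⊆ S.1) (h2 : S.1 ⊆ Set.Iio T)
    (hB : B ≤ 0) (hT : 0 ≤ T) : eigenF2 K S = ∑ l ∈ Finset.Ico B T, halfSq K l *
      (if 0 ≤ l then (if l ∈ S.1 then (1 : K) else 0) else (if l ∈ S.1 then 0 else -1)) := by
  rw [eigenF2, opF2, opOfBasis_basisVec, finsum_eq_sum_of_support_subset (s := Finset.Ico B T)]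
  · rw [Finsupp.finsetSum_apply]
    refine Finset.sum_congr rfl fun l _ => ?_
    rw [opE_self_basisVec, Finsupp.smul_apply, Finsupp.smul_apply]
    simp [basisVec, halfSq]
  · intro l hl
    rw [Finset.coe_Ico, Set.mem_Ico]
    rw [Function.mem_support, opE_self_basisVec] at hl
    constructor
    · by_contra h
      rw [if_neg (by lia), if_pos (h1 (not_le.1 h)), zero_smul, smul_zero] at hl
      exact hl rfl
    · by_contra h
      rw [if_pos (by lia), if_neg (fun h' => h (h2 h')), zero_smul, smul_zero] at hl
      exact hl rfl

/-- For `k ≥ 0` a particle of weight `k²/2` appears; for `k < 0` a hole, counted with the opposite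
sign, disappears. The change is the same in both cases. -/
theorem eigenF2_insert {S : Maya} {k : ℤ} (hk : k ∉ S.1) :
    eigenF2 K (S.insert k) = eigenF2 K S + halfSq K k := by
  classical
  obtain ⟨B, T, h1, h2⟩ := S.exists_bounds
  have h1' : Set.Iio (min B 0) ⊆ S.1 := (Set.Iio_subset_Iio (min_le_left _ _)).trans h1
  have h2' : S.1 ⊆ Set.Iio (max (max T 0) (k + 1)) :=
    h2.trans (Set.Iio_subset_Iio (by lia))
  have hB : min B 0 ≤ k := by
    by_contra h
    exact hk (h1' (not_le.1 h))
  rw [eigenF2_eq_sum h1' h2' (by lia) (by lia), eigenF2_eq_sum (S := S.insert k)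
    (h1'.trans (Set.subset_insert _ _)) (Set.insert_subset (by rw [Set.mem_Iio]; lia) h2') (by lia)
    (by lia), ← sub_eq_iff_eq_add', ← Finset.sum_sub_distrib]
  rw [Finset.sum_eq_single_of_mem k (Finset.mem_Ico.2 ⟨hB, by lia⟩)]
  · simp only [Maya.mem_insert, hk, or_false]
    split_ifs <;> simp_all
  · intro l _ hl
    simp only [Maya.mem_insert, hl, false_or, sub_self]

theorem eigenF2_erase {S : Maya} {k : ℤ} (hk : k ∈ S.1) :
    eigenF2 K (S.erase k) = eigenF2 K S - halfSq K k := by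
  have h := eigenF2_insert (K := K) (S := S.erase k) (k := k) (fun h => h.2 rfl)
  rw [Maya.insert_erase hk] at h
  rw [h, add_sub_cancel_right]

theorem eigenF2_vacuum : eigenF2 K Maya.vacuum = 0 := by
  rw [eigenF2_eq_sum (B := 0) (T := 0) (Set.Subset.refl (Set.Iio (0 : ℤ)))
    (Set.Subset.refl (Set.Iio (0 : ℤ))) le_rfl le_rfl]
  simp

variable [CharZero K]

theorem hexp_add (x y : K) : hexp (x + y) = hexp x * hexp y := by
  rw [hexp, hexp, hexp, ← PowerSeries.exp_mul_exp_eq_exp_add, PowerSeries.coe_mul]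

theorem hexp_zero : hexp (0 : K) = 1 := by
  simp [hexp]

theorem expF2_basisVec (b : K) (S : Maya) : expF2 b (basisVec (LaurentSeries K) S) =
    hexp (b * eigenF2 K S) • basisVec (LaurentSeries K) S := opOfBasis_basisVec _ S

theorem expF2_psi (b : K) (k : ℤ) (v : Fock (LaurentSeries K)) :
    expF2 b (psi _ k v) = hexp (b * halfSq K k) • psi _ k (expF2 b v) := by
  have h : expF2 b * psi _ k = hexp (b * halfSq K k) • (psi _ k * expF2 b) := by
    refine end_ext fun S => ?_
    rw [LinearMap.smul_apply, Module.End.mul_apply, Module.End.mul_apply, expF2_basisVec, map_smul]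
    by_cases hk : k ∈ S.1
    · rw [psi_of_mem hk]; simp
    · rw [psi_of_notMem hk, map_zsmul, expF2_basisVec, eigenF2_insert hk, mul_add, hexp_add,
        smul_smul, smul_comm (_ : LaurentSeries K) (_ : ℤ), mul_comm]
  exact LinearMap.congr_fun h v

theorem expF2_psiStar (b : K) (k : ℤ) (v : Fock (LaurentSeries K)) :
    expF2 b (psiStar _ k v) = hexp (-(b * halfSq K k)) • psiStar _ k (expF2 b v) := by
  have h : expF2 b * psiStar _ k = hexp (-(b * halfSq K k)) • (psiStar _ k * expF2 b) := by
    refine end_ext fun S => ?_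
    rw [LinearMap.smul_apply, Module.End.mul_apply, Module.End.mul_apply, expF2_basisVec, map_smul]
    by_cases hk : k ∈ S.1
    · rw [psiStar_of_mem hk, map_zsmul, expF2_basisVec, eigenF2_erase hk, mul_sub, sub_eq_add_neg,
        hexp_add, smul_smul, smul_comm (_ : LaurentSeries K) (_ : ℤ), mul_comm]
    · rw [psiStar_of_notMem hk]; simp
  exact LinearMap.congr_fun h v

theorem expF2_vacuum (b : K) : expF2 b (basisVec (LaurentSeries K) Maya.vacuum) =
    basisVec (LaurentSeries K) Maya.vacuum := by
  rw [expF2_basisVec, eigenF2_vacuum, mul_zero, hexp_zero, one_smul]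

/-- The factor `exp (b ħ ((k + m)² - k²) / 2)`, where `k` is shifted by `1/2`. -/
def shiftFactor (b : K) (m k : ℤ) : LaurentSeries K := hexp (b * (halfSq K (k + m) - halfSq K k))

theorem expF2_psi_psiStar (b : K) (m k : ℤ) (v : Fock (LaurentSeries K)) :
    expF2 b (psi _ (k + m) (psiStar _ k v)) =
      shiftFactor b m k • psi _ (k + m) (psiStar _ k (expF2 b v)) := by
  rw [expF2_psi, expF2_psiStar, map_smul, smul_smul, ← hexp_add, shiftFactor]
  congr 2; ring

end ExpF2

/-! ### One- and two-particle expectation values -/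

section TwoParticle

variable {K : Type*} [Field K] [CharZero K]

instance : CharZero (LaurentSeries K) :=
  charZero_of_injective_ringHom (f := (HahnSeries.C : K →+* LaurentSeries K))
    HahnSeries.C_injective

/-- The functional `v ↦ ⟨exp (∑ α_i p_i / i) exp (b ħ 𝓕₂) v⟩`. -/
def vevExp (p : ℕ+ → LaurentSeries K) (b : K) (v : Fock (LaurentSeries K)) : LaurentSeries K :=
  expLocNilp (gammaPlus p) (expF2 b v) Maya.vacuum

/-- The matrix element of `exp (∑ α_i p_i / i) exp (b ħ 𝓕₂) α_{-m}` conjugated to the left. -/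
def conjAlpha (p : ℕ+ → LaurentSeries K) (b : K) (I : Finset ℤ) (m i j : ℤ) : LaurentSeries K :=
  ∑ k ∈ I, shiftFactor b m k * (coeffZ (expOf (timesSeries p)) (k + m - i) *
    coeffZ (expOf (-timesSeries p)) (j - k))

theorem vevExp_vacuum (p : ℕ+ → LaurentSeries K) (b : K) :
    vevExp p b (basisVec _ Maya.vacuum) = 1 := by
  rw [vevExp, expF2_vacuum, expLocNilp_vacuum]
  simp [basisVec]

/-- The indices `-m ≤ k < 0` would suffice. The longer ranges depending on the auxiliary `n` are
chosen so that the disconnected product in `vevExp_two` can be recognised literally. -/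
theorem vevExp_one (p : ℕ+ → LaurentSeries K) (b : K) {m n : ℤ} (hm : 0 < m) (hn : 0 < n) :
    vevExp p b (alpha _ (-m) (basisVec _ Maya.vacuum)) =
      ∑ i ∈ Finset.Ico (-(m + n)) 0, conjAlpha p b (Finset.Ico (-(m + n)) n) m i i := by
  rw [alpha_apply (by lia) (vacuum_mem_bounded le_rfl le_rfl) (I := Finset.Ico (-(m + n)) n)
    (fun l h1 h2 => Finset.mem_Ico.2 ⟨by lia, by lia⟩), vevExp, map_sum]
  simp only [sub_neg_eq_add, expF2_psi_psiStar, expF2_vacuum]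
  have h2 := fun k (hk : k ∈ Finset.Ico (-(m + n)) n) =>
    expLocNilp_two p (B := -(m + n)) (T := m + n) (a := k + m) (b := k) (by lia) (by lia)
      (by rw [Finset.mem_Ico] at hk; lia) (by rw [Finset.mem_Ico] at hk; lia)
  rw [(expLocNilp_sum_smul _ _ _ fun k hk => (h2 k hk).1).2]
  simp only [Finsupp.finsetSum_apply, Finsupp.smul_apply, conjAlpha]
  rw [Finset.sum_comm]
  refine Finset.sum_congr rfl fun k hk => ?_
  rw [(h2 k hk).2, smul_eq_mul, Finset.mul_sum]

/-- The nilpotency statement is kept beside the formula because `expLocNilp` is additive only on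
vectors where the operator is nilpotent; see `vevExp_add`. -/
theorem vevExp_two (p : ℕ+ → LaurentSeries K) (b : K) {m n : ℤ} (hm : 0 < m) (hn : 0 < n) :
    (∃ N, (gammaPlus p ^ N)
      (expF2 b (alpha _ (-m) (alpha _ (-n) (basisVec _ Maya.vacuum)))) = 0) ∧
    vevExp p b (alpha _ (-m) (alpha _ (-n) (basisVec _ Maya.vacuum))) =
      vevExp p b (alpha _ (-m) (basisVec _ Maya.vacuum)) *
        vevExp p b (alpha _ (-n) (basisVec _ Maya.vacuum)) +
      ∑ i ∈ Finset.Ico (-(m + n)) 0, ∑ j ∈ Finset.Ico 0 (m + n),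
        conjAlpha p b (Finset.Ico (-(m + n)) n) m i j *
          conjAlpha p b (Finset.Ico (-(m + n)) m) n j i := by
  have hv := vacuum_mem_bounded (R := LaurentSeries K) (B := -n) (T := n) (by lia) (by lia)
  have hα : alpha _ (-n) (basisVec _ Maya.vacuum) ∈ bounded (LaurentSeries K) (-n) n := by
    rw [alpha_apply (by lia) (vacuum_mem_bounded le_rfl le_rfl) (I := Finset.Ico (-n) 0)
      (fun l h1 h2 => Finset.mem_Ico.2 ⟨by lia, by lia⟩)]
    refine Submodule.sum_mem _ fun l hl => ?_
    rw [Finset.mem_Ico] at hl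
    exact psi_mem_bounded (psiStar_mem_bounded hv (by lia)) (by lia)
  have e1 := vevExp_one p b hm hn
  have e2 := vevExp_one p b hn hm
  rw [add_comm n m] at e2
  rw [e1, e2]
  have hE : expF2 b (alpha _ (-m) (alpha _ (-n) (basisVec _ Maya.vacuum))) =
      ∑ x ∈ Finset.Ico (-(m + n)) n ×ˢ Finset.Ico (-(m + n)) m,
        (shiftFactor b m x.1 * shiftFactor b n x.2) • psi _ (x.1 + m) (psiStar _ x.1
          (psi _ (x.2 + n) (psiStar _ x.2 (basisVec _ Maya.vacuum)))) := by
    rw [alpha_apply (by lia) hα (I := Finset.Ico (-(m + n)) n)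
      (fun l h1 h2 => Finset.mem_Ico.2 ⟨by lia, by lia⟩),
      alpha_apply (k := -n) (by lia) (vacuum_mem_bounded le_rfl le_rfl)
        (I := Finset.Ico (-(m + n)) m) (fun l h1 h2 => Finset.mem_Ico.2 ⟨by lia, by lia⟩)]
    simp only [sub_neg_eq_add, map_sum, expF2_psi_psiStar, expF2_vacuum, map_smul, smul_smul]
    rw [Finset.sum_product]
  have h4 := fun k (hk : k ∈ Finset.Ico (-(m + n)) n) l (hl : l ∈ Finset.Ico (-(m + n)) m) =>
    expLocNilp_four p (B := -(m + n)) (T := m + n) (a := k + m) (b := k) (c := l + n) (d := l)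
      (by lia) (by lia) (by rw [Finset.mem_Ico] at hk; lia) (by rw [Finset.mem_Ico] at hk; lia)
      (by rw [Finset.mem_Ico] at hl; lia) (by rw [Finset.mem_Ico] at hl; lia)
  have h5 := fun x (hx : x ∈ Finset.Ico (-(m + n)) n ×ˢ Finset.Ico (-(m + n)) m) =>
    (h4 x.1 (Finset.mem_product.1 hx).1 x.2 (Finset.mem_product.1 hx).2).1
  rw [vevExp, hE]
  refine ⟨(expLocNilp_sum_smul _ _ _ h5).1, ?_⟩
  rw [(expLocNilp_sum_smul _ _ _ h5).2]
  rw [Finsupp.finsetSum_apply, Finset.sum_product]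
  simp only [Finsupp.smul_apply, smul_eq_mul]
  rw [Finset.sum_congr rfl fun k hk => Finset.sum_congr rfl fun l hl => by rw [(h4 k hk l hl).2]]
  -- The contraction within each pair factors into the product of the two one-operator values; the
  -- contraction across the pairs is the connected exchange term.
  simp only [mul_add, Finset.sum_add_distrib]
  congr 1
  · simp only [conjAlpha]
    rw [Finset.sum_comm (s := Finset.Ico (-(m + n)) 0), Finset.sum_comm (s := Finset.Ico (-(m + n)) 0), 
      Finset.sum_mul_sum]
    refine Finset.sum_congr rfl fun k _ => Finset.sum_congr rfl fun l _ => ?_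
    rw [← Finset.mul_sum, ← Finset.mul_sum]
    ring
  · simp only [conjAlpha, Finset.sum_mul_sum]
    simp only [Finset.mul_sum]
    rw [sum_comm_pairs]
    refine Finset.sum_congr rfl fun i _ => Finset.sum_congr rfl fun j _ =>
      Finset.sum_congr rfl fun k _ => Finset.sum_congr rfl fun l _ => ?_
    ring

end TwoParticle

end TorusKnotOV

end

noncomputable section

namespace TorusKnotOV

/-! ### The expansion in `ħ` -/

section Exp

variable {R : Type*} [Field R] [CharZero R]

theorem constantCoeff_expOf {g : PowerSeries R} (hg : PowerSeries.constantCoeff g = 0) :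
    PowerSeries.constantCoeff (expOf g) = 1 := by
  rw [← PowerSeries.coeff_zero_eq_constantCoeff_apply, coeff_expOf hg (M := 1) Nat.one_pos]
  simp

theorem derivative_expOf {g : PowerSeries R} (hg : PowerSeries.constantCoeff g = 0) :
    PowerSeries.derivative R (expOf g) = expOf g * PowerSeries.derivative R g := by
  rw [expOf, PowerSeries.derivative_subst (PowerSeries.HasSubst.of_constantCoeff_zero' hg),
    PowerSeries.derivative_exp]

/-- Uniqueness for a first-order linear equation: `f / g` has derivative zero and constant term `1`.
The exponential and power laws below are all obtained this way. -/
theorem eq_of_derivative_eq_mul {f g u : PowerSeries R}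
    (hf : PowerSeries.derivative R f = f * u) (hg : PowerSeries.derivative R g = g * u)
    (hf1 : PowerSeries.constantCoeff f = 1) (hg1 : PowerSeries.constantCoeff g = 1) : f = g := by
  have h0 : PowerSeries.constantCoeff g ≠ 0 := by rw [hg1]; exact one_ne_zero
  have hgg : g * g⁻¹ = 1 := PowerSeries.mul_inv_cancel g h0
  have h : f * g⁻¹ = 1 := by
    refine PowerSeries.derivative.ext ?_ ?_
    · rw [Derivation.leibniz, PowerSeries.derivative_inv', hf, hg, PowerSeries.derivative_one]
      simp only [smul_eq_mul]
      linear_combination (-f * u * g⁻¹) * hgg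
    · rw [map_mul, hf1, PowerSeries.constantCoeff_inv, hg1]; simp
  calc f = f * g⁻¹ * g := by rw [mul_assoc, mul_comm g⁻¹, hgg, mul_one]
    _ = g := by rw [h, one_mul]

theorem expOf_add {f g : PowerSeries R} (hf : PowerSeries.constantCoeff f = 0)
    (hg : PowerSeries.constantCoeff g = 0) : expOf (f + g) = expOf f * expOf g := by
  have hfg : PowerSeries.constantCoeff (f + g) = 0 := by rw [map_add, hf, hg, add_zero]
  refine eq_of_derivative_eq_mul (derivative_expOf hfg) ?_ (constantCoeff_expOf hfg) ?_
  · rw [Derivation.leibniz, derivative_expOf hf, derivative_expOf hg, map_add]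
    simp only [smul_eq_mul]; ring
  · rw [map_mul, constantCoeff_expOf hf, constantCoeff_expOf hg, one_mul]

theorem rescale_expOf (q : R) {g : PowerSeries R} (hg : PowerSeries.constantCoeff g = 0) :
    PowerSeries.rescale q (expOf g) = expOf (PowerSeries.rescale q g) := by
  have hq : PowerSeries.constantCoeff (PowerSeries.rescale q g) = 0 := by
    rw [← PowerSeries.coeff_zero_eq_constantCoeff_apply, PowerSeries.coeff_rescale,
      PowerSeries.coeff_zero_eq_constantCoeff_apply, hg, mul_zero]
  ext n
  rw [PowerSeries.coeff_rescale, coeff_expOf hg n.lt_succ_self, coeff_expOf hq n.lt_succ_self,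
    Finset.mul_sum]
  refine Finset.sum_congr rfl fun i _ => ?_
  rw [← map_pow, PowerSeries.coeff_rescale]; ring

end Exp

/-! ### Laurent series without polar part -/

section Regular

variable {K : Type*} [Field K]

/-- A Laurent series without polar part and with constant term `c`. -/
def RegularAt (x : LaurentSeries K) (c : K) : Prop :=
  ∃ f : PowerSeries K, (f : LaurentSeries K) = x ∧ PowerSeries.constantCoeff f = c

theorem RegularAt.coeff_zero {x : LaurentSeries K} {c : K} (h : RegularAt x c) :
    x.coeff 0 = c := by
  obtain ⟨f, rfl, rfl⟩ := h
  have := LaurentSeries.coeff_coe_powerSeries f 0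
  simpa using this

theorem RegularAt.mul {x y : LaurentSeries K} {c d : K} (hx : RegularAt x c)
    (hy : RegularAt y d) : RegularAt (x * y) (c * d) := by
  obtain ⟨f, rfl, rfl⟩ := hx
  obtain ⟨g, rfl, rfl⟩ := hy
  exact ⟨f * g, PowerSeries.coe_mul _ _, map_mul _ _ _⟩

theorem RegularAt.add {x y : LaurentSeries K} {c d : K} (hx : RegularAt x c)
    (hy : RegularAt y d) : RegularAt (x + y) (c + d) := by
  obtain ⟨f, rfl, rfl⟩ := hx
  obtain ⟨g, rfl, rfl⟩ := hy
  exact ⟨f + g, PowerSeries.coe_add _ _, map_add _ _ _⟩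

theorem RegularAt.C (c : K) : RegularAt (HahnSeries.C c : LaurentSeries K) c :=
  ⟨PowerSeries.C c, PowerSeries.coe_C c, PowerSeries.constantCoeff_C c⟩

theorem RegularAt.zero : RegularAt (0 : LaurentSeries K) 0 := by
  simpa using RegularAt.C (0 : K)

theorem RegularAt.one : RegularAt (1 : LaurentSeries K) 1 := by
  simpa using RegularAt.C (1 : K)

theorem RegularAt.sum {ι : Type*} (s : Finset ι) {x : ι → LaurentSeries K} {c : ι → K}
    (h : ∀ i ∈ s, RegularAt (x i) (c i)) : RegularAt (∑ i ∈ s, x i) (∑ i ∈ s, c i) := by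
  classical
  induction s using Finset.induction_on with
  | empty => simpa using RegularAt.zero
  | insert a s ha ih =>
    rw [Finset.sum_insert ha, Finset.sum_insert ha]
    exact (h a (Finset.mem_insert_self _ _)).add
      (ih fun i hi => h i (Finset.mem_insert_of_mem hi))

theorem regularAt_coeff_pow {F : PowerSeries (LaurentSeries K)} {f : PowerSeries K}
    (h : ∀ n, RegularAt (PowerSeries.coeff n F) (PowerSeries.coeff n f)) (i n : ℕ) :
    RegularAt (PowerSeries.coeff n (F ^ i)) (PowerSeries.coeff n (f ^ i)) := by
  induction i generalizing n with
  | zero =>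
    rw [pow_zero, pow_zero, PowerSeries.coeff_one, PowerSeries.coeff_one]
    split_ifs
    · exact RegularAt.one
    · exact RegularAt.zero
  | succ i ih =>
    rw [pow_succ, pow_succ, PowerSeries.coeff_mul, PowerSeries.coeff_mul]
    exact RegularAt.sum _ fun x _ => (ih _).mul (h _)

variable [CharZero K]

theorem regularAt_expOf {F : PowerSeries (LaurentSeries K)} {f : PowerSeries K}
    (hF : PowerSeries.constantCoeff F = 0) (hf : PowerSeries.constantCoeff f = 0)
    (h : ∀ n, RegularAt (PowerSeries.coeff n F) (PowerSeries.coeff n f)) (n : ℕ) :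
    RegularAt (PowerSeries.coeff n (expOf F)) (PowerSeries.coeff n (expOf f)) := by
  rw [coeff_expOf hF n.lt_succ_self, coeff_expOf hf n.lt_succ_self]
  refine RegularAt.sum _ fun i _ => RegularAt.mul ?_ (regularAt_coeff_pow h i n)
  have := RegularAt.C ((i ! : K)⁻¹)
  rwa [map_inv₀, map_natCast] at this

theorem constantCoeff_rescale_exp (x : K) :
    PowerSeries.constantCoeff (PowerSeries.rescale x (PowerSeries.exp K)) = 1 := by
  rw [← PowerSeries.coeff_zero_eq_constantCoeff_apply, PowerSeries.coeff_rescale]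
  simp

theorem regularAt_hexp (x : K) : RegularAt (hexp x) 1 := ⟨_, rfl, constantCoeff_rescale_exp x⟩

theorem hexp_sub_hexp (x y : K) : ∃ u : PowerSeries K, hexp x - hexp y =
    ((PowerSeries.X * u : PowerSeries K) : LaurentSeries K) ∧
      PowerSeries.constantCoeff u = x - y := by
  have h : PowerSeries.constantCoeff (PowerSeries.rescale x (PowerSeries.exp K) -
      PowerSeries.rescale y (PowerSeries.exp K)) = 0 := by
    rw [map_sub, constantCoeff_rescale_exp, constantCoeff_rescale_exp, sub_self]
  obtain ⟨u, hu⟩ := PowerSeries.X_dvd_iff.2 h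
  refine ⟨u, ?_, ?_⟩
  · rw [← hu, PowerSeries.coe_sub]; rfl
  · have := congrArg (PowerSeries.coeff 1) hu
    rw [← zero_add 1, PowerSeries.coeff_succ_X_mul, map_sub, PowerSeries.coeff_rescale,
      PowerSeries.coeff_rescale, PowerSeries.coeff_exp] at this
    rw [← PowerSeries.coeff_zero_eq_constantCoeff_apply, ← this]
    simp

/-- Numerator and denominator are both divisible by `ħ`, with quotients of constant term `x - y` and
`z - w`. This is where the pole of `p_i^*` is cancelled. -/
theorem regularAt_hexp_ratio (x y z w : K) (h : z - w ≠ 0) :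
    RegularAt ((hexp x - hexp y) / (hexp z - hexp w)) ((x - y) / (z - w)) := by
  obtain ⟨u, hu, hu0⟩ := hexp_sub_hexp x y
  obtain ⟨v, hv, hv0⟩ := hexp_sub_hexp z w
  have hv' : PowerSeries.constantCoeff v ≠ 0 := by rwa [hv0]
  have hvne : (v : LaurentSeries K) ≠ 0 := fun e => by
    have : v = 0 := by
      apply HahnSeries.ofPowerSeries_injective (Γ := ℤ) (R := K)
      rw [map_zero]; exact e
    rw [this] at hv'
    simp at hv'
  have hX : ((PowerSeries.X : PowerSeries K) : LaurentSeries K) ≠ 0 := fun e => by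
    refine PowerSeries.X_ne_zero (R := K) ?_
    apply HahnSeries.ofPowerSeries_injective (Γ := ℤ) (R := K)
    rw [map_zero]; exact e
  refine ⟨u * v⁻¹, ?_, ?_⟩
  · rw [hu, hv, PowerSeries.coe_mul, PowerSeries.coe_mul, PowerSeries.coe_mul,
      mul_div_mul_left _ _ hX, eq_div_iff hvne, mul_assoc, ← PowerSeries.coe_mul,
      PowerSeries.inv_mul_cancel v hv', PowerSeries.coe_one, mul_one]
  · rw [map_mul, PowerSeries.constantCoeff_inv, hu0, hv0, div_eq_mul_inv]

end Regular

/-! ### The conjugated operators and their value at ħ = 0 -/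

section Conjugated

variable {K : Type*} [Field K] [CharZero K]

theorem hexp_pow (x : K) (n : ℕ) : hexp x ^ n = hexp (n * x) := by
  induction n with
  | zero => simp [hexp_zero]
  | succ n ih => rw [pow_succ, ih, ← hexp_add]; congr 1; push_cast; ring

theorem regularAt_shiftFactor (b : K) (m k : ℤ) : RegularAt (shiftFactor b m k) 1 :=
  regularAt_hexp _

/-- The difference `(k + m)² - k²` is linear in `k`, so the factor is geometric. A geometric factor
in a convolution is a rescaling of the variable. -/
theorem shiftFactor_sub (b : K) (m j : ℤ) (r : ℕ) :
    shiftFactor b m (j - r) = shiftFactor b m j * hexp (-(b * m)) ^ r := by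
  rw [hexp_pow, shiftFactor, shiftFactor, ← hexp_add]
  congr 1
  simp only [halfSq]
  push_cast
  ring

/-- The generating function of the matrix elements of the conjugated operator `α_{-m}`. -/
def conjSeries (p : ℕ+ → LaurentSeries K) (b : K) (m : ℤ) : PowerSeries (LaurentSeries K) :=
  expOf (timesSeries p - PowerSeries.rescale (hexp (-(b * m))) (timesSeries p))

theorem constantCoeff_sub_rescale {R : Type*} [CommRing R] (q : R) {g : PowerSeries R}
    (hg : PowerSeries.constantCoeff g = 0) :
    PowerSeries.constantCoeff (g - PowerSeries.rescale q g) = 0 := by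
  rw [map_sub, hg, ← PowerSeries.coeff_zero_eq_constantCoeff_apply, PowerSeries.coeff_rescale,
      PowerSeries.coeff_zero_eq_constantCoeff_apply, hg, mul_zero, sub_zero]

theorem conjSeries_eq (p : ℕ+ → LaurentSeries K) (b : K) (m : ℤ) : conjSeries p b m =
    PowerSeries.rescale (hexp (-(b * m))) (expOf (-timesSeries p)) * expOf (timesSeries p) := by
  have h := constantCoeff_timesSeries p
  have h' : PowerSeries.constantCoeff (-timesSeries p) = 0 := by rw [map_neg, h, neg_zero]
  rw [rescale_expOf _ h', ← expOf_add _ h, conjSeries]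
  · congr 1; rw [map_neg]; ring
  · have := constantCoeff_sub_rescale (hexp (-(b * m))) h
    rw [map_sub, h, zero_sub] at this
    rw [map_neg, map_neg, this]

/-- With `r = j - k`, the sum over `k` becomes the Cauchy product of `exp (-g(qX))` and `exp
(g(X))`, where `q = e^{-bmħ}`. The hypothesis on `I` covers exactly the `k` at which neither
coefficient has a negative index. -/
theorem conjAlpha_eq (p : ℕ+ → LaurentSeries K) (b : K) {I : Finset ℤ} {m i j : ℤ}
    (hI : ∀ k, i - m ≤ k → k ≤ j → k ∈ I) :
    conjAlpha p b I m i j = shiftFactor b m j * coeffZ (conjSeries p b m) (m - i + j) := by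
  by_cases hN : 0 ≤ m - i + j
  · obtain ⟨N, hN⟩ := Int.eq_ofNat_of_zero_le hN
    rw [hN, coeffZ_natCast, conjSeries_eq, PowerSeries.coeff_mul,
      Finset.Nat.sum_antidiagonal_eq_sum_range_succ_mk, Finset.mul_sum, conjAlpha]
    symm
    refine Finset.sum_of_injOn (fun r : ℕ => j - r) ?_ ?_ ?_ ?_
    · intro r _ s _ h
      simp only at h
      lia
    · intro r hr
      have := Finset.mem_range.1 (Finset.mem_coe.1 hr)
      exact hI _ (by lia) (by lia)
    · intro k _ hk
      by_cases h1 : j - k < 0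
      · rw [coeffZ_of_neg _ h1, mul_zero, mul_zero]
      by_cases h2 : k + m - i < 0
      · rw [coeffZ_of_neg _ h2, zero_mul, mul_zero]
      exact absurd ⟨(j - k).toNat, Finset.mem_coe.2 (Finset.mem_range.2 (by lia)), by
        simp only; lia⟩ hk
    · intro r hr
      have := Finset.mem_range.1 hr
      have e1 : j - (j - (r : ℤ)) = (r : ℕ) := by lia
      have e2 : j - (r : ℤ) + m - i = ((N - r : ℕ) : ℤ) := by lia
      simp only
      rw [e1, e2, coeffZ_natCast, coeffZ_natCast, shiftFactor_sub, PowerSeries.coeff_rescale]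
      ring
  · rw [coeffZ_of_neg _ (not_le.1 hN), mul_zero]
    refine Finset.sum_eq_zero fun k _ => ?_
    by_cases h1 : j - k < 0
    · rw [coeffZ_of_neg _ h1, mul_zero, mul_zero]
    · rw [coeffZ_of_neg _ (by lia : k + m - i < 0), zero_mul, mul_zero]

/-- The series `∑_{k ≥ 1} (A^k - A^{-k}) c X^k / k`, the logarithm of
`((1 - A^{-1} X) / (1 - A X))^c`. -/
def logRatio (A c : K) : PowerSeries K :=
  PowerSeries.mk fun k => (A ^ k - (A ^ k)⁻¹) * c / k

theorem constantCoeff_logRatio (A c : K) : PowerSeries.constantCoeff (logRatio A c) = 0 := by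
  rw [← PowerSeries.coeff_zero_eq_constantCoeff_apply, logRatio, PowerSeries.coeff_mk]; simp

variable (Q : ℕ) (B : K)

/-- The coefficient of `X^k` in the exponent is `(A^k - A^{-k})/k` times `(1 - e^{-bmkħ}) /
(e^{kħ/2} - e^{-kħ/2})`, and the last quotient takes the value `bm` at `ħ = 0`. Regularity passes to
the exponential coefficientwise. -/
theorem regularAt_conjSeries (b : K) (m : ℤ) (n : ℕ) :
    RegularAt (PowerSeries.coeff n (conjSeries (pTop Q B) b m))
      (PowerSeries.coeff n (expOf (logRatio (B ^ Q) (b * m)))) := by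
  have h0 := constantCoeff_sub_rescale (hexp (-(b * m))) (constantCoeff_timesSeries (pTop Q B))
  refine regularAt_expOf h0 (constantCoeff_logRatio _ _) (fun k => ?_) n
  cases k with
  | zero =>
    rw [PowerSeries.coeff_zero_eq_constantCoeff_apply,
      PowerSeries.coeff_zero_eq_constantCoeff_apply, h0, constantCoeff_logRatio]
    exact RegularAt.zero
  | succ k =>
    have hk : ((k + 1 : ℕ) : K) ≠ 0 := Nat.cast_ne_zero.2 k.succ_ne_zero
    have h1 := regularAt_hexp_ratio (0 : K) (-(((k + 1 : ℕ) : K) * (b * m)))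
      (((k + 1 : ℕ) : K) / 2) (-(((k + 1 : ℕ) : K) / 2)) (by
        rw [sub_neg_eq_add, add_halves]; exact hk)
    have h2 := (RegularAt.C (((B ^ Q) ^ (k + 1) - ((B ^ Q) ^ (k + 1))⁻¹) /
      ((k + 1 : ℕ) : K))).mul h1
    rw [map_sub, PowerSeries.coeff_rescale, coeff_timesSeries_succ, logRatio, PowerSeries.coeff_mk]
    convert h2 using 1
    · rw [pTop, hexp_zero, hexp_pow, map_div₀, map_natCast]
      simp only [Nat.succPNat_coe, zpow_natCast, zpow_neg, Nat.succ_eq_add_one, mul_neg]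
      ring
    · rw [zero_sub, neg_neg, sub_neg_eq_add, add_halves]
      field_simp

theorem coeffZ_regular (b : K) (m : ℤ) (n : ℤ) :
    RegularAt (coeffZ (conjSeries (pTop Q B) b m) n)
      (coeffZ (expOf (logRatio (B ^ Q) (b * m))) n) := by
  unfold coeffZ
  split_ifs
  · exact regularAt_conjSeries Q B b m _
  · exact RegularAt.zero

theorem regularAt_vevExp (b : K) {m n : ℤ} (hm : 0 < m) (hn : 0 < n) :
    RegularAt (vevExp (pTop Q B) b (alpha _ (-m) (alpha _ (-n) (basisVec _ Maya.vacuum))) -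
      vevExp (pTop Q B) b (alpha _ (-m) (basisVec _ Maya.vacuum)) *
        vevExp (pTop Q B) b (alpha _ (-n) (basisVec _ Maya.vacuum)))
      (∑ i ∈ Finset.Ico (-(m + n)) 0, ∑ j ∈ Finset.Ico 0 (m + n),
        coeffZ (expOf (logRatio (B ^ Q) (b * m))) (m - i + j) *
          coeffZ (expOf (logRatio (B ^ Q) (b * n))) (n - j + i)) := by
  rw [(vevExp_two _ _ hm hn).2, add_sub_cancel_left]
  refine RegularAt.sum _ fun i hi => RegularAt.sum _ fun j hj => ?_
  rw [Finset.mem_Ico] at hi hj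
  rw [conjAlpha_eq _ _ (m := n) (i := j) (fun k _ _ => Finset.mem_Ico.2 ⟨by lia, by lia⟩)]
  -- The summation range of the first factor is long enough only if `j - i ≤ n`; otherwise the
  -- second factor vanishes.
  by_cases h : n - j + i < 0
  · rw [coeffZ_of_neg _ h, coeffZ_of_neg _ h, mul_zero, mul_zero, mul_zero]
    exact RegularAt.zero
  · rw [conjAlpha_eq _ _ (m := m) (fun k _ _ => Finset.mem_Ico.2 ⟨by lia, by lia⟩)]
    have := ((regularAt_shiftFactor b m j).mul (coeffZ_regular Q B b m (m - i + j))).mul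
      ((regularAt_shiftFactor b n i).mul (coeffZ_regular Q B b n (n - j + i)))
    rw [one_mul, one_mul] at this
    exact this

end Conjugated

end TorusKnotOV

end

noncomputable section

namespace TorusKnotOV

/-! ### Logarithms of power series -/

section Log

variable {σ R : Type*} [Field R]

theorem coeff_pow_mul_eq_zero {g : MvPowerSeries σ R} (hg : MvPowerSeries.constantCoeff g = 0)
    (h : MvPowerSeries σ R) {e : σ →₀ ℕ} {n : ℕ} (hn : e.degree < n) :
    MvPowerSeries.coeff e (g ^ n * h) = 0 := by
  classical
  rw [MvPowerSeries.coeff_mul]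
  refine Finset.sum_eq_zero fun x hx => ?_
  have hx' := Finset.HasAntidiagonal.mem_antidiagonal.1 hx
  have hd : x.1.degree ≤ e.degree := by rw [← hx', map_add]; exact Nat.le_add_right _ _
  rw [MvPowerSeries.coeff_eq_zero_of_constantCoeff_nilpotent (m := 1) (by rw [hg, pow_one])
    (by lia), zero_mul]

variable [Algebra ℚ R]

theorem coeff_logSeries {f : MvPowerSeries σ R} (hf : MvPowerSeries.constantCoeff f = 1)
    {e : σ →₀ ℕ} {N : ℕ} (hN : e.degree < N) :
    MvPowerSeries.coeff e (logSeries f) = MvPowerSeries.coeff e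
      (∑ d ∈ Finset.range N, PowerSeries.coeff d (PowerSeries.log R) • (f - 1) ^ d) := by
  have hg : MvPowerSeries.constantCoeff (f - 1) = 0 := by rw [map_sub, hf, map_one, sub_self]
  rw [logSeries, PowerSeries.coeff_subst (PowerSeries.HasSubst.of_constantCoeff_zero hg),
    finsum_eq_sum_of_support_subset (s := Finset.range N), map_sum]
  · simp only [smul_eq_mul, map_smul]
  · intro d hd
    rw [Finset.coe_range, Set.mem_Iio]
    by_contra hc
    have := coeff_pow_mul_eq_zero hg 1 (show e.degree < d by lia)
    rw [mul_one] at this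
    exact hd (by simp only; rw [this, smul_zero])

theorem constantCoeff_logSeries {f : MvPowerSeries σ R}
    (hf : MvPowerSeries.constantCoeff f = 1) :
    MvPowerSeries.constantCoeff (logSeries f) = 0 := by
  rw [← MvPowerSeries.coeff_zero_eq_constantCoeff_apply, coeff_logSeries hf (N := 1) (by simp)]
  simp

theorem pderiv_logSeries_mul {f : MvPowerSeries σ R} (hf : MvPowerSeries.constantCoeff f = 1)
    (i : σ) : MvPowerSeries.pderiv R i (logSeries f) * f = MvPowerSeries.pderiv R i f := by
  classical
  have hg : MvPowerSeries.constantCoeff (f - 1) = 0 := by rw [map_sub, hf, map_one, sub_self]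
  set g := f - 1 with hgdef
  have hfg : f = g + 1 := by rw [hgdef]; ring
  have hdf : MvPowerSeries.pderiv R i f = MvPowerSeries.pderiv R i g := by
    rw [hfg, map_add, MvPowerSeries.pderiv_one, add_zero]
  -- With `f = 1 + g`, the derivative of the truncated logarithm is a finite geometric sum in `-g`
  -- times the derivative of `g`, so multiplication by `f` telescopes it.
  have key : ∀ N, MvPowerSeries.pderiv R i (∑ d ∈ Finset.range (N + 1),
      PowerSeries.coeff d (PowerSeries.log R) • g ^ d) * f =
        MvPowerSeries.pderiv R i g - (-1) ^ N * (g ^ N * MvPowerSeries.pderiv R i g) := by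
    intro N
    induction N with
    | zero => simp
    | succ N ih =>
      rw [Finset.sum_range_succ, map_add, add_mul, ih, Derivation.map_smul, MvPowerSeries.pderiv_pow,
        PowerSeries.coeff_log, if_neg N.succ_ne_zero, Nat.add_sub_cancel]
      have h1 : (algebraMap ℚ R) ((-1) ^ (N + 1 + 1) / ((N + 1 : ℕ) : ℚ)) • (((N + 1 : ℕ) :
          MvPowerSeries σ R) * g ^ N * MvPowerSeries.pderiv R i g) =
          (-1) ^ N * (g ^ N * MvPowerSeries.pderiv R i g) := by
        have h2 : ((N + 1 : ℕ) : ℚ) ≠ 0 := Nat.cast_ne_zero.2 N.succ_ne_zero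
        rw [mul_assoc, ← nsmul_eq_mul, ← Nat.cast_smul_eq_nsmul R, smul_smul,
          ← map_natCast (algebraMap ℚ R), ← map_mul, div_mul_cancel₀ _ h2, map_pow, map_neg,
          map_one, MvPowerSeries.smul_eq_C_mul]
        simp only [map_pow, map_neg, map_one]
        ring
      rw [h1, hfg]
      ring
  ext e
  rw [hdf]
  -- The remainder contains `g^{|e|+1}`, which has no terms of degree `|e|`. One more degree of the
  -- logarithm is needed because of the derivative.
  have h3 := congrArg (MvPowerSeries.coeff e) (key (e.degree + 1))
  rw [map_sub, ← map_one (MvPowerSeries.C (σ := σ) (R := R)), ← map_neg, ← map_pow,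
    MvPowerSeries.coeff_C_mul, coeff_pow_mul_eq_zero hg _ (Nat.lt_succ_self _), mul_zero,
    sub_zero] at h3
  rw [← h3, MvPowerSeries.coeff_mul, MvPowerSeries.coeff_mul]
  refine Finset.sum_congr rfl fun x hx => ?_
  have hx' := Finset.HasAntidiagonal.mem_antidiagonal.1 hx
  have hd : x.1.degree ≤ e.degree := by rw [← hx', map_add]; exact Nat.le_add_right _ _
  rw [MvPowerSeries.coeff_pderiv, MvPowerSeries.coeff_pderiv,
    coeff_logSeries hf (N := e.degree + 1 + 1)]
  rw [map_add, Finsupp.degree_single]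
  lia

theorem constantCoeff_pderiv_pderiv_logSeries {f : MvPowerSeries σ R}
    (hf : MvPowerSeries.constantCoeff f = 1) (i j : σ) :
    MvPowerSeries.constantCoeff
        (MvPowerSeries.pderiv R i (MvPowerSeries.pderiv R j (logSeries f))) =
      MvPowerSeries.constantCoeff (MvPowerSeries.pderiv R i (MvPowerSeries.pderiv R j f)) -
        MvPowerSeries.constantCoeff (MvPowerSeries.pderiv R i f) *
          MvPowerSeries.constantCoeff (MvPowerSeries.pderiv R j f) := by
  have h := pderiv_logSeries_mul hf j
  have h1 := congrArg MvPowerSeries.constantCoeff h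
  rw [map_mul, hf, mul_one] at h1
  have h2 := congrArg (fun u => MvPowerSeries.constantCoeff (MvPowerSeries.pderiv R i u)) h
  simp only [Derivation.leibniz, smul_eq_mul, map_add, map_mul, hf, one_mul, h1] at h2
  rw [← h2]; ring

end Log

/-! ### The correlators -/

section Correlator

/-- The factor on the left is `2` if `i = j` and `1` otherwise, the same one that two
differentiations produce. It makes the formula uniform, and both orders of the noncommuting
coefficients are kept. -/
theorem coeff_single_add_single_mul {σ A : Type*} [Semiring A] (G : MvPowerSeries σ A)
    (hG : ∀ m, MvPowerSeries.coeff m G ≠ 0 → ∃ k, m = Finsupp.single k 1) (i j : σ) :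
    (Finsupp.single i 1 j + 1) • MvPowerSeries.coeff (Finsupp.single i 1 + Finsupp.single j 1)
        (G * G) =
      MvPowerSeries.coeff (Finsupp.single i 1) G * MvPowerSeries.coeff (Finsupp.single j 1) G +
      MvPowerSeries.coeff (Finsupp.single j 1) G * MvPowerSeries.coeff (Finsupp.single i 1) G := by
  classical
  have hsub : ({(Finsupp.single i 1, Finsupp.single j 1),
      (Finsupp.single j 1, Finsupp.single i 1)} : Finset ((σ →₀ ℕ) × (σ →₀ ℕ))) ⊆
      Finset.HasAntidiagonal.antidiagonal (Finsupp.single i 1 + Finsupp.single j 1) := by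
    intro x hx
    rw [Finset.mem_insert, Finset.mem_singleton] at hx
    rw [Finset.HasAntidiagonal.mem_antidiagonal]
    rcases hx with rfl | rfl
    · rfl
    · exact add_comm _ _
  rw [MvPowerSeries.coeff_mul, ← Finset.sum_subset hsub]
  · by_cases hij : i = j
    · subst hij
      simp [two_mul]
    · rw [Finset.sum_pair, Finsupp.single_eq_of_ne (Ne.symm hij), zero_add, one_smul]
      intro h
      exact hij (Finsupp.single_left_injective one_ne_zero (Prod.mk.inj h).1)
  · rintro ⟨x, y⟩ hx hxy
    by_contra h0
    have hx0 : MvPowerSeries.coeff x G ≠ 0 := fun e => h0 (by simp only; rw [e, zero_mul])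
    have hy0 : MvPowerSeries.coeff y G ≠ 0 := fun e => h0 (by simp only; rw [e, mul_zero])
    obtain ⟨k, rfl⟩ := hG x hx0
    obtain ⟨l, rfl⟩ := hG y hy0
    rw [Finset.HasAntidiagonal.mem_antidiagonal] at hx
    simp only at hx
    apply hxy
    rw [Finset.mem_insert, Finset.mem_singleton]
    rcases (Finsupp.single_add_single_eq_single_add_single one_ne_zero one_ne_zero).1 hx with
      h | h | h
    · exact Or.inl (by rw [h.1, h.2])
    · exact Or.inr (by rw [h.2.1, h.2.2])
    · exact absurd h.1 (by norm_num)

variable {R : Type*} [Field R]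

theorem coeff_gammaMinus_single (c : ℕ+ → R) (j : ℕ+) :
    MvPowerSeries.coeff (Finsupp.single j 1) (gammaMinus c) =
      (c j / (j : R)) • alpha R (-(j : ℤ)) := by
  classical
  change gammaMinus c (Finsupp.single j 1) = _
  rw [gammaMinus, finsum_eq_single _ j]
  · rw [if_pos rfl]
  · intro k hk
    rw [if_neg]
    intro h
    exact hk (Finsupp.single_left_injective one_ne_zero h).symm

theorem exists_single_of_coeff_gammaMinus (c : ℕ+ → R) (m : ℕ+ →₀ ℕ)
    (h : MvPowerSeries.coeff m (gammaMinus c) ≠ 0) : ∃ k, m = Finsupp.single k 1 := by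
  classical
  by_contra hm
  apply h
  change gammaMinus c m = 0
  rw [gammaMinus]
  refine finsum_eq_zero_of_forall_eq_zero fun j => ?_
  rw [if_neg fun h => hm ⟨j, h⟩]

theorem coeff_expSeries_zero (G : MvPowerSeries ℕ+ (Module.End R (Fock R))) :
    MvPowerSeries.coeff 0 (expSeries G) = 1 := by
  change expSeries G 0 = 1
  simp [expSeries]

theorem coeff_expSeries_single (G : MvPowerSeries ℕ+ (Module.End R (Fock R))) (j : ℕ+) :
    MvPowerSeries.coeff (Finsupp.single j 1) (expSeries G) =
      MvPowerSeries.coeff (Finsupp.single j 1) G := by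
  classical
  change expSeries G (Finsupp.single j 1) = _
  rw [expSeries, Finsupp.degree_single, Finset.sum_range_succ, Finset.sum_range_one, pow_zero,
    pow_one, MvPowerSeries.coeff_one, if_neg (by simp)]
  simp

theorem coeff_expSeries_single_add_single {G : MvPowerSeries ℕ+ (Module.End R (Fock R))}
    (hG : ∀ m, MvPowerSeries.coeff m G ≠ 0 → ∃ k, m = Finsupp.single k 1) (i j : ℕ+) :
    MvPowerSeries.coeff (Finsupp.single i 1 + Finsupp.single j 1) (expSeries G) =
      (2 : R)⁻¹ • MvPowerSeries.coeff (Finsupp.single i 1 + Finsupp.single j 1) (G * G) := by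
  classical
  change expSeries G (Finsupp.single i 1 + Finsupp.single j 1) = _
  have h1 : MvPowerSeries.coeff (Finsupp.single i 1 + Finsupp.single j 1) G = 0 := by
    by_contra h
    obtain ⟨k, hk⟩ := hG _ h
    have := congrArg Finsupp.degree hk
    simp at this
  have h0 : MvPowerSeries.coeff (Finsupp.single i 1 + Finsupp.single j 1)
      (1 : MvPowerSeries ℕ+ (Module.End R (Fock R))) = 0 := by
    rw [MvPowerSeries.coeff_one, if_neg]
    intro hk
    have := congrArg Finsupp.degree hk
    simp at this
  rw [expSeries, map_add, Finsupp.degree_single, Finsupp.degree_single, Finset.sum_range_succ,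
    Finset.sum_range_succ, Finset.sum_range_one, pow_zero, pow_one, h0, h1, pow_two]
  simp

variable {K : Type*} [Field K] [CharZero K] (Q : ℕ) (P : ℤ) (B : K)

theorem vevExp_smul (p : ℕ+ → LaurentSeries K) (b : K) (c : LaurentSeries K)
    (v : Fock (LaurentSeries K)) : vevExp p b (c • v) = c * vevExp p b v := by
  have : expLocNilp (gammaPlus p) (expF2 b (c • v)) =
      c • expLocNilp (gammaPlus p) (expF2 b v) := by
    rw [expLocNilp, expLocNilp, smul_finsum]
    refine finsum_congr fun n => ?_
    rw [map_smul, map_smul, smul_comm]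
  rw [vevExp, this, Finsupp.smul_apply, smul_eq_mul]
  rfl

theorem vevExp_add (p : ℕ+ → LaurentSeries K) (b : K) {v w : Fock (LaurentSeries K)}
    (hv : ∃ N, (gammaPlus p ^ N) (expF2 b v) = 0) (hw : ∃ N, (gammaPlus p ^ N) (expF2 b w) = 0) :
    vevExp p b (v + w) = vevExp p b v + vevExp p b w := by
  obtain ⟨N, hN⟩ := hv
  obtain ⟨N', hN'⟩ := hw
  rw [vevExp, map_add, (expLocNilp_add hN hN').2, Finsupp.add_apply]
  rfl

/-- The coefficients `Q A^{jP/Q} / j` of the operators `α_{-j}`. -/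
def couplingConst (j : ℕ+) : LaurentSeries K :=
  HahnSeries.C ((Q : K) * B ^ ((j : ℤ) * P)) / (j : LaurentSeries K)

theorem coeff_Zext (p : ℕ+ → LaurentSeries K) (m : ℕ+ →₀ ℕ) :
    MvPowerSeries.coeff m (Zext Q P B p) = vevExp p ((P : K) / Q) (MvPowerSeries.coeff m
      (expSeries (gammaMinus fun j => HahnSeries.C ((Q : K) * B ^ ((j : ℤ) * P))))
        (basisVec (LaurentSeries K) Maya.vacuum)) := rfl

theorem constantCoeff_Zext (p : ℕ+ → LaurentSeries K) :
    MvPowerSeries.constantCoeff (Zext Q P B p) = 1 := by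
  rw [← MvPowerSeries.coeff_zero_eq_constantCoeff_apply, coeff_Zext, coeff_expSeries_zero,
    Module.End.one_apply, vevExp_vacuum]

theorem constantCoeff_pderiv_Zext (p : ℕ+ → LaurentSeries K) (i : ℕ+) :
    MvPowerSeries.constantCoeff (MvPowerSeries.pderiv _ i (Zext Q P B p)) =
      couplingConst Q P B i *
        vevExp p ((P : K) / Q) (alpha _ (-(i : ℤ)) (basisVec _ Maya.vacuum)) := by
  rw [← MvPowerSeries.coeff_zero_eq_constantCoeff_apply, MvPowerSeries.coeff_pderiv, zero_add,
    coeff_Zext, coeff_expSeries_single, coeff_gammaMinus_single, LinearMap.smul_apply,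
    vevExp_smul]
  simp [couplingConst]

/-- The quadratic term of the exponential contains both orders of `α_{-i}` and `α_{-j}`. Keeping
their mean makes it unnecessary to know that the two commute. -/
theorem constantCoeff_pderiv_pderiv_Zext (p : ℕ+ → LaurentSeries K) (i j : ℕ+) :
    MvPowerSeries.constantCoeff
        (MvPowerSeries.pderiv _ i (MvPowerSeries.pderiv _ j (Zext Q P B p))) =
      couplingConst Q P B i * couplingConst Q P B j * (2⁻¹ *
        (vevExp p ((P : K) / Q)
          (alpha _ (-(i : ℤ)) (alpha _ (-(j : ℤ)) (basisVec _ Maya.vacuum))) +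
        vevExp p ((P : K) / Q)
          (alpha _ (-(j : ℤ)) (alpha _ (-(i : ℤ)) (basisVec _ Maya.vacuum))))) := by
  have hi : 0 < (i : ℤ) := by positivity
  have hj : 0 < (j : ℤ) := by positivity
  rw [← MvPowerSeries.coeff_zero_eq_constantCoeff_apply, MvPowerSeries.coeff_pderiv, zero_add,
    MvPowerSeries.coeff_pderiv, coeff_Zext,
    coeff_expSeries_single_add_single (exists_single_of_coeff_gammaMinus _)]
  have h := coeff_single_add_single_mul (gammaMinus fun j : ℕ+ =>
    (HahnSeries.C ((Q : K) * B ^ ((j : ℤ) * P)) : LaurentSeries K))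
      (exists_single_of_coeff_gammaMinus _) i j
  set X := MvPowerSeries.coeff (Finsupp.single i 1 + Finsupp.single j 1)
    ((gammaMinus fun j : ℕ+ => (HahnSeries.C ((Q : K) * B ^ ((j : ℤ) * P)) : LaurentSeries K)) *
      gammaMinus fun j : ℕ+ => (HahnSeries.C ((Q : K) * B ^ ((j : ℤ) * P)) : LaurentSeries K))
  rw [LinearMap.smul_apply, vevExp_smul]
  have h' := congrArg (fun T : Module.End _ _ => vevExp p ((P : K) / Q)
    (T (basisVec _ Maya.vacuum))) h
  simp only [coeff_gammaMinus_single] at h'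
  rw [← Nat.cast_smul_eq_nsmul (LaurentSeries K), LinearMap.smul_apply, vevExp_smul,
    LinearMap.add_apply, Module.End.mul_apply, Module.End.mul_apply, LinearMap.smul_apply,
    LinearMap.smul_apply, LinearMap.smul_apply, LinearMap.smul_apply, map_smul, map_smul,
    smul_smul, smul_smul, mul_comm (_ / (j : LaurentSeries K)), ← smul_add, vevExp_smul,
    vevExp_add p _ (vevExp_two p _ hi hj).1 (vevExp_two p _ hj hi).1] at h'
  rw [couplingConst, couplingConst, mul_left_comm, ← h']
  simp only [Finsupp.single_apply, Finsupp.coe_zero, Pi.zero_apply]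
  push_cast
  ring

theorem correlator_two (hB : B ≠ 0) (μ₁ μ₂ : ℕ+) :
    correlator Q P B 0 [μ₁, μ₂] = (Q : K) ^ 2 * B ^ (((μ₁ : ℤ) + μ₂) * P) / (μ₁ * μ₂) *
      (2⁻¹ *
        (∑ i ∈ Finset.Ico (-((μ₁ : ℤ) + μ₂)) 0, ∑ j ∈ Finset.Ico 0 ((μ₁ : ℤ) + μ₂),
          coeffZ (expOf (logRatio (B ^ Q) ((P : K) / Q * (μ₁ : ℤ)))) (μ₁ - i + j) *
            coeffZ (expOf (logRatio (B ^ Q) ((P : K) / Q * (μ₂ : ℤ)))) (μ₂ - j + i) +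
        ∑ i ∈ Finset.Ico (-((μ₂ : ℤ) + μ₁)) 0, ∑ j ∈ Finset.Ico 0 ((μ₂ : ℤ) + μ₁),
          coeffZ (expOf (logRatio (B ^ Q) ((P : K) / Q * (μ₂ : ℤ)))) (μ₂ - i + j) *
            coeffZ (expOf (logRatio (B ^ Q) ((P : K) / Q * (μ₁ : ℤ)))) (μ₁ - j + i))) := by
  have h1 : (0 : ℤ) < μ₁ := by positivity
  have h2 : (0 : ℤ) < μ₂ := by positivity
  have hC : ∀ j : ℕ+, RegularAt (couplingConst Q P B j) ((Q : K) * B ^ ((j : ℤ) * P) / j) := by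
    intro j
    have := RegularAt.C ((Q : K) * B ^ ((j : ℤ) * P) / j)
    rwa [map_div₀, map_natCast] at this
  have hhalf : RegularAt (2⁻¹ : LaurentSeries K) 2⁻¹ := by
    have := RegularAt.C ((2 : K)⁻¹)
    rwa [map_inv₀, map_ofNat] at this
  have key := ((hC μ₁).mul (hC μ₂)).mul (hhalf.mul
    ((regularAt_vevExp Q B ((P : K) / Q) h1 h2).add (regularAt_vevExp Q B ((P : K) / Q) h2 h1)))
  -- In genus zero with two points the relevant power of `ħ` is the zeroth, so the constant term of
  -- a regular series is the correlator.
  have e : (2 * ((0 : ℕ) : ℤ) - 2 + ([μ₁, μ₂].length : ℕ)) = 0 := by simp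
  have e' := fun inst => @constantCoeff_pderiv_pderiv_logSeries ℕ+ (LaurentSeries K) _ inst _
    (constantCoeff_Zext Q P B (pTop Q B)) μ₁ μ₂
  rw [correlator, e, List.foldr_cons, List.foldr_cons, List.foldr_nil, e',
    constantCoeff_pderiv_pderiv_Zext, constantCoeff_pderiv_Zext, constantCoeff_pderiv_Zext]
  have key' := key.coeff_zero
  rw [add_mul, zpow_add₀ hB]
  convert key' using 1
  · congr 1
    ring
  · ring

end Correlator

end TorusKnotOV

end

noncomputable section

namespace TorusKnotOV

/-! ### The genus zero two-point correlators -/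

/-! ### Binomial series and their first-order differential equations -/

section NegPow

variable {K : Type*} [Field K]

/-- `(1 - c X)^{-α}` -/
def negPow (α c : K) : PowerSeries K :=
  PowerSeries.mk fun n => (ascPochhammer K n).eval α / (n ! : K) * c ^ n

theorem constantCoeff_negPow (α c : K) : PowerSeries.constantCoeff (negPow α c) = 1 := by
  rw [← PowerSeries.coeff_zero_eq_constantCoeff_apply, negPow, PowerSeries.coeff_mk]
  simp

variable [CharZero K]

theorem derivative_negPow (α c : K) :
    (1 - PowerSeries.C c * PowerSeries.X) * PowerSeries.derivative K (negPow α c) =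
      PowerSeries.C (α * c) * negPow α c := by
  have h : ∀ n : ℕ, PowerSeries.coeff (n + 1) (negPow α c) * (n + 1) =
      (α + n) * c * PowerSeries.coeff n (negPow α c) := by
    intro n
    simp only [negPow, PowerSeries.coeff_mk, ascPochhammer_succ_eval, Nat.factorial_succ]
    have h1 : (n ! : K) ≠ 0 := Nat.cast_ne_zero.2 n.factorial_ne_zero
    have h2 : (n : K) + 1 ≠ 0 := Nat.cast_add_one_ne_zero n
    push_cast
    field_simp
    ring
  ext n
  rw [sub_mul, one_mul, mul_assoc, map_sub, PowerSeries.coeff_C_mul, PowerSeries.coeff_C_mul,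
    PowerSeries.coeff_derivative, h]
  cases n with
  | zero => simp
  | succ n =>
    rw [PowerSeries.coeff_succ_X_mul, PowerSeries.coeff_derivative]
    push_cast
    ring

theorem derivative_logRatio {A : K} (hA : A ≠ 0) (c : K) :
    ((1 - PowerSeries.C A * PowerSeries.X) * (1 - PowerSeries.C A⁻¹ * PowerSeries.X)) *
      PowerSeries.derivative K (logRatio A c) = PowerSeries.C (c * (A - A⁻¹)) := by
  have h : ∀ n, PowerSeries.coeff n (PowerSeries.derivative K (logRatio A c)) =
      (A ^ (n + 1) - (A ^ (n + 1))⁻¹) * c := by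
    intro n
    have h2 : (n : K) + 1 ≠ 0 := Nat.cast_add_one_ne_zero n
    rw [PowerSeries.coeff_derivative, logRatio, PowerSeries.coeff_mk]
    push_cast
    field_simp
  have e : (1 - PowerSeries.C A * PowerSeries.X) * (1 - PowerSeries.C A⁻¹ * PowerSeries.X) =
      1 - PowerSeries.C (A + A⁻¹) * PowerSeries.X + PowerSeries.X * (PowerSeries.X) := by
    have : (PowerSeries.C A * PowerSeries.C A⁻¹ : PowerSeries K) = 1 := by
      rw [← map_mul, mul_inv_cancel₀ hA, map_one]
    rw [map_add]
    linear_combination PowerSeries.X ^ 2 * this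
  rw [e]
  ext n
  rw [add_mul, sub_mul, one_mul, mul_assoc, mul_assoc, map_add, map_sub, PowerSeries.coeff_C_mul,
    PowerSeries.coeff_C, h]
  match n with
  | 0 => simp; ring
  | 1 =>
    rw [← zero_add 1, PowerSeries.coeff_succ_X_mul, PowerSeries.coeff_succ_X_mul, h]
    simp
    field_simp
    ring
  | n + 2 =>
    rw [PowerSeries.coeff_succ_X_mul, PowerSeries.coeff_succ_X_mul, PowerSeries.coeff_succ_X_mul,
      h, h]
    simp
    field_simp
    ring

/-- The series `(1 - X / A)^{e - 1} (1 - A X)^{-e - 1}`. -/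
def powHat (A e : K) : PowerSeries K := negPow (1 - e) A⁻¹ * negPow (1 + e) A

theorem derivative_mul_powHat {A : K} (hA : A ≠ 0) (e : K) :
    PowerSeries.derivative K (((1 - PowerSeries.C A * PowerSeries.X) *
      (1 - PowerSeries.C A⁻¹ * PowerSeries.X)) * powHat A e) =
      PowerSeries.C (e * (A - A⁻¹)) * powHat A e := by
  have : (PowerSeries.C A * PowerSeries.C A⁻¹ : PowerSeries K) = 1 := by
    rw [← map_mul, mul_inv_cancel₀ hA, map_one]
  have h1 := derivative_negPow (1 - e) A⁻¹
  have h2 := derivative_negPow (1 + e) A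
  simp only [powHat, Derivation.leibniz, map_sub, PowerSeries.derivative_C,
    PowerSeries.derivative_X, PowerSeries.derivative_one, smul_eq_mul, map_mul, map_add,
    map_one] at h1 h2 ⊢
  linear_combination (1 - PowerSeries.C A * PowerSeries.X) * negPow (1 + e) A * h1 +
    (1 - PowerSeries.C A⁻¹ * PowerSeries.X) * negPow (1 - e) A⁻¹ * h2

/-- Pulling out the two linear factors leaves `powHat`, to which the derivative of the same function
is proportional (`derivative_expOf_logRatio`). One series thus controls a function and its
derivative. -/
theorem expOf_logRatio {A : K} (hA : A ≠ 0) (e : K) :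
    expOf (logRatio A e) = ((1 - PowerSeries.C A * PowerSeries.X) *
      (1 - PowerSeries.C A⁻¹ * PowerSeries.X)) * powHat A e := by
  set D := (1 - PowerSeries.C A * PowerSeries.X) * (1 - PowerSeries.C A⁻¹ * PowerSeries.X)
    with hD
  have hD1 : PowerSeries.constantCoeff D = 1 := by simp [hD]
  have hDD : D * D⁻¹ = 1 := PowerSeries.mul_inv_cancel D (by rw [hD1]; exact one_ne_zero)
  have h := derivative_logRatio hA e
  rw [← hD] at h
  have h' := derivative_mul_powHat hA e
  rw [← hD] at h'
  refine eq_of_derivative_eq_mul (derivative_expOf (constantCoeff_logRatio _ _)) ?_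
    (constantCoeff_expOf (constantCoeff_logRatio _ _)) ?_
  · rw [h', ← h]; ring
  · rw [map_mul, hD1, powHat, map_mul, constantCoeff_negPow, constantCoeff_negPow]; simp

theorem derivative_expOf_logRatio {A : K} (hA : A ≠ 0) (e : K) :
    PowerSeries.derivative K (expOf (logRatio A e)) =
      PowerSeries.C (e * (A - A⁻¹)) * powHat A e := by
  rw [expOf_logRatio hA, derivative_mul_powHat hA]

theorem coeffZ_expOf_logRatio {A : K} (hA : A ≠ 0) (e : K) (n : ℤ) :
    coeffZ (expOf (logRatio A e)) n = coeffZ (powHat A e) n -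
      (A + A⁻¹) * coeffZ (powHat A e) (n - 1) + coeffZ (powHat A e) (n - 2) := by
  have e' : (1 - PowerSeries.C A * PowerSeries.X) * (1 - PowerSeries.C A⁻¹ * PowerSeries.X) =
      1 - PowerSeries.C (A + A⁻¹) * PowerSeries.X + PowerSeries.X * (PowerSeries.X) := by
    have : (PowerSeries.C A * PowerSeries.C A⁻¹ : PowerSeries K) = 1 := by
      rw [← map_mul, mul_inv_cancel₀ hA, map_one]
    rw [map_add]
    linear_combination PowerSeries.X ^ 2 * this
  rw [expOf_logRatio hA, e']
  rcases lt_or_ge n 0 with h | h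
  · rw [coeffZ_of_neg _ h, coeffZ_of_neg _ h, coeffZ_of_neg _ (by omega),
      coeffZ_of_neg _ (by omega)]
    ring
  · lift n to ℕ using h
    rw [coeffZ_natCast, coeffZ_natCast, add_mul, sub_mul, one_mul, mul_assoc, mul_assoc, map_add,
      map_sub, PowerSeries.coeff_C_mul]
    match n with
    | 0 => simp [coeffZ_of_neg]
    | 1 =>
      rw [show (((1 : ℕ) : ℤ) - 1) = ((0 : ℕ) : ℤ) by norm_num, coeffZ_natCast,
        coeffZ_of_neg _ (by norm_num)]
      rw [← zero_add 1, PowerSeries.coeff_succ_X_mul, PowerSeries.coeff_succ_X_mul]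
      simp
    | n + 2 =>
      rw [show (((n + 2 : ℕ) : ℤ) - 1) = ((n + 1 : ℕ) : ℤ) by push_cast; ring, coeffZ_natCast,
        show (((n + 2 : ℕ) : ℤ) - 2) = (n : ℤ) by push_cast; ring, coeffZ_natCast,
        PowerSeries.coeff_succ_X_mul, PowerSeries.coeff_succ_X_mul, PowerSeries.coeff_succ_X_mul]

/-- Read off from the derivative, while `coeffZ_expOf_logRatio` is read off from the product.
Integer indices make the two relations valid without boundary cases, as the telescoping requires. -/
theorem mul_coeffZ_expOf_logRatio {A : K} (hA : A ≠ 0) (e : K) (n : ℤ) :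
    n * coeffZ (expOf (logRatio A e)) n =
      e * (A - A⁻¹) * coeffZ (powHat A e) (n - 1) := by
  rcases lt_or_ge n 0 with h | h
  · rw [coeffZ_of_neg _ h, coeffZ_of_neg _ (by omega)]
    ring
  · lift n to ℕ using h
    cases n with
    | zero => simp [coeffZ_of_neg]
    | succ n =>
      rw [show (((n + 1 : ℕ) : ℤ) - 1) = ((n : ℕ) : ℤ) by push_cast; ring, coeffZ_natCast,
        coeffZ_natCast, ← PowerSeries.coeff_C_mul n (powHat A e), ← derivative_expOf_logRatio hA,
        PowerSeries.coeff_derivative]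
      push_cast
      ring

end NegPow

/-! ### Telescoping of the exchange sum -/

section Telescope

variable {K : Type*} [Field K]

theorem sum_sum_range_add {M : Type*} [AddCommMonoid M] (F : ℕ → M) {N : ℕ}
    (hF : ∀ l, N ≤ l → F l = 0) :
    ∑ i ∈ Finset.range N, ∑ j ∈ Finset.range N, F (i + j) =
      ∑ l ∈ Finset.range N, (l + 1) • F l := by
  have h : ∀ i ∈ Finset.range N, ∑ j ∈ Finset.range N, F (i + j) =
      ∑ l ∈ Finset.Ico i N, F l := by
    intro i hi
    have e : ∑ j ∈ Finset.range N, F (i + j) = ∑ l ∈ Finset.Ico i (i + N), F l := by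
      rw [Finset.sum_Ico_eq_sum_range, add_tsub_cancel_left]
    rw [e]
    refine (Finset.sum_subset (Finset.Ico_subset_Ico_right (by omega)) fun l hl hl' => hF l ?_).symm
    rw [Finset.mem_Ico] at hl hl'
    omega
  rw [Finset.sum_congr rfl h, Finset.range_eq_Ico, Finset.sum_Ico_Ico_comm]
  refine Finset.sum_congr rfl fun l _ => ?_
  simp

/-- After `i ↦ -i - 1` the summand depends only on `l = i + j`, and `l + 1` pairs give the same `l`.
Nothing is lost by truncation since the second coefficient vanishes for `l ≥ n`. -/
theorem sum_sum_coeffZ (f g : PowerSeries K) {m n N : ℕ} (h : n ≤ N) :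
    ∑ i ∈ Finset.Ico (-(N : ℤ)) 0, ∑ j ∈ Finset.Ico 0 (N : ℤ),
        coeffZ f (m - i + j) * coeffZ g (n - j + i) =
      ∑ l ∈ Finset.range N, ((l : K) + 1) * (coeffZ f (m + l + 1) * coeffZ g (n - l - 1)) := by
  have key := sum_sum_range_add (fun l : ℕ => coeffZ f (m + l + 1) * coeffZ g (n - l - 1)) (N := N)
    (fun l hl => by rw [coeffZ_of_neg g (by omega), mul_zero])
  simp only [nsmul_eq_mul] at key
  push_cast at key
  rw [← key]
  refine Finset.sum_nbij' (fun i => (-i - 1).toNat) (fun i => -(i : ℤ) - 1) ?_ ?_ ?_ ?_ ?_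
  · intro i hi; rw [Finset.mem_Ico] at hi; rw [Finset.mem_range]; omega
  · intro i hi; rw [Finset.mem_range] at hi; rw [Finset.mem_Ico]; omega
  · intro i hi; rw [Finset.mem_Ico] at hi; omega
  · intro i hi; omega
  · intro i hi
    rw [Finset.mem_Ico] at hi
    refine Finset.sum_nbij' (fun j => j.toNat) (fun j => (j : ℤ)) ?_ ?_ ?_ ?_ ?_
    · intro j hj; rw [Finset.mem_Ico] at hj; rw [Finset.mem_range]; omega
    · intro j hj; rw [Finset.mem_range] at hj; rw [Finset.mem_Ico]; omega
    · intro j hj; rw [Finset.mem_Ico] at hj; omega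
    · intro j hj; omega
    · intro j hj
      rw [Finset.mem_Ico] at hj
      congr 2 <;> omega

variable [CharZero K]

/-- A linear relation between three consecutive coefficients. -/
theorem coeffZ_powHat_self {A : K} (hA : A ≠ 0) (b : K) {m : ℤ} (hm : m ≠ 0) :
    coeffZ (powHat A (b * m)) m = (A + A⁻¹ + b * (A - A⁻¹)) * coeffZ (powHat A (b * m)) (m - 1) -
      coeffZ (powHat A (b * m)) (m - 2) := by
  have h1 := coeffZ_expOf_logRatio hA (b * m) m
  have h2 := mul_coeffZ_expOf_logRatio hA (b * m) m
  have hm' : (m : K) ≠ 0 := Int.cast_ne_zero.2 hm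
  -- At the index `m` matching the exponent `bm`, the factor `m` occurs on both sides of the
  -- derivative relation and cancels.
  refine mul_left_cancel₀ hm' ?_
  linear_combination h2 - m * h1

/-- The weight splits as `(m + n)(l + 1) = n (m + l + 1) - m (n - l - 1)`. Each piece is absorbed by
the derivative relation of one factor, and expanding the other factor through `powHat` makes the sum
a telescoping one. -/
theorem sum_mul_coeffZ_mul_coeffZ {A : K} (hA : A ≠ 0) (b : K) (m n : ℕ)
    (L : ℕ) :
    ((m : K) + n) * ∑ l ∈ Finset.range L, ((l : K) + 1) *
        (coeffZ (expOf (logRatio A (b * (m : ℤ)))) (m + l + 1) *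
          coeffZ (expOf (logRatio A (b * (n : ℤ)))) (n - l - 1)) =
      m * n * (b * (A - A⁻¹)) *
        (coeffZ (powHat A (b * (m : ℤ))) m * coeffZ (powHat A (b * (n : ℤ))) (n - 1) -
          coeffZ (powHat A (b * (m : ℤ))) (m - 1) * coeffZ (powHat A (b * (n : ℤ))) (n - 2) -
          coeffZ (powHat A (b * (m : ℤ))) (m + L) * coeffZ (powHat A (b * (n : ℤ))) (n - L - 1) +
          coeffZ (powHat A (b * (m : ℤ))) (m + L - 1) *
            coeffZ (powHat A (b * (n : ℤ))) (n - L - 2)) := by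
  induction L with
  | zero => simp
  | succ L ih =>
    rw [Finset.sum_range_succ, mul_add, ih]
    have hf := coeffZ_expOf_logRatio hA (b * (m : ℤ)) (m + L + 1)
    have hf' := mul_coeffZ_expOf_logRatio hA (b * (m : ℤ)) (m + L + 1)
    have hg := coeffZ_expOf_logRatio hA (b * (n : ℤ)) (n - L - 1)
    have hg' := mul_coeffZ_expOf_logRatio hA (b * (n : ℤ)) (n - L - 1)
    rw [show (m : ℤ) + L + 1 - 1 = m + L by ring, show (m : ℤ) + L + 1 - 2 = m + L - 1 by ring]
      at hf
    rw [show (m : ℤ) + L + 1 - 1 = m + L by ring] at hf'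
    rw [show (n : ℤ) - L - 1 - 1 = n - L - 2 by ring, show (n : ℤ) - L - 1 - 2 = n - L - 3 by ring]
      at hg
    rw [show (n : ℤ) - L - 1 - 1 = n - L - 2 by ring] at hg'
    rw [show (m : ℤ) + (L + 1 : ℕ) = m + L + 1 by push_cast; ring,
      show (m : ℤ) + L + 1 - 1 = m + L by ring,
      show (n : ℤ) - (L + 1 : ℕ) - 1 = n - L - 2 by push_cast; ring,
      show (n : ℤ) - (L + 1 : ℕ) - 2 = n - L - 3 by push_cast; ring]
    push_cast at hf hg hf' hg' ⊢
    set f := coeffZ (expOf (logRatio A (b * (m : K)))) (m + L + 1)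
    set g := coeffZ (expOf (logRatio A (b * (n : K)))) (n - L - 1)
    linear_combination n * g * hf' - m * f * hg' - m * n * (b * (A - A⁻¹)) *
      coeffZ (powHat A (b * (n : K))) (n - L - 2) * hf + m * n * (b * (A - A⁻¹)) *
      coeffZ (powHat A (b * (m : K))) (m + L) * hg

/-- For `L = m + n` the upper boundary terms have negative indices and vanish. In the lower one
`coeffZ_powHat_self` eliminates the coefficient of index `m`; the result is symmetric in the two
points, so averaging the two orders changes nothing. -/
theorem correlator_eq_powHat (Q : ℕ) (P : ℤ) {B : K} (hB : B ≠ 0) (μ₁ μ₂ : ℕ+) :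
    correlator Q P B 0 [μ₁, μ₂] = (Q : K) ^ 2 * B ^ (((μ₁ : ℤ) + μ₂) * P) / (μ₁ + μ₂) *
      ((P : K) / Q * (B ^ Q - (B ^ Q)⁻¹) *
        ((B ^ Q + (B ^ Q)⁻¹ + (P : K) / Q * (B ^ Q - (B ^ Q)⁻¹)) *
            (coeffZ (powHat (B ^ Q) ((P : K) / Q * (μ₁ : ℤ))) (μ₁ - 1) *
              coeffZ (powHat (B ^ Q) ((P : K) / Q * (μ₂ : ℤ))) (μ₂ - 1)) -
          coeffZ (powHat (B ^ Q) ((P : K) / Q * (μ₁ : ℤ))) (μ₁ - 1) *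
              coeffZ (powHat (B ^ Q) ((P : K) / Q * (μ₂ : ℤ))) (μ₂ - 2) -
          coeffZ (powHat (B ^ Q) ((P : K) / Q * (μ₁ : ℤ))) (μ₁ - 2) *
              coeffZ (powHat (B ^ Q) ((P : K) / Q * (μ₂ : ℤ))) (μ₂ - 1))) := by
  have hA : B ^ Q ≠ 0 := pow_ne_zero _ hB
  rw [correlator_two Q P B hB]
  generalize hm : (μ₁ : ℕ) = m
  generalize hn : (μ₂ : ℕ) = n
  have hm0 : 0 < m := hm ▸ μ₁.pos
  have hn0 : 0 < n := hn ▸ μ₂.pos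
  rw [show (m : ℤ) + n = ((m + n : ℕ) : ℤ) by push_cast; ring,
    show (n : ℤ) + m = ((m + n : ℕ) : ℤ) by push_cast; ring,
    sum_sum_coeffZ _ _ (Nat.le_add_left n m), sum_sum_coeffZ _ _ (Nat.le_add_right m n)]
  have e1 := sum_mul_coeffZ_mul_coeffZ hA ((P : K) / Q) m n (m + n)
  have e2 := sum_mul_coeffZ_mul_coeffZ hA ((P : K) / Q) n m (m + n)
  rw [coeffZ_of_neg (powHat _ ((P : K) / Q * (n : ℤ))) (n := (n : ℤ) - (m + n : ℕ) - 1)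
      (by push_cast; omega),
    coeffZ_of_neg (powHat _ ((P : K) / Q * (n : ℤ))) (n := (n : ℤ) - (m + n : ℕ) - 2)
      (by push_cast; omega), coeffZ_powHat_self hA _ (by omega)] at e1
  rw [coeffZ_of_neg (powHat _ ((P : K) / Q * (m : ℤ))) (n := (m : ℤ) - (m + n : ℕ) - 1)
      (by push_cast; omega),
    coeffZ_of_neg (powHat _ ((P : K) / Q * (m : ℤ))) (n := (m : ℤ) - (m + n : ℕ) - 2)
      (by push_cast; omega), coeffZ_powHat_self hA _ (by omega)] at e2
  have hm1 : (m : K) ≠ 0 := Nat.cast_ne_zero.2 hm0.ne'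
  have hn1 : (n : K) ≠ 0 := Nat.cast_ne_zero.2 hn0.ne'
  have hmn : (m : K) + n ≠ 0 := by exact_mod_cast (by omega : m + n ≠ 0)
  have f1 := eq_div_of_mul_eq hmn ((mul_comm _ _).trans e1)
  have f2 := eq_div_of_mul_eq (by rwa [add_comm] : (n : K) + m ≠ 0) ((mul_comm _ _).trans e2)
  rw [f1, f2, add_comm (n : K)]
  generalize B ^ Q = A at *
  field_simp
  ring

end Telescope

/-! ### Jacobi polynomials as coefficients of a product of binomial series -/

section Jacobi

variable {K : Type*} [Field K]

theorem ascPochhammer_eval_neg (k : ℕ) (β : K) :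
    (ascPochhammer K k).eval (-β) = (-1) ^ k * (ascPochhammer K k).eval (β - k + 1) := by
  rw [ascPochhammer_eval_neg_eq_descPochhammer, descPochhammer_eval_eq_ascPochhammer]

theorem ascPochhammer_eval_neg_natCast {n s : ℕ} (h : s ≤ n) :
    (ascPochhammer K s).eval (-(n : K)) * ((n - s)! : K) = (-1) ^ s * (n ! : K) := by
  induction s with
  | zero => simp
  | succ s ih =>
    have h1 := ih (by omega)
    rw [show n - s = (n - (s + 1)) + 1 by omega, Nat.factorial_succ] at h1
    have h2 : ((n - (s + 1) : ℕ) : K) = n - (s + 1) := by push_cast [Nat.cast_sub h]; ring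
    rw [ascPochhammer_succ_eval, pow_succ]
    push_cast at h1
    rw [h2] at h1
    linear_combination -h1

variable [CharZero K]

/-- The Cauchy product agrees with the hypergeometric sum term by term: reflection turns
`(-α-n)_{n-s}` into `(α+s+1)_{n-s}` up to sign, `(-n)_s` supplies `n!/(n-s)!`, and the powers of `A`
combine to `A^{-n} (A²)^s`, where `A² = (1 - x)/2`. -/
theorem coeff_mul_negPow_eq_jacobi {A : K} (hA : A ≠ 0) (α : K) (n : ℕ) :
    PowerSeries.coeff n (negPow (-(α + n)) A⁻¹ * negPow (α + n + 2) A) =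
      (-1) ^ n * (A ^ n)⁻¹ * jacobi n α 1 (1 - 2 * A ^ 2) := by
  rw [mul_comm, PowerSeries.coeff_mul, Finset.Nat.sum_antidiagonal_eq_sum_range_succ_mk, jacobi,
    if_pos (Int.natCast_nonneg n), Int.toNat_natCast, Finset.mul_sum]
  refine Finset.sum_congr rfl fun s hs => ?_
  have hs' : s ≤ n := Nat.lt_succ_iff.1 (Finset.mem_range.1 hs)
  simp only [negPow, PowerSeries.coeff_mk, Int.cast_natCast]
  obtain ⟨k, rfl⟩ := Nat.exists_eq_add_of_le hs'
  have h1 := ascPochhammer_eval_neg_natCast (K := K) hs'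
  rw [add_tsub_cancel_left] at h1 ⊢
  rw [ascPochhammer_eval_neg, show α + ((s + k : ℕ) : K) - k + 1 = α + s + 1 by push_cast; ring,
    show (1 - (1 - 2 * A ^ 2)) / 2 = A ^ 2 by ring,
    show 1 + α + 1 + (((s + k : ℕ) : K)) = α + (s + k : ℕ) + 2 by ring]
  have hk : (k ! : K) ≠ 0 := Nat.cast_ne_zero.2 k.factorial_ne_zero
  have hs1 : (s ! : K) ≠ 0 := Nat.cast_ne_zero.2 s.factorial_ne_zero
  have hn : ((s + k)! : K) ≠ 0 := Nat.cast_ne_zero.2 (s + k).factorial_ne_zero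
  rw [eq_div_of_mul_eq hk h1]
  have hsq : ((-1 : K) ^ s) * (-1) ^ s = 1 := by rw [← mul_pow]; simp
  rw [pow_add (-1 : K), pow_add A, inv_pow, ← pow_mul, mul_comm 2 s, pow_mul]
  field_simp
  linear_combination (-1 : K) * (
    Polynomial.eval (α + ((s + k : ℕ) : K) + 2) (ascPochhammer K s) *
    Polynomial.eval (α + s + 1) (ascPochhammer K k)) * hsq

end Jacobi

section Xi

variable {K : Type*} [Field K] [CharZero K] (Q : ℕ) (P : ℤ) {B : K}

/-- Degree `m - 1` with `α = m(b-1)` and degree `m - 2` with `α = m(b-1) + 1` both give `α + n = bm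
- 1`. Hence `ξ¹_m` and `ξ²_m` are neighbouring coefficients of the same `powHat A (b m)`, up to
explicit factors. -/
theorem xi1_eq_coeffZ (hB : B ≠ 0) (m : ℕ+) :
    xi1 Q P B m = -(B ^ ((m : ℤ) * P) * (B ^ Q)⁻¹ *
      coeffZ (powHat (B ^ Q) ((P : K) / Q * (m : ℤ))) (m - 1)) := by
  obtain ⟨n, hn⟩ : ∃ n : ℕ, (m : ℕ) = n + 1 := ⟨m - 1, by have := m.pos; omega⟩
  have hA : B ^ Q ≠ 0 := pow_ne_zero _ hB
  rw [xi1, hn, show ((n + 1 : ℕ) : ℤ) - 1 = n by push_cast; ring, coeffZ_natCast]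
  have h := coeff_mul_negPow_eq_jacobi hA (((n + 1 : ℕ) : K) * ((P : K) / Q - 1)) n
  have e : negPow (-(((n + 1 : ℕ) : K) * ((P : K) / Q - 1) + n)) (B ^ Q)⁻¹ *
      negPow (((n + 1 : ℕ) : K) * ((P : K) / Q - 1) + n + 2) (B ^ Q) =
      powHat (B ^ Q) ((P : K) / Q * ((n + 1 : ℕ) : ℤ)) := by
    rw [powHat]
    congr 2 <;> push_cast <;> ring
  rw [e] at h
  rw [h, sub_mul, zpow_sub₀ hB, show (Q : ℤ) * ((n + 1 : ℕ) : ℤ) = ((Q * (n + 1) : ℕ) : ℤ) by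
    push_cast; ring, zpow_natCast, pow_mul, mul_comm (P : ℤ)]
  have hsq : ((-1 : K) ^ n) * (-1) ^ n = 1 := by rw [← mul_pow]; simp
  rw [pow_succ (B ^ Q), pow_succ (-1 : K)]
  field_simp

theorem xi2_eq_coeffZ (hB : B ≠ 0) (m : ℕ+) :
    xi2 Q P B m = B ^ ((m : ℤ) * P) * ((B ^ Q)⁻¹) ^ 2 *
      coeffZ (powHat (B ^ Q) ((P : K) / Q * (m : ℤ))) (m - 2) := by
  have hA : B ^ Q ≠ 0 := pow_ne_zero _ hB
  obtain hm | ⟨n, hn⟩ : (m : ℕ) = 1 ∨ ∃ n : ℕ, (m : ℕ) = n + 2 := by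
    rcases Nat.lt_or_ge (m : ℕ) 2 with h | h
    · exact Or.inl (by have := m.pos; omega)
    · exact Or.inr ⟨m - 2, by omega⟩
  -- For `m = 1` both sides are zero by convention: a Jacobi polynomial of degree `-1` and a
  -- coefficient of index `-1`.
  · rw [xi2, hm, jacobi, if_neg (by norm_num), coeffZ_of_neg _ (by norm_num), mul_zero, mul_zero]
  rw [xi2, hn, show ((n + 2 : ℕ) : ℤ) - 2 = n by push_cast; ring, coeffZ_natCast]
  have h := coeff_mul_negPow_eq_jacobi hA (((n + 2 : ℕ) : K) * ((P : K) / Q - 1) + 1) n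
  have e : negPow (-(((n + 2 : ℕ) : K) * ((P : K) / Q - 1) + 1 + n)) (B ^ Q)⁻¹ *
      negPow (((n + 2 : ℕ) : K) * ((P : K) / Q - 1) + 1 + n + 2) (B ^ Q) =
      powHat (B ^ Q) ((P : K) / Q * ((n + 2 : ℕ) : ℤ)) := by
    rw [powHat]
    congr 2 <;> push_cast <;> ring
  rw [e] at h
  rw [h, sub_mul, zpow_sub₀ hB, show (Q : ℤ) * ((n + 2 : ℕ) : ℤ) = ((Q * (n + 2) : ℕ) : ℤ) by
    push_cast; ring, zpow_natCast, pow_mul, mul_comm (P : ℤ)]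
  rw [pow_add (B ^ Q), pow_add (-1 : K)]
  field_simp

theorem correlator_eq_xi (hB : B ≠ 0) (μ₁ μ₂ : ℕ+) :
    correlator Q P B 0 [μ₁, μ₂] =
      (Q : K) ^ 2 * (((B ^ Q) ^ 2 - 1) * ((P : K) / Q)) / ((μ₁ : K) + (μ₂ : K)) *
        ((((B ^ Q) ^ 2 + 1) + ((B ^ Q) ^ 2 - 1) * ((P : K) / Q)) * (xi1 Q P B μ₁ * xi1 Q P B μ₂) +
          (B ^ Q) ^ 2 * (xi1 Q P B μ₁ * xi2 Q P B μ₂ + xi2 Q P B μ₁ * xi1 Q P B μ₂)) := by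
  have hA : B ^ Q ≠ 0 := pow_ne_zero _ hB
  rw [correlator_eq_powHat Q P hB, xi1_eq_coeffZ Q P hB, xi1_eq_coeffZ Q P hB,
    xi2_eq_coeffZ Q P hB, xi2_eq_coeffZ Q P hB, add_mul, zpow_add₀ hB]
  generalize coeffZ (powHat (B ^ Q) ((P : K) / Q * (μ₁ : ℤ))) (μ₁ - 1) = x₁
  generalize coeffZ (powHat (B ^ Q) ((P : K) / Q * (μ₂ : ℤ))) (μ₂ - 1) = x₂
  generalize coeffZ (powHat (B ^ Q) ((P : K) / Q * (μ₁ : ℤ))) (μ₁ - 2) = y₁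
  generalize coeffZ (powHat (B ^ Q) ((P : K) / Q * (μ₂ : ℤ))) (μ₂ - 2) = y₂
  generalize B ^ Q = A at *
  generalize (P : K) / Q = b
  have hmn : ((μ₁ : ℕ) : K) + (μ₂ : ℕ) ≠ 0 := by
    exact_mod_cast (by have := μ₁.pos; omega : (μ₁ : ℕ) + μ₂ ≠ 0)
  field_simp
  ring

end Xi

end TorusKnotOV

end

noncomputable section

namespace TorusKnotOV

/-! ### Power series in the local coordinates of the curve -/

section OneVariable

variable {K : Type*} [Field K]

/-- For `Λ = U ρ(1/U)` this is `(U / Λ) dΛ/dU`. -/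
def logDerivFactor (ρ : PowerSeries K) : PowerSeries K :=
  (ρ - PowerSeries.X * PowerSeries.derivative K ρ) * ρ⁻¹

theorem logDerivFactor_mul {ρ : PowerSeries K} (h : PowerSeries.constantCoeff ρ ≠ 0) :
    logDerivFactor ρ * ρ = ρ - PowerSeries.X * PowerSeries.derivative K ρ := by
  rw [logDerivFactor, mul_assoc, PowerSeries.inv_mul_cancel _ h, mul_one]

theorem constantCoeff_logDerivFactor {ρ : PowerSeries K} (h : PowerSeries.constantCoeff ρ ≠ 0) :
    PowerSeries.constantCoeff (logDerivFactor ρ) = 1 := by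
  rw [logDerivFactor, map_mul, map_sub, map_mul, PowerSeries.constantCoeff_X, zero_mul, sub_zero,
    PowerSeries.constantCoeff_inv, mul_inv_cancel₀ h]

theorem X_mul_derivative_pow {ρ : PowerSeries K} (h : PowerSeries.constantCoeff ρ ≠ 0) (m : ℕ) :
    PowerSeries.X * PowerSeries.derivative K (ρ ^ m) =
      (m : PowerSeries K) * (ρ ^ m - ρ ^ m * logDerivFactor ρ) := by
  have h1 := logDerivFactor_mul h
  cases m with
  | zero => simp
  | succ m =>
    rw [Derivation.leibniz_pow, Nat.add_sub_cancel, smul_eq_mul, nsmul_eq_mul]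
    linear_combination ((m + 1 : ℕ) : PowerSeries K) * ρ ^ m * h1

theorem coeff_X_mul_derivative (f : PowerSeries K) (n : ℕ) :
    PowerSeries.coeff n (PowerSeries.X * PowerSeries.derivative K f) =
      n * PowerSeries.coeff n f := by
  cases n with
  | zero => simp
  | succ n =>
    rw [PowerSeries.coeff_succ_X_mul, PowerSeries.coeff_derivative]
    push_cast
    ring

variable [CharZero K]

/-- An exact differential has no residue: `ρ^d - ρ^d κ`, with `κ` the logarithmic factor, is `w
(ρ^d)' / d`, whose coefficient of `w^d` is that of `ρ^d`. -/
theorem coeff_pow_mul_logDerivFactor {ρ : PowerSeries K} (h : PowerSeries.constantCoeff ρ ≠ 0)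
    (d : ℕ) : PowerSeries.coeff d (ρ ^ d * logDerivFactor ρ) = if d = 0 then 1 else 0 := by
  split_ifs with hd
  · subst hd
    rw [pow_zero, one_mul, PowerSeries.coeff_zero_eq_constantCoeff_apply,
      constantCoeff_logDerivFactor h]
  · have e := congrArg (PowerSeries.coeff (R := K) d) (X_mul_derivative_pow h d)
    rw [coeff_X_mul_derivative, ← nsmul_eq_mul d (ρ ^ d - ρ ^ d * logDerivFactor ρ), map_nsmul,
      nsmul_eq_mul, map_sub] at e
    have hd' : (d : K) ≠ 0 := Nat.cast_ne_zero.2 hd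
    have := mul_left_cancel₀ hd' e
    linear_combination this

/-- Orthogonality of the powers `Λ^{-k}` and the differentials `Λ^m dΛ/Λ` under the residue at `w =
0`. -/
theorem coeff_X_mul_inv_pow {ρ : PowerSeries K} (h : PowerSeries.constantCoeff ρ ≠ 0) (k m : ℕ) :
    PowerSeries.coeff m ((PowerSeries.X * ρ⁻¹) ^ k * (ρ ^ m * logDerivFactor ρ)) =
      if k = m then 1 else 0 := by
  rw [mul_pow, mul_assoc, PowerSeries.coeff_X_pow_mul']
  rcases Nat.lt_or_ge m k with hk | hk
  · rw [if_neg (by omega), if_neg (by omega)]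
  · obtain ⟨d, rfl⟩ := Nat.exists_eq_add_of_le hk
    have e : ρ⁻¹ ^ k * (ρ ^ (k + d) * logDerivFactor ρ) = ρ ^ d * logDerivFactor ρ := by
      rw [pow_add, ← mul_assoc, ← mul_assoc, ← mul_pow, PowerSeries.inv_mul_cancel _ h, one_pow,
        one_mul]
    rw [if_pos hk, Nat.add_sub_cancel_left, e, coeff_pow_mul_logDerivFactor h]
    refine if_congr (by omega) rfl rfl

end OneVariable

/-! ### Substitution, partial derivatives and divided differences in two variables -/

section TwoVariables

variable {K : Type*} [Field K]

theorem coeff_toMvPowerSeries {σ : Type*} [DecidableEq σ] (i : σ) (f : PowerSeries K)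
    (e : σ →₀ ℕ) : MvPowerSeries.coeff e (PowerSeries.toMvPowerSeries i f) =
      if e = Finsupp.single i (e i) then PowerSeries.coeff (e i) f else 0 := by
  rw [PowerSeries.toMvPowerSeries_eq_subst, PowerSeries.coeff_subst (PowerSeries.HasSubst.X _),
    finsum_eq_single _ (e i)]
  · rw [MvPowerSeries.X_pow_eq, MvPowerSeries.coeff_monomial]
    split_ifs <;> simp
  · intro n hn
    rw [MvPowerSeries.X_pow_eq, MvPowerSeries.coeff_monomial, if_neg, smul_zero]
    rintro rfl
    simp at hn

theorem constantCoeff_toMvPowerSeries {σ : Type*} (i : σ) (f : PowerSeries K) :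
    MvPowerSeries.constantCoeff (PowerSeries.toMvPowerSeries i f) =
      PowerSeries.constantCoeff f := by
  classical
  rw [← MvPowerSeries.coeff_zero_eq_constantCoeff_apply, coeff_toMvPowerSeries]
  simp

theorem pderiv_toMvPowerSeries_self {σ : Type*} (i : σ) (f : PowerSeries K) :
    MvPowerSeries.pderiv K i (PowerSeries.toMvPowerSeries i f) =
      PowerSeries.toMvPowerSeries i (PowerSeries.derivative K f) := by
  classical
  ext e
  rw [MvPowerSeries.coeff_pderiv, coeff_toMvPowerSeries, coeff_toMvPowerSeries,
    PowerSeries.coeff_derivative]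
  have : (e + Finsupp.single i 1 = Finsupp.single i ((e + Finsupp.single i 1 : σ →₀ ℕ) i)) ↔
      e = Finsupp.single i (e i) := by
    rw [Finsupp.add_apply, Finsupp.single_eq_same, Finsupp.single_add, add_left_inj]
  simp only [this]
  split_ifs <;> simp

theorem pderiv_toMvPowerSeries_of_ne {σ : Type*} {i j : σ} (h : j ≠ i) (f : PowerSeries K) :
    MvPowerSeries.pderiv K j (PowerSeries.toMvPowerSeries i f) = 0 := by
  classical
  ext e
  rw [MvPowerSeries.coeff_pderiv, coeff_toMvPowerSeries, if_neg, zero_mul, map_zero]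
  intro h'
  have := DFunLike.congr_fun h' j
  simp [h.symm] at this

theorem finTwo_eq_single_add_single (e : Fin 2 →₀ ℕ) :
    e = Finsupp.single 0 (e 0) + Finsupp.single 1 (e 1) := by
  ext i; fin_cases i <;> simp

theorem coeff_toMvPowerSeries_mul (f g : PowerSeries K) (e : Fin 2 →₀ ℕ) :
    MvPowerSeries.coeff e (PowerSeries.toMvPowerSeries 0 f * PowerSeries.toMvPowerSeries 1 g) =
      PowerSeries.coeff (e 0) f * PowerSeries.coeff (e 1) g := by
  rw [MvPowerSeries.coeff_mul,
    Finset.sum_eq_single (Finsupp.single (0 : Fin 2) (e 0), Finsupp.single (1 : Fin 2) (e 1))]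
  · simp [coeff_toMvPowerSeries]
  · rintro ⟨x, y⟩ hxy hne
    rw [Finset.HasAntidiagonal.mem_antidiagonal] at hxy
    rw [coeff_toMvPowerSeries, coeff_toMvPowerSeries]
    split_ifs with h1 h2
    · refine absurd ?_ hne
      subst hxy
      dsimp only at h1 h2
      rw [h1, h2]
      simp
    all_goals simp
  · intro h
    refine absurd ?_ h
    rw [Finset.HasAntidiagonal.mem_antidiagonal]
    exact (finTwo_eq_single_add_single e).symm

theorem coeff_subst_mul {σ τ : Type*} {a : σ → MvPowerSeries τ K} (ha : MvPowerSeries.HasSubst a)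
    (F : MvPowerSeries σ K) (H : MvPowerSeries τ K) (e : τ →₀ ℕ) :
    MvPowerSeries.coeff e (MvPowerSeries.subst a F * H) =
      ∑ᶠ d : σ →₀ ℕ, MvPowerSeries.coeff d F *
        MvPowerSeries.coeff e ((d.prod fun s n => a s ^ n) * H) := by
  classical
  simp only [MvPowerSeries.coeff_mul, Finset.mul_sum]
  rw [finsum_sum_comm]
  · refine Finset.sum_congr rfl fun p _ => ?_
    rw [MvPowerSeries.coeff_subst ha, finsum_mul]
    refine finsum_congr fun d => ?_
    rw [smul_eq_mul, mul_assoc]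
  · intro p _
    refine (MvPowerSeries.coeff_subst_finite ha F p.1).subset fun d hd => ?_
    rw [Function.mem_support] at hd ⊢
    contrapose! hd
    rw [← mul_assoc]
    rw [smul_eq_mul] at hd
    rw [hd, zero_mul]

theorem coeff_X_mul_pderiv {σ : Type*} (i : σ) (G : MvPowerSeries σ K) (e : σ →₀ ℕ) :
    MvPowerSeries.coeff e (MvPowerSeries.X i * MvPowerSeries.pderiv K i G) =
      e i * MvPowerSeries.coeff e G := by
  classical
  rw [MvPowerSeries.X_def, MvPowerSeries.coeff_monomial_mul]
  split_ifs with h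
  · rw [one_mul, MvPowerSeries.coeff_pderiv, tsub_add_cancel_of_le h]
    have : 1 ≤ e i := by simpa using h i
    rw [Finsupp.tsub_apply, Finsupp.single_eq_same, Nat.cast_sub this]
    push_cast
    ring
  · have : e i = 0 := by
      by_contra h0
      exact h (Finsupp.single_le_iff.2 (Nat.one_le_iff_ne_zero.2 h0))
    rw [this]; simp

/-- Nondegeneracy by triangularity: the coefficient of `G * H e` at `e` is a nonzero multiple of
that of `G` at `e` plus terms of lower degree in `G`, so induction on the degree applies. -/
theorem eq_zero_of_coeff_mul_eq_zero {σ : Type*} {G : MvPowerSeries σ K}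
    (H : (σ →₀ ℕ) → MvPowerSeries σ K) (h0 : ∀ e, MvPowerSeries.constantCoeff (H e) ≠ 0)
    (h : ∀ e, MvPowerSeries.coeff e (G * H e) = 0) : G = 0 := by
  classical
  suffices hs : ∀ n, ∀ e : σ →₀ ℕ, e.degree = n → MvPowerSeries.coeff e G = 0 by
    ext e
    rw [hs _ e rfl, map_zero]
  intro n
  induction n using Nat.strong_induction_on with
  | _ n ih =>
    intro e he
    have := h e
    rw [MvPowerSeries.coeff_mul, Finset.sum_eq_single (e, 0)] at this
    · exact (mul_eq_zero.1 this).resolve_right (by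
        rw [MvPowerSeries.coeff_zero_eq_constantCoeff_apply]; exact h0 e)
    · rintro ⟨x, y⟩ hxy hne
      rw [Finset.HasAntidiagonal.mem_antidiagonal] at hxy
      dsimp only at hxy ⊢
      rw [ih x.degree ?_ x rfl, zero_mul]
      rw [← he, ← hxy, map_add]
      have : y ≠ 0 := by
        rintro rfl
        exact hne (by rw [← hxy, add_zero])
      have : y.degree ≠ 0 := fun hy => this ((Finsupp.degree_eq_zero_iff y).1 hy)
      omega
    · intro hn
      exact absurd (Finset.HasAntidiagonal.mem_antidiagonal.2 (add_zero e)) hn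

/-- Integration by parts in one of the variables. -/
theorem coeff_X_mul_pderiv_mul {σ : Type*} {ρ : PowerSeries K}
    (h : PowerSeries.constantCoeff ρ ≠ 0) (i : σ) (G H : MvPowerSeries σ K)
    (hH : MvPowerSeries.pderiv K i H = 0) (e : σ →₀ ℕ) :
    MvPowerSeries.coeff e (MvPowerSeries.X i * MvPowerSeries.pderiv K i G *
        (PowerSeries.toMvPowerSeries i (ρ ^ e i) * H)) =
      e i * MvPowerSeries.coeff e (G *
        (PowerSeries.toMvPowerSeries i (ρ ^ e i * logDerivFactor ρ) * H)) := by
  have h1 := coeff_X_mul_pderiv i (G * (PowerSeries.toMvPowerSeries i (ρ ^ e i) * H)) e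
  have h2 := congrArg (PowerSeries.toMvPowerSeries (R := K) (σ := σ) i) (X_mul_derivative_pow h (e i))
  rw [map_mul, PowerSeries.toMvPowerSeries_X, ← pderiv_toMvPowerSeries_self, map_mul, map_sub,
    map_natCast] at h2
  rw [Derivation.leibniz, Derivation.leibniz, hH] at h1
  simp only [smul_eq_mul, mul_zero, zero_add] at h1
  have h3 : MvPowerSeries.X i * MvPowerSeries.pderiv K i G *
        (PowerSeries.toMvPowerSeries i (ρ ^ e i) * H) +
      (e i) • (G * (PowerSeries.toMvPowerSeries i (ρ ^ e i) * H)) =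
      MvPowerSeries.X i * (G * (H * MvPowerSeries.pderiv K i
        (PowerSeries.toMvPowerSeries i (ρ ^ e i))) +
        PowerSeries.toMvPowerSeries i (ρ ^ e i) * H * MvPowerSeries.pderiv K i G) +
      (e i) • (G * (PowerSeries.toMvPowerSeries i (ρ ^ e i * logDerivFactor ρ) * H)) := by
    rw [nsmul_eq_mul, nsmul_eq_mul]
    linear_combination -G * H * h2
  have h4 := congrArg (MvPowerSeries.coeff e) h3
  rw [map_add, map_add, map_nsmul, map_nsmul, nsmul_eq_mul, nsmul_eq_mul, h1] at h4
  linear_combination h4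

/-- The series `∑ f_{i+j+1} w_1^i w_2^j`. -/
def dividedDifference (f : PowerSeries K) : MvPowerSeries (Fin 2) K :=
  fun e => PowerSeries.coeff (e 0 + e 1 + 1) f

theorem coeff_dividedDifference (f : PowerSeries K) (e : Fin 2 →₀ ℕ) :
    MvPowerSeries.coeff e (dividedDifference f) = PowerSeries.coeff (e 0 + e 1 + 1) f := rfl

theorem X_sub_X_mul_dividedDifference (f : PowerSeries K) :
    (MvPowerSeries.X 1 - MvPowerSeries.X 0) * dividedDifference f =
      PowerSeries.toMvPowerSeries 1 f - PowerSeries.toMvPowerSeries 0 f := by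
  ext e
  rw [sub_mul, map_sub, map_sub, MvPowerSeries.X_def, MvPowerSeries.X_def,
    MvPowerSeries.coeff_monomial_mul, MvPowerSeries.coeff_monomial_mul, one_mul, one_mul,
    coeff_dividedDifference, coeff_dividedDifference, coeff_toMvPowerSeries, coeff_toMvPowerSeries]
  have h0 : e = Finsupp.single 0 (e 0) ↔ e 1 = 0 := by
    conv_lhs => lhs; rw [finTwo_eq_single_add_single e]
    rw [add_eq_left, Finsupp.single_eq_zero]
  have h1 : e = Finsupp.single 1 (e 1) ↔ e 0 = 0 := by
    conv_lhs => lhs; rw [finTwo_eq_single_add_single e]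
    rw [add_eq_right, Finsupp.single_eq_zero]
  simp only [h0, h1, Finsupp.single_le_iff, Finsupp.tsub_apply, Finsupp.single_apply]
  rcases Nat.eq_zero_or_pos (e 0) with h | h <;> rcases Nat.eq_zero_or_pos (e 1) with h' | h'
  · simp [h, h']
  · simp [h, h'.ne', Nat.sub_add_cancel h', Nat.one_le_iff_ne_zero]
  · simp [h', h.ne', Nat.sub_add_cancel h, Nat.one_le_iff_ne_zero]
  · have e1 : e 0 + (e 1 - 1) + 1 = e 0 + e 1 := by omega
    have e2 : e 0 - 1 + e 1 + 1 = e 0 + e 1 := by omega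
    simp [h.ne', h'.ne', Nat.one_le_iff_ne_zero, e1, e2]

variable [CharZero K]

/-- Lagrange inversion in residue form: orthogonality in each variable recovers the coefficients of
a series in `Λ_1^{-1}, Λ_2^{-1}` from its expansion in `w_1, w_2`, with no inverse series involved.
-/
theorem coeff_subst_toMvPowerSeries_mul {ρ : PowerSeries K}
    (h : PowerSeries.constantCoeff ρ ≠ 0) (F : MvPowerSeries (Fin 2) K) (e : Fin 2 →₀ ℕ) :
    MvPowerSeries.coeff e (MvPowerSeries.subst
        (fun i => PowerSeries.toMvPowerSeries i (PowerSeries.X * ρ⁻¹)) F *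
      (PowerSeries.toMvPowerSeries 0 (ρ ^ e 0 * logDerivFactor ρ) *
        PowerSeries.toMvPowerSeries 1 (ρ ^ e 1 * logDerivFactor ρ))) =
      MvPowerSeries.coeff e F := by
  have key : ∀ d : Fin 2 →₀ ℕ, MvPowerSeries.coeff e ((d.prod fun s n =>
      (fun i => PowerSeries.toMvPowerSeries i (PowerSeries.X * ρ⁻¹)) s ^ n) *
      (PowerSeries.toMvPowerSeries 0 (ρ ^ e 0 * logDerivFactor ρ) *
        PowerSeries.toMvPowerSeries 1 (ρ ^ e 1 * logDerivFactor ρ))) =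
      if d = e then (1 : K) else 0 := by
    intro d
    rw [Finsupp.prod_fintype _ _ (fun i => pow_zero _), Fin.prod_univ_two, mul_mul_mul_comm,
      ← map_pow, ← map_pow, ← map_mul, ← map_mul, coeff_toMvPowerSeries_mul,
      coeff_X_mul_inv_pow h, coeff_X_mul_inv_pow h]
    by_cases hd : d = e
    · subst hd; simp
    · rw [if_neg hd]
      by_cases h0 : d 0 = e 0
      · rw [if_neg (c := d 1 = e 1), mul_zero]
        intro h1
        exact hd (by ext i; fin_cases i <;> assumption)
      · rw [if_neg h0, zero_mul]
  rw [coeff_subst_mul (MvPowerSeries.HasSubst.toMvPowerSeries (by simp)), finsum_eq_single _ e]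
  · rw [key, if_pos rfl, mul_one]
  · intro d hd
    rw [key, if_neg hd, mul_zero]

end TwoVariables

end TorusKnotOV

end

noncomputable section

namespace TorusKnotOV

/-! ### The two-point function on the spectral curve -/

section DividedDifference

variable {K : Type*} [Field K]

/-- For `Λ = U ρ(1/U)` this is `(Λ_1 - Λ_2) / (U_1 - U_2)`. -/
def ratioSeries (ρ : PowerSeries K) : MvPowerSeries (Fin 2) K :=
  MvPowerSeries.C (PowerSeries.constantCoeff ρ) - MvPowerSeries.X 0 * MvPowerSeries.X 1 *
    dividedDifference (PowerSeries.mk fun n => PowerSeries.coeff (n + 1) ρ)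

theorem constantCoeff_ratioSeries (ρ : PowerSeries K) :
    MvPowerSeries.constantCoeff (ratioSeries ρ) = PowerSeries.constantCoeff ρ := by
  simp [ratioSeries]

/-- Multiplication by `w_1 w_2` clears denominators in `Λ_1 - Λ_2` and `U_1 - U_2`. Differentiating
this relation gives all the derivatives of `ratioSeries` that are needed. -/
theorem X_sub_X_mul_ratioSeries (ρ : PowerSeries K) :
    (MvPowerSeries.X 1 - MvPowerSeries.X 0) * ratioSeries ρ =
      MvPowerSeries.X 1 * PowerSeries.toMvPowerSeries 0 ρ -
        MvPowerSeries.X 0 * PowerSeries.toMvPowerSeries 1 ρ := by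
  have h := X_sub_X_mul_dividedDifference (PowerSeries.mk fun n => PowerSeries.coeff (n + 1) ρ)
  have hρ : ∀ i : Fin 2, PowerSeries.toMvPowerSeries i ρ = MvPowerSeries.X i *
      PowerSeries.toMvPowerSeries i (PowerSeries.mk fun n => PowerSeries.coeff (n + 1) ρ) +
      MvPowerSeries.C (PowerSeries.constantCoeff ρ) := by
    intro i
    conv_lhs => rw [PowerSeries.eq_X_mul_shift_add_const ρ]
    rw [map_add, map_mul, PowerSeries.toMvPowerSeries_X, PowerSeries.toMvPowerSeries_C]
  rw [hρ 0, hρ 1, ratioSeries]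
  linear_combination (-(MvPowerSeries.X 0) * MvPowerSeries.X 1) * h

theorem X_sub_X_ne_zero :
    (MvPowerSeries.X 1 - MvPowerSeries.X 0 : MvPowerSeries (Fin 2) K) ≠ 0 := by
  intro h
  have := congrArg (MvPowerSeries.coeff (Finsupp.single 1 1)) h
  simp [MvPowerSeries.coeff_X, Finsupp.single_left_inj] at this

theorem pderiv_zero_ratioSeries (ρ : PowerSeries K) :
    -ratioSeries ρ + (MvPowerSeries.X 1 - MvPowerSeries.X 0) *
        MvPowerSeries.pderiv K 0 (ratioSeries ρ) =
      MvPowerSeries.X 1 * PowerSeries.toMvPowerSeries 0 (PowerSeries.derivative K ρ) -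
        PowerSeries.toMvPowerSeries 1 ρ := by
  have h := congrArg (MvPowerSeries.pderiv K 0) (X_sub_X_mul_ratioSeries ρ)
  simp only [Derivation.leibniz, map_sub, pderiv_toMvPowerSeries_self,
    pderiv_toMvPowerSeries_of_ne (zero_ne_one (α := Fin 2)), MvPowerSeries.pderiv_X_self,
    MvPowerSeries.pderiv_X_of_ne (one_ne_zero (α := Fin 2)), smul_eq_mul] at h
  linear_combination h

theorem pderiv_one_ratioSeries (ρ : PowerSeries K) :
    ratioSeries ρ + (MvPowerSeries.X 1 - MvPowerSeries.X 0) *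
        MvPowerSeries.pderiv K 1 (ratioSeries ρ) =
      PowerSeries.toMvPowerSeries 0 ρ -
        MvPowerSeries.X 0 * PowerSeries.toMvPowerSeries 1 (PowerSeries.derivative K ρ) := by
  have h := congrArg (MvPowerSeries.pderiv K 1) (X_sub_X_mul_ratioSeries ρ)
  simp only [Derivation.leibniz, map_sub, pderiv_toMvPowerSeries_self,
    pderiv_toMvPowerSeries_of_ne (one_ne_zero (α := Fin 2)), MvPowerSeries.pderiv_X_self,
    MvPowerSeries.pderiv_X_of_ne (zero_ne_one (α := Fin 2)), smul_eq_mul] at h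
  linear_combination h

theorem pderiv_pderiv_ratioSeries (ρ : PowerSeries K) :
    MvPowerSeries.pderiv K 0 (ratioSeries ρ) - MvPowerSeries.pderiv K 1 (ratioSeries ρ) +
        (MvPowerSeries.X 1 - MvPowerSeries.X 0) *
          MvPowerSeries.pderiv K 0 (MvPowerSeries.pderiv K 1 (ratioSeries ρ)) =
      PowerSeries.toMvPowerSeries 0 (PowerSeries.derivative K ρ) -
        PowerSeries.toMvPowerSeries 1 (PowerSeries.derivative K ρ) := by
  have h := congrArg (MvPowerSeries.pderiv K 0) (pderiv_one_ratioSeries ρ)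
  simp only [Derivation.leibniz, map_sub, map_add, pderiv_toMvPowerSeries_self,
    pderiv_toMvPowerSeries_of_ne (zero_ne_one (α := Fin 2)), MvPowerSeries.pderiv_X_self,
    MvPowerSeries.pderiv_X_of_ne (one_ne_zero (α := Fin 2)), smul_eq_mul] at h
  linear_combination h

theorem ratioSeries_ne_zero {ρ : PowerSeries K} (h : PowerSeries.constantCoeff ρ ≠ 0) :
    ratioSeries ρ ≠ 0 := by
  intro h0
  rw [← constantCoeff_ratioSeries, h0, map_zero] at h
  exact h rfl

/-- For `Λ = U ρ(1/U)` this is `ρ(0) (U_1 - U_2) / (Λ_1 - Λ_2)`. -/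
def normalizedRatio (ρ : PowerSeries K) : MvPowerSeries (Fin 2) K :=
  MvPowerSeries.C (PowerSeries.constantCoeff ρ) * (ratioSeries ρ)⁻¹

theorem normalizedRatio_mul {ρ : PowerSeries K} (h : PowerSeries.constantCoeff ρ ≠ 0) :
    normalizedRatio ρ * ratioSeries ρ = MvPowerSeries.C (PowerSeries.constantCoeff ρ) := by
  rw [normalizedRatio, mul_assoc, MvPowerSeries.inv_mul_cancel _
    (by rwa [constantCoeff_ratioSeries]), mul_one]

theorem constantCoeff_normalizedRatio {ρ : PowerSeries K}
    (h : PowerSeries.constantCoeff ρ ≠ 0) :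
    MvPowerSeries.constantCoeff (normalizedRatio ρ) = 1 := by
  have e := congrArg MvPowerSeries.constantCoeff (normalizedRatio_mul h)
  rw [map_mul, constantCoeff_ratioSeries, MvPowerSeries.constantCoeff_C] at e
  exact mul_right_cancel₀ h (e.trans (one_mul _).symm)

variable [Algebra ℚ K]

theorem ratioSeries_mul_pderiv_log {ρ : PowerSeries K} (h : PowerSeries.constantCoeff ρ ≠ 0)
    (i : Fin 2) :
    ratioSeries ρ * MvPowerSeries.pderiv K i (logSeries (normalizedRatio ρ)) =
      -MvPowerSeries.pderiv K i (ratioSeries ρ) := by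
  have h1 := pderiv_logSeries_mul (constantCoeff_normalizedRatio h) i
  have h2 := congrArg (MvPowerSeries.pderiv K i) (normalizedRatio_mul h)
  rw [Derivation.leibniz, MvPowerSeries.pderiv_C, smul_eq_mul, smul_eq_mul, ← h1] at h2
  have hR : normalizedRatio ρ ≠ 0 := by
    intro h0
    have := constantCoeff_normalizedRatio h
    rw [h0, map_zero] at this
    exact zero_ne_one this
  refine mul_left_cancel₀ hR ?_
  linear_combination h2

/-- The Euler field in `Λ_1, Λ_2` sends `log (Λ_1 - Λ_2)` to `1`, so only `log (U_1 - U_2)`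
contributes something nontrivial. Here the field is multiplied by the two logarithmic factors, and
`U ∂_U` is `-w ∂_w`. -/
theorem euler_log_normalizedRatio {ρ : PowerSeries K} (h : PowerSeries.constantCoeff ρ ≠ 0) :
    (MvPowerSeries.X 1 - MvPowerSeries.X 0) *
      (PowerSeries.toMvPowerSeries 1 (logDerivFactor ρ) *
          (MvPowerSeries.X 0 * MvPowerSeries.pderiv K 0 (logSeries (normalizedRatio ρ))) +
        PowerSeries.toMvPowerSeries 0 (logDerivFactor ρ) *
          (MvPowerSeries.X 1 * MvPowerSeries.pderiv K 1 (logSeries (normalizedRatio ρ)))) =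
      PowerSeries.toMvPowerSeries 0 (logDerivFactor ρ) *
          PowerSeries.toMvPowerSeries 1 (logDerivFactor ρ) *
            (MvPowerSeries.X 1 - MvPowerSeries.X 0) -
        PowerSeries.toMvPowerSeries 1 (logDerivFactor ρ) * MvPowerSeries.X 1 +
        PowerSeries.toMvPowerSeries 0 (logDerivFactor ρ) * MvPowerSeries.X 0 := by
  have hk : ∀ i : Fin 2, PowerSeries.toMvPowerSeries i (logDerivFactor ρ) *
      PowerSeries.toMvPowerSeries i ρ = PowerSeries.toMvPowerSeries i ρ -
        MvPowerSeries.X i * PowerSeries.toMvPowerSeries i (PowerSeries.derivative K ρ) := by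
    intro i
    rw [← map_mul, logDerivFactor_mul h, map_sub, map_mul, PowerSeries.toMvPowerSeries_X]
  have hL0 := ratioSeries_mul_pderiv_log h 0
  have hL1 := ratioSeries_mul_pderiv_log h 1
  have hV := X_sub_X_mul_ratioSeries ρ
  have hV0 := pderiv_zero_ratioSeries ρ
  have hV1 := pderiv_one_ratioSeries ρ
  have hk0 := hk 0
  have hk1 := hk 1
  refine mul_left_cancel₀ (ratioSeries_ne_zero h) ?_
  set k0 := PowerSeries.toMvPowerSeries (0 : Fin 2) (logDerivFactor ρ)
  set k1 := PowerSeries.toMvPowerSeries (1 : Fin 2) (logDerivFactor ρ)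
  set x0 : MvPowerSeries (Fin 2) K := MvPowerSeries.X 0
  set x1 : MvPowerSeries (Fin 2) K := MvPowerSeries.X 1
  linear_combination k1 * x0 * (x1 - x0) * hL0 + k0 * x1 * (x1 - x0) * hL1 - k1 * x0 * hV0 -
    k0 * x1 * hV1 - k1 * x1 * hk0 + k0 * x0 * hk1 - (k0 * k1 - k0 - k1) * hV

/-- The Bergman kernel in the coordinates `w_i = 1/U_i`. -/
theorem mul_pderiv_pderiv_log_normalizedRatio {ρ : PowerSeries K}
    (h : PowerSeries.constantCoeff ρ ≠ 0) :
    ((MvPowerSeries.X 1 - MvPowerSeries.X 0) * ratioSeries ρ) ^ 2 * MvPowerSeries.pderiv K 0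
        (MvPowerSeries.pderiv K 1 (logSeries (normalizedRatio ρ))) =
      ratioSeries ρ ^ 2 -
        PowerSeries.toMvPowerSeries 0 (ρ - PowerSeries.X * PowerSeries.derivative K ρ) *
          PowerSeries.toMvPowerSeries 1 (ρ - PowerSeries.X * PowerSeries.derivative K ρ) := by
  have hL0 := ratioSeries_mul_pderiv_log h 0
  have hL1 := ratioSeries_mul_pderiv_log h 1
  have hL := congrArg (MvPowerSeries.pderiv K 0) hL1
  rw [Derivation.leibniz, smul_eq_mul, smul_eq_mul, map_neg] at hL
  have hV := X_sub_X_mul_ratioSeries ρ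
  have hV0 := pderiv_zero_ratioSeries ρ
  have hV1 := pderiv_one_ratioSeries ρ
  have hV01 := pderiv_pderiv_ratioSeries ρ
  simp only [map_sub, map_mul, PowerSeries.toMvPowerSeries_X]
  set x0 : MvPowerSeries (Fin 2) K := MvPowerSeries.X 0
  set x1 : MvPowerSeries (Fin 2) K := MvPowerSeries.X 1
  set T := ratioSeries ρ
  set T0 := MvPowerSeries.pderiv K 0 T
  set T1 := MvPowerSeries.pderiv K 1 T
  set T01 := MvPowerSeries.pderiv K 0 T1
  set r0 := PowerSeries.toMvPowerSeries (0 : Fin 2) ρ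
  set r1 := PowerSeries.toMvPowerSeries (1 : Fin 2) ρ
  set s0 := PowerSeries.toMvPowerSeries (0 : Fin 2) (PowerSeries.derivative K ρ)
  set s1 := PowerSeries.toMvPowerSeries (1 : Fin 2) (PowerSeries.derivative K ρ)
  -- This is minus the mixed derivative of `log T`; the additive constant in the logarithm has
  -- dropped out.
  have e1 : T ^ 2 * MvPowerSeries.pderiv K 0
      (MvPowerSeries.pderiv K 1 (logSeries (normalizedRatio ρ))) = T0 * T1 - T * T01 := by
    linear_combination T * hL - T0 * hL1
  have e2 : (x1 - x0) ^ 2 * (T0 * T1 - T * T01) =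
      T ^ 2 - (r0 - x0 * s0) * (r1 - x1 * s1) := by
    linear_combination (T + (x1 - x0) * T1) * hV0 + (x1 * s0 - r1) * hV1 -
      (x1 - x0) * T * hV01 - (s0 - s1) * hV
  rw [mul_pow, mul_assoc, e1, e2]

end DividedDifference

/-! ### The explicit curve -/

section LambdaRatio

variable {K : Type*} [Field K]

theorem derivative_rescale (q : K) (f : PowerSeries K) :
    PowerSeries.derivative K (PowerSeries.rescale q f) =
      PowerSeries.C q * PowerSeries.rescale q (PowerSeries.derivative K f) := by
  ext n
  rw [PowerSeries.coeff_derivative, PowerSeries.coeff_C_mul, PowerSeries.coeff_rescale,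
    PowerSeries.coeff_rescale, PowerSeries.coeff_derivative]
  ring

variable [CharZero K]

theorem binPow_eq_negPow (c : K) (r : ℚ) : binPow c r = negPow (-(r : K)) c := by
  ext n
  have h : ((Ring.choose r n : ℚ) : K) * n ! = (-1) ^ n * (ascPochhammer K n).eval (-(r : K)) := by
    have h1 : Ring.choose r n * n ! = (ascPochhammer ℚ n).eval (r - n + 1) := by
      have h2 : (n ! : ℚ) ≠ 0 := Nat.cast_ne_zero.2 n.factorial_ne_zero
      rw [Ring.choose_eq_smul, Polynomial.descPochhammer_smeval_eq_ascPochhammer,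
        Polynomial.ascPochhammer_smeval_eq_eval, smul_eq_mul]
      field_simp
    have h3 := congrArg (Rat.cast (K := K)) h1
    have hsq : ((-1 : K) ^ n) * (-1) ^ n = 1 := by rw [← mul_pow]; simp
    rw [ascPochhammer_eval_neg, ← mul_assoc, hsq, one_mul]
    push_cast at h3
    rw [h3, ← ascPochhammer_map (algebraMap ℚ K), Polynomial.eval_map_algebraMap]
    have := Polynomial.aeval_algebraMap_apply K (r - n + 1) (ascPochhammer ℚ n)
    simp only [eq_ratCast] at this
    push_cast at this
    rw [this]
    simp [Polynomial.aeval_def, Polynomial.eval₂_id]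
  have hn : (n ! : K) ≠ 0 := Nat.cast_ne_zero.2 n.factorial_ne_zero
  rw [binPow, PowerSeries.coeff_rescale, PowerSeries.binomialSeries_coeff, negPow,
    PowerSeries.coeff_mk, Rat.smul_def, mul_one, eq_div_of_mul_eq hn h, neg_pow c]
  have hsq : ((-1 : K) ^ n) * (-1) ^ n = 1 := by rw [← mul_pow]; simp
  linear_combination (c ^ n * ((ascPochhammer K n).eval (-(r : K)) / (n ! : K))) * hsq

theorem expOf_logRatio_eq_negPow {A : K} (hA : A ≠ 0) (e : K) :
    expOf (logRatio A e) = negPow (-e) A⁻¹ * negPow e A := by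
  set D := (1 - PowerSeries.C A * PowerSeries.X) * (1 - PowerSeries.C A⁻¹ * PowerSeries.X)
    with hD
  have hD1 : PowerSeries.constantCoeff D = 1 := by simp [hD]
  have hD0 : D ≠ 0 := by
    intro h
    rw [h, map_zero] at hD1
    exact zero_ne_one hD1
  have h := derivative_logRatio hA e
  rw [← hD] at h
  have hC : (PowerSeries.C A * PowerSeries.C A⁻¹ : PowerSeries K) = 1 := by
    rw [← map_mul, mul_inv_cancel₀ hA, map_one]
  have h1 := derivative_negPow (-e) A⁻¹
  have h2 := derivative_negPow e A
  refine eq_of_derivative_eq_mul (derivative_expOf (constantCoeff_logRatio _ _)) ?_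
    (constantCoeff_expOf (constantCoeff_logRatio _ _)) ?_
  · refine mul_left_cancel₀ hD0 ?_
    rw [mul_left_comm, h, hD, Derivation.leibniz]
    simp only [smul_eq_mul, map_mul, map_sub, map_neg] at h1 h2 ⊢
    linear_combination (1 - PowerSeries.C A * PowerSeries.X) * negPow e A * h1 +
      (1 - PowerSeries.C A⁻¹ * PowerSeries.X) * negPow (-e) A⁻¹ * h2
  · rw [map_mul, constantCoeff_negPow, constantCoeff_negPow, one_mul]

/-- The exponent is additive in `e`, so the `m`-th power of the function on the curve is the series
attached to `α_{-m}`. -/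
theorem expOf_logRatio_pow (A e : K) (m : ℕ) :
    expOf (logRatio A e) ^ m = expOf (logRatio A (e * m)) := by
  have hadd : ∀ c d : K, logRatio A (c + d) = logRatio A c + logRatio A d := by
    intro c d
    ext n
    simp only [logRatio, map_add, PowerSeries.coeff_mk]
    ring
  induction m with
  | zero =>
    have h0 : logRatio A (0 : K) = 0 := by
      ext n
      simp [logRatio]
    rw [pow_zero, Nat.cast_zero, mul_zero, h0]
    exact eq_of_derivative_eq_mul (u := 0) (by simp) (by rw [derivative_expOf (by simp)]; simp)
      (by simp) (constantCoeff_expOf (by simp))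
  | succ m ih =>
    rw [pow_succ, ih, ← expOf_add (constantCoeff_logRatio _ _) (constantCoeff_logRatio _ _),
      ← hadd]
    congr 2
    push_cast
    ring

theorem rescale_negPow (q α c : K) :
    PowerSeries.rescale q (negPow α c) = negPow α (q * c) := by
  ext n
  rw [PowerSeries.coeff_rescale, negPow, negPow, PowerSeries.coeff_mk, PowerSeries.coeff_mk]
  ring

variable (Q : ℕ) (P : ℤ) {B : K}

/-- The bridge between the two sides: up to the constant `A^{2b}` and the rescaling `X = A^{-b} w`,
the curve is the value at `ħ = 0` of the conjugation series. -/
theorem lambdaRatio_eq (hB : B ≠ 0) : lambdaRatio Q P B = PowerSeries.C (B ^ (2 * P)) *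
    PowerSeries.rescale (B ^ (-P)) (expOf (logRatio (B ^ Q) ((P : K) / Q))) := by
  rw [lambdaRatio, expOf_logRatio_eq_negPow (pow_ne_zero _ hB), map_mul, rescale_negPow,
    rescale_negPow, binPow_eq_negPow, binPow_eq_negPow, ← zpow_natCast, ← zpow_neg,
    ← zpow_add₀ hB, ← zpow_add₀ hB]
  push_cast
  rw [neg_neg, neg_add, neg_sub, sub_eq_neg_add]

theorem constantCoeff_lambdaRatio (hB : B ≠ 0) :
    PowerSeries.constantCoeff (lambdaRatio Q P B) = B ^ (2 * P) := by
  rw [lambdaRatio_eq Q P hB, map_mul, PowerSeries.constantCoeff_C,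
    ← PowerSeries.coeff_zero_eq_constantCoeff_apply, PowerSeries.coeff_rescale, pow_zero, one_mul,
    PowerSeries.coeff_zero_eq_constantCoeff_apply,
    constantCoeff_expOf (constantCoeff_logRatio _ _), mul_one]

theorem constantCoeff_lambdaRatio_ne_zero (hB : B ≠ 0) :
    PowerSeries.constantCoeff (lambdaRatio Q P B) ≠ 0 := by
  rw [constantCoeff_lambdaRatio Q P hB]
  exact zpow_ne_zero _ hB

/-- The series `(1 - A^{1-b} w) (1 - A^{-1-b} w)`. -/
def curveDen (Q : ℕ) (P : ℤ) (B : K) : PowerSeries K :=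
  PowerSeries.rescale (B ^ (-P)) ((1 - PowerSeries.C (B ^ Q) * PowerSeries.X) *
    (1 - PowerSeries.C (B ^ Q)⁻¹ * PowerSeries.X))

theorem lambdaRatio_pow (hB : B ≠ 0) (m : ℕ) : lambdaRatio Q P B ^ m =
    curveDen Q P B * (PowerSeries.C (B ^ (2 * P * m)) *
      PowerSeries.rescale (B ^ (-P)) (powHat (B ^ Q) ((P : K) / Q * m))) := by
  rw [lambdaRatio_eq Q P hB, mul_pow, ← map_pow, ← map_pow, expOf_logRatio_pow,
    expOf_logRatio (pow_ne_zero _ hB), map_mul, curveDen, ← zpow_natCast (B ^ (2 * P)),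
    ← zpow_mul]
  ring

/-- The logarithmic derivative of a product of powers of linear factors is rational. This makes the
Euler derivative of the logarithm rational as well. -/
theorem logDerivFactor_lambdaRatio_mul_curveDen (hB : B ≠ 0) :
    logDerivFactor (lambdaRatio Q P B) * curveDen Q P B = curveDen Q P B -
      PowerSeries.C ((P : K) / Q * (B ^ Q - (B ^ Q)⁻¹) * B ^ (-P)) * PowerSeries.X := by
  have h0 := constantCoeff_lambdaRatio_ne_zero Q P hB
  have h := logDerivFactor_mul h0
  have hρ : lambdaRatio Q P B ≠ 0 := by
    intro h'
    rw [h', map_zero] at h0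
    exact h0 rfl
  have hd := derivative_logRatio (pow_ne_zero Q hB) ((P : K) / Q)
  have hd' := congrArg (PowerSeries.rescale (B ^ (-P))) hd
  rw [map_mul (PowerSeries.rescale (B ^ (-P))) _ (PowerSeries.derivative K _), ← curveDen] at hd'
  have hdρ : curveDen Q P B * PowerSeries.derivative K (lambdaRatio Q P B) =
      PowerSeries.C ((P : K) / Q * (B ^ Q - (B ^ Q)⁻¹) * B ^ (-P)) * lambdaRatio Q P B := by
    rw [lambdaRatio_eq Q P hB, Derivation.leibniz, PowerSeries.derivative_C, derivative_rescale,
      derivative_expOf (constantCoeff_logRatio _ _), map_mul (PowerSeries.rescale (B ^ (-P)))]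
    have hC : ∀ c : K, PowerSeries.rescale (B ^ (-P)) (PowerSeries.C c) = PowerSeries.C c := by
      intro c
      ext n
      rw [PowerSeries.coeff_rescale, PowerSeries.coeff_C]
      split_ifs with hn
      · subst hn; simp
      · simp
    rw [hC] at hd'
    simp only [smul_eq_mul, mul_zero, add_zero]
    rw [map_mul PowerSeries.C ((P : K) / Q * (B ^ Q - (B ^ Q)⁻¹)) (B ^ (-P)), ← hd']
    ring
  refine mul_right_cancel₀ hρ ?_
  linear_combination curveDen Q P B * h - PowerSeries.X * hdρ

end LambdaRatio

end TorusKnotOV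

end

noncomputable section

namespace TorusKnotOV

/-! ### The free energy and the two-point differential on the curve -/

section Pairing

variable {K : Type*} [Field K]

/-- The series dual to the monomials in `Λ_1⁻¹`, `Λ_2⁻¹` under the residue pairing. -/
def residueKernel (ρ : PowerSeries K) (e : Fin 2 →₀ ℕ) : MvPowerSeries (Fin 2) K :=
  PowerSeries.toMvPowerSeries 0 (ρ ^ e 0 * logDerivFactor ρ) *
    PowerSeries.toMvPowerSeries 1 (ρ ^ e 1 * logDerivFactor ρ)

theorem constantCoeff_residueKernel_ne_zero {ρ : PowerSeries K}
    (h : PowerSeries.constantCoeff ρ ≠ 0) (e : Fin 2 →₀ ℕ) :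
    MvPowerSeries.constantCoeff (residueKernel ρ e) ≠ 0 := by
  rw [residueKernel, map_mul, constantCoeff_toMvPowerSeries, constantCoeff_toMvPowerSeries,
    map_mul, map_mul, constantCoeff_logDerivFactor h, map_pow, map_pow, mul_one, mul_one]
  exact mul_ne_zero (pow_ne_zero _ h) (pow_ne_zero _ h)

theorem pderiv_zero_toMvPowerSeries_one (f : PowerSeries K) :
    MvPowerSeries.pderiv K (0 : Fin 2) (PowerSeries.toMvPowerSeries (1 : Fin 2) f) = 0 :=
  pderiv_toMvPowerSeries_of_ne zero_ne_one f

theorem pderiv_one_toMvPowerSeries_zero (f : PowerSeries K) :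
    MvPowerSeries.pderiv K (1 : Fin 2) (PowerSeries.toMvPowerSeries (0 : Fin 2) f) = 0 :=
  pderiv_toMvPowerSeries_of_ne one_ne_zero f

/-- Integration by parts in each variable separately: the factor `e_i` becomes `w_i ∂_i`, and one
logarithmic factor is freed. The sum is the Euler field of `euler_log_normalizedRatio`. -/
theorem add_mul_coeff_mul_residueKernel {ρ : PowerSeries K}
    (h : PowerSeries.constantCoeff ρ ≠ 0) (G : MvPowerSeries (Fin 2) K) (e : Fin 2 →₀ ℕ) :
    ((e 0 : K) + e 1) * MvPowerSeries.coeff e (G * residueKernel ρ e) =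
      MvPowerSeries.coeff e ((PowerSeries.toMvPowerSeries 1 (logDerivFactor ρ) *
            (MvPowerSeries.X 0 * MvPowerSeries.pderiv K 0 G) +
          PowerSeries.toMvPowerSeries 0 (logDerivFactor ρ) *
            (MvPowerSeries.X 1 * MvPowerSeries.pderiv K 1 G)) *
        (PowerSeries.toMvPowerSeries 0 (ρ ^ e 0) * PowerSeries.toMvPowerSeries 1 (ρ ^ e 1))) := by
  have h0 := coeff_X_mul_pderiv_mul h 0 G _
    (pderiv_zero_toMvPowerSeries_one (ρ ^ e 1 * logDerivFactor ρ)) e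
  have h1 := coeff_X_mul_pderiv_mul h 1 G _
    (pderiv_one_toMvPowerSeries_zero (ρ ^ e 0 * logDerivFactor ρ)) e
  rw [mul_comm (PowerSeries.toMvPowerSeries 1 (ρ ^ e 1 * logDerivFactor ρ))] at h1
  rw [add_mul, residueKernel, ← h0, ← h1, ← map_add]
  congr 1
  simp only [map_mul]
  ring

theorem mul_coeff_mul_residueKernel {ρ : PowerSeries K}
    (h : PowerSeries.constantCoeff ρ ≠ 0) (G : MvPowerSeries (Fin 2) K) (e : Fin 2 →₀ ℕ) :
    (e 0 : K) * e 1 * MvPowerSeries.coeff e (G * residueKernel ρ e) =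
      MvPowerSeries.coeff e (MvPowerSeries.X 0 * MvPowerSeries.X 1 *
        MvPowerSeries.pderiv K 0 (MvPowerSeries.pderiv K 1 G) *
        (PowerSeries.toMvPowerSeries 0 (ρ ^ e 0) * PowerSeries.toMvPowerSeries 1 (ρ ^ e 1))) := by
  have h0 := coeff_X_mul_pderiv_mul h 0 (MvPowerSeries.X 1 * MvPowerSeries.pderiv K 1 G) _
    (pderiv_zero_toMvPowerSeries_one (ρ ^ e 1)) e
  have h1 := coeff_X_mul_pderiv_mul h 1 G _
    (pderiv_one_toMvPowerSeries_zero (ρ ^ e 0 * logDerivFactor ρ)) e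
  rw [mul_comm (PowerSeries.toMvPowerSeries 1 (ρ ^ e 1)),
    mul_comm (PowerSeries.toMvPowerSeries 1 (ρ ^ e 1 * logDerivFactor ρ))] at h1
  rw [mul_assoc, residueKernel, ← h1, ← h0, Derivation.leibniz,
    MvPowerSeries.pderiv_X_of_ne one_ne_zero]
  congr 1
  simp only [smul_eq_mul, mul_zero, add_zero]
  ring

variable (Q : ℕ) (P : ℤ) {B : K}

/-- `B ^ (m P) [X^{m - d}] (1 - X / A)^{bm - 1} (1 - A X)^{-bm - 1}` -/
def hatCoeff (Q : ℕ) (P : ℤ) (B : K) (m d : ℕ) : K :=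
  B ^ ((m : ℤ) * P) * coeffZ (powHat (B ^ Q) ((P : K) / Q * (m : ℤ))) (m - d)

theorem coeff_pow_mul_hat (hB : B ≠ 0) (m d : ℕ) :
    PowerSeries.coeff m (PowerSeries.C ((B ^ (-P)) ^ d) * PowerSeries.X ^ d *
      (PowerSeries.C (B ^ (2 * P * m)) *
        PowerSeries.rescale (B ^ (-P)) (powHat (B ^ Q) ((P : K) / Q * m)))) =
      hatCoeff Q P B m d := by
  rw [mul_assoc, PowerSeries.coeff_C_mul, PowerSeries.coeff_X_pow_mul', hatCoeff]
  split_ifs with h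
  · obtain ⟨n, rfl⟩ := Nat.exists_eq_add_of_le h
    rw [Nat.add_sub_cancel_left, PowerSeries.coeff_C_mul, PowerSeries.coeff_rescale,
      show ((d + n : ℕ) : ℤ) - d = n by push_cast; ring, coeffZ_natCast, ← mul_assoc, ← mul_assoc,
      mul_right_comm ((B ^ (-P)) ^ d), ← pow_add, ← zpow_natCast, ← zpow_mul, ← zpow_add₀ hB]
    congr 2 <;> push_cast <;> ring
  · rw [coeffZ_of_neg _ (by omega)]
    simp

variable [CharZero K]

theorem curveDen_mul_curveDen_mul_euler (hB : B ≠ 0) :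
    PowerSeries.toMvPowerSeries 0 (curveDen Q P B) *
        PowerSeries.toMvPowerSeries 1 (curveDen Q P B) *
        (PowerSeries.toMvPowerSeries 1 (logDerivFactor (lambdaRatio Q P B)) *
          (MvPowerSeries.X 0 * MvPowerSeries.pderiv K 0
            (logSeries (normalizedRatio (lambdaRatio Q P B)))) +
        PowerSeries.toMvPowerSeries 0 (logDerivFactor (lambdaRatio Q P B)) *
          (MvPowerSeries.X 1 * MvPowerSeries.pderiv K 1
            (logSeries (normalizedRatio (lambdaRatio Q P B))))) =
      MvPowerSeries.C ((P : K) / Q * (B ^ Q - (B ^ Q)⁻¹)) *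
        (MvPowerSeries.C (B ^ Q + (B ^ Q)⁻¹ + (P : K) / Q * (B ^ Q - (B ^ Q)⁻¹)) *
          (MvPowerSeries.C (B ^ (-P)) * MvPowerSeries.X 0) *
          (MvPowerSeries.C (B ^ (-P)) * MvPowerSeries.X 1) -
        (MvPowerSeries.C (B ^ (-P)) * MvPowerSeries.X 0) ^ 2 *
          (MvPowerSeries.C (B ^ (-P)) * MvPowerSeries.X 1) -
        (MvPowerSeries.C (B ^ (-P)) * MvPowerSeries.X 0) *
          (MvPowerSeries.C (B ^ (-P)) * MvPowerSeries.X 1) ^ 2) := by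
  have he := euler_log_normalizedRatio (constantCoeff_lambdaRatio_ne_zero Q P hB)
  have hk : ∀ i : Fin 2, PowerSeries.toMvPowerSeries i (logDerivFactor (lambdaRatio Q P B)) *
      PowerSeries.toMvPowerSeries i (curveDen Q P B) =
      PowerSeries.toMvPowerSeries i (curveDen Q P B) -
        MvPowerSeries.C ((P : K) / Q * (B ^ Q - (B ^ Q)⁻¹)) *
          (MvPowerSeries.C (B ^ (-P)) * MvPowerSeries.X i) := by
    intro i
    rw [← map_mul, logDerivFactor_lambdaRatio_mul_curveDen Q P hB, map_sub, map_mul,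
      PowerSeries.toMvPowerSeries_C, PowerSeries.toMvPowerSeries_X, map_mul MvPowerSeries.C]
    ring
  have hd : ∀ i : Fin 2, PowerSeries.toMvPowerSeries i (curveDen Q P B) =
      1 - MvPowerSeries.C (B ^ Q + (B ^ Q)⁻¹) * (MvPowerSeries.C (B ^ (-P)) * MvPowerSeries.X i) +
        (MvPowerSeries.C (B ^ (-P)) * MvPowerSeries.X i) ^ 2 := by
    intro i
    have hC : ∀ c : K, PowerSeries.rescale (B ^ (-P)) (PowerSeries.C c) = PowerSeries.C c := by
      intro c
      ext n
      rw [PowerSeries.coeff_rescale, PowerSeries.coeff_C]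
      split_ifs with hn
      · subst hn; simp
      · simp
    have hA : (MvPowerSeries.C (B ^ Q) * MvPowerSeries.C (B ^ Q)⁻¹ :
        MvPowerSeries (Fin 2) K) = 1 := by
      rw [← map_mul, mul_inv_cancel₀ (pow_ne_zero _ hB), map_one]
    simp only [curveDen, map_mul, map_sub, map_one, hC, PowerSeries.rescale_X,
      PowerSeries.toMvPowerSeries_C, PowerSeries.toMvPowerSeries_X]
    rw [map_add]
    linear_combination (MvPowerSeries.C (B ^ (-P)) * MvPowerSeries.X i) ^ 2 * hA
  have hk0 := hk 0
  have hk1 := hk 1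
  have hd0 := hd 0
  have hd1 := hd 1
  refine mul_left_cancel₀ (X_sub_X_ne_zero (K := K)) ?_
  rw [map_add MvPowerSeries.C (B ^ Q + (B ^ Q)⁻¹)]
  set q : MvPowerSeries (Fin 2) K := MvPowerSeries.C (B ^ (-P))
  set k0 := PowerSeries.toMvPowerSeries (0 : Fin 2) (logDerivFactor (lambdaRatio Q P B))
  set k1 := PowerSeries.toMvPowerSeries (1 : Fin 2) (logDerivFactor (lambdaRatio Q P B))
  set d0 := PowerSeries.toMvPowerSeries (0 : Fin 2) (curveDen Q P B)
  set d1 := PowerSeries.toMvPowerSeries (1 : Fin 2) (curveDen Q P B)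
  set c : MvPowerSeries (Fin 2) K := MvPowerSeries.C ((P : K) / Q * (B ^ Q - (B ^ Q)⁻¹))
  set x0 : MvPowerSeries (Fin 2) K := MvPowerSeries.X 0
  set x1 : MvPowerSeries (Fin 2) K := MvPowerSeries.X 1
  -- The last bracket is the difference of one quadratic polynomial at the two points, hence
  -- divisible by `x1 - x0`. The quotient is linear and gives the cubic on the right-hand side.
  have e1 : d0 * d1 * (k0 * k1 * (x1 - x0) - k1 * x1 + k0 * x0) =
      c * q * x0 * x1 * (d0 - c * (q * x0) - (d1 - c * (q * x1))) := by
    linear_combination (d1 * x0 + (x1 - x0) * (k1 * d1)) * hk0 +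
      ((x1 - x0) * (d0 - c * (q * x0)) - d0 * x1) * hk1
  rw [mul_left_comm, he, e1, hd0, hd1]
  ring

/-- Each power `ρ^m` contains one factor `curveDen`, exactly what the Euler derivative needs to
become a polynomial. The remaining `powHat` factors turn its three monomials into the coefficients
occurring in the correlator. -/
theorem coeff_log_mul_residueKernel (hB : B ≠ 0) (e : Fin 2 →₀ ℕ) :
    ((e 0 : K) + e 1) * MvPowerSeries.coeff e
        (logSeries (normalizedRatio (lambdaRatio Q P B)) * residueKernel (lambdaRatio Q P B) e) =
      (P : K) / Q * (B ^ Q - (B ^ Q)⁻¹) *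
        ((B ^ Q + (B ^ Q)⁻¹ + (P : K) / Q * (B ^ Q - (B ^ Q)⁻¹)) *
          (hatCoeff Q P B (e 0) 1 * hatCoeff Q P B (e 1) 1) -
          hatCoeff Q P B (e 0) 2 * hatCoeff Q P B (e 1) 1 -
          hatCoeff Q P B (e 0) 1 * hatCoeff Q P B (e 1) 2) := by
  have key := curveDen_mul_curveDen_mul_euler Q P hB
  have hc : ∀ d d' : ℕ, hatCoeff Q P B (e 0) d * hatCoeff Q P B (e 1) d' =
      MvPowerSeries.coeff e ((MvPowerSeries.C (B ^ (-P)) * MvPowerSeries.X 0) ^ d *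
        (MvPowerSeries.C (B ^ (-P)) * MvPowerSeries.X 1) ^ d' *
        (PowerSeries.toMvPowerSeries 0 (PowerSeries.C (B ^ (2 * P * (e 0 : ℕ))) *
            PowerSeries.rescale (B ^ (-P)) (powHat (B ^ Q) ((P : K) / Q * (e 0 : ℕ)))) *
          PowerSeries.toMvPowerSeries 1 (PowerSeries.C (B ^ (2 * P * (e 1 : ℕ))) *
            PowerSeries.rescale (B ^ (-P)) (powHat (B ^ Q) ((P : K) / Q * (e 1 : ℕ)))))) := by
    intro d d'
    rw [← coeff_pow_mul_hat Q P hB, ← coeff_pow_mul_hat Q P hB, ← coeff_toMvPowerSeries_mul]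
    congr 1
    simp only [map_mul, map_pow, PowerSeries.toMvPowerSeries_C, PowerSeries.toMvPowerSeries_X,
      mul_pow]
    ring
  rw [add_mul_coeff_mul_residueKernel (constantCoeff_lambdaRatio_ne_zero Q P hB),
    lambdaRatio_pow Q P hB, lambdaRatio_pow Q P hB, hc, hc, hc, ← MvPowerSeries.coeff_C_mul,
    ← map_sub, ← map_sub, ← MvPowerSeries.coeff_C_mul]
  congr 1
  rw [map_mul (PowerSeries.toMvPowerSeries 0) (curveDen Q P B),
    map_mul (PowerSeries.toMvPowerSeries 1) (curveDen Q P B)]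
  set H0 := PowerSeries.toMvPowerSeries (0 : Fin 2) (PowerSeries.C (B ^ (2 * P * (e 0 : ℕ))) *
    PowerSeries.rescale (B ^ (-P)) (powHat (B ^ Q) ((P : K) / Q * (e 0 : ℕ))))
  set H1 := PowerSeries.toMvPowerSeries (1 : Fin 2) (PowerSeries.C (B ^ (2 * P * (e 1 : ℕ))) *
    PowerSeries.rescale (B ^ (-P)) (powHat (B ^ Q) ((P : K) / Q * (e 1 : ℕ))))
  linear_combination H0 * H1 * key

/-- The exponent of `X 0 * X 1`. -/
def unitPair : Fin 2 →₀ ℕ := Finsupp.single 0 1 + Finsupp.single 1 1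

theorem add_unitPair_apply (e : Fin 2 →₀ ℕ) (i : Fin 2) : (e + unitPair) i = e i + 1 := by
  fin_cases i <;> simp [unitPair]

theorem coeff_freeEnergy_two (B : K) (e : Fin 2 →₀ ℕ) (h : ∀ i, 0 < e i) :
    MvPowerSeries.coeff e (freeEnergy Q P B 0 2) =
      correlator Q P B 0 [⟨e 0, h 0⟩, ⟨e 1, h 1⟩] := by
  have hl : (List.ofFn fun i : Fin 2 => (⟨e i, h i⟩ : ℕ+)) = [⟨e 0, h 0⟩, ⟨e 1, h 1⟩] := by
    simp [List.ofFn_succ]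
  exact (dif_pos h).trans (congrArg (correlator Q P B 0) hl)

theorem coeff_omegaSeries_two (B : K) (e : Fin 2 →₀ ℕ) (h : ∀ i, 0 < e i) :
    MvPowerSeries.coeff (e + unitPair) (omegaSeries Q P B 0 2) =
      ((Q : K) ^ 2)⁻¹ * MvPowerSeries.coeff e (freeEnergy Q P B 0 2) * (e 0 * e 1) := by
  have he := add_unitPair_apply e
  have h' : ∀ i, 1 < (e + unitPair) i := by
    intro i; rw [he]; have := h i; omega
  have hl : (List.ofFn fun i : Fin 2 => (⟨e i, h i⟩ : ℕ+)) = List.ofFn fun i : Fin 2 =>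
      (⟨(e + unitPair) i - 1, Nat.sub_pos_of_lt (h' i)⟩ : ℕ+) := by
    congr 1
    funext i
    refine Subtype.ext ?_
    change e i = (e + unitPair) i - 1
    rw [he, Nat.add_sub_cancel]
  have hF : MvPowerSeries.coeff e (freeEnergy Q P B 0 2) =
      correlator Q P B 0 (List.ofFn fun i : Fin 2 => (⟨e i, h i⟩ : ℕ+)) := dif_pos h
  refine (dif_pos h').trans ?_
  refine congrArg₂ (· * ·) (congrArg (((Q : K) ^ 2)⁻¹ * ·)
    ((congrArg (correlator Q P B 0) hl.symm).trans hF.symm)) ?_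
  rw [Fin.prod_univ_two, he, he, Nat.add_sub_cancel, Nat.add_sub_cancel, neg_mul_neg]

theorem coeff_omegaSeries_of_not (B : K) (e : Fin 2 →₀ ℕ) (h : ¬∀ i, 1 < e i) :
    MvPowerSeries.coeff e (omegaSeries Q P B 0 2) = 0 := dif_neg h

theorem coeff_freeEnergy (hB : B ≠ 0) (e : Fin 2 →₀ ℕ) :
    MvPowerSeries.coeff e (freeEnergy Q P B 0 2) = (Q : K) ^ 2 * MvPowerSeries.coeff e
      (logSeries (normalizedRatio (lambdaRatio Q P B)) * residueKernel (lambdaRatio Q P B) e) := by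
  have key := coeff_log_mul_residueKernel Q P hB e
  by_cases h : ∀ i, 0 < e i
  · have hs : (e 0 : K) + e 1 ≠ 0 := by
      exact_mod_cast (by have := h 0; omega : e 0 + e 1 ≠ 0)
    have hc := correlator_eq_powHat Q P hB ⟨e 0, h 0⟩ ⟨e 1, h 1⟩
    simp only [PNat.mk_coe] at hc
    rw [add_mul ((e 0 : ℕ) : ℤ), zpow_add₀ hB] at hc
    rw [coeff_freeEnergy_two Q P B e h, hc, mul_div_assoc, mul_assoc]
    congr 1
    refine mul_left_cancel₀ hs ?_
    rw [key]
    simp only [hatCoeff, Nat.cast_one, Nat.cast_ofNat]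
    field_simp
    ring
  · have hh : ∀ d, 0 < d → hatCoeff Q P B 0 d = 0 := by
      intro d hd
      rw [hatCoeff, coeffZ_of_neg _ (by omega), mul_zero]
    have hz : e 0 = 0 ∨ e 1 = 0 := by
      by_contra hn
      rw [not_or] at hn
      refine h fun i => ?_
      fin_cases i
      · exact Nat.pos_of_ne_zero hn.1
      · exact Nat.pos_of_ne_zero hn.2
    -- The divided identity says nothing at the origin. There the logarithm has no constant term;
    -- for the other exponents with a zero entry the coefficients of negative index vanish.
    by_cases hs : e 0 + e 1 = 0
    · have he : e = 0 := by
        ext i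
        fin_cases i
        · exact (Nat.add_eq_zero_iff.1 hs).1
        · exact (Nat.add_eq_zero_iff.1 hs).2
      rw [show MvPowerSeries.coeff e (freeEnergy Q P B 0 2) = 0 from dif_neg h, he,
        MvPowerSeries.coeff_zero_eq_constantCoeff_apply, map_mul, constantCoeff_logSeries
        (constantCoeff_normalizedRatio (constantCoeff_lambdaRatio_ne_zero Q P hB)), zero_mul,
        mul_zero]
    · have hs' : (e 0 : K) + e 1 ≠ 0 := by exact_mod_cast hs
      have : ((e 0 : K) + e 1) * MvPowerSeries.coeff e
          (logSeries (normalizedRatio (lambdaRatio Q P B)) *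
            residueKernel (lambdaRatio Q P B) e) = 0 := by
        rw [key]
        rcases hz with hz | hz <;> rw [hz, hh 1 one_pos, hh 2 two_pos] <;> ring
      rw [show MvPowerSeries.coeff e (freeEnergy Q P B 0 2) = 0 from dif_neg h, (mul_eq_zero.1 this).resolve_left hs', mul_zero]

/-- Both sides have the same pairing with every residue kernel, and the pairing is nondegenerate. -/
theorem onCurve_freeEnergy (hB : B ≠ 0) : onCurve Q P B (freeEnergy Q P B 0 2) =
    ((Q : K) ^ 2) • logSeries (normalizedRatio (lambdaRatio Q P B)) := by
  have h0 := constantCoeff_lambdaRatio_ne_zero Q P hB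
  refine sub_eq_zero.1 (eq_zero_of_coeff_mul_eq_zero (residueKernel (lambdaRatio Q P B))
    (constantCoeff_residueKernel_ne_zero h0) fun e => ?_)
  have h1 := coeff_subst_toMvPowerSeries_mul h0 (freeEnergy Q P B 0 2) e
  rw [sub_mul, map_sub, onCurve, lambdaInv, residueKernel, h1, coeff_freeEnergy Q P hB,
    residueKernel, smul_mul_assoc, MvPowerSeries.coeff_smul, sub_self]

/-- The two-point differential in the coordinates `w_i = 1/U_i`. -/
theorem onCurve_omegaSeries_mul (hQ : 0 < Q) (hB : B ≠ 0) :
    onCurve Q P B (omegaSeries Q P B 0 2) *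
        (PowerSeries.toMvPowerSeries 0 (lambdaDeriv Q P B) *
          PowerSeries.toMvPowerSeries 1 (lambdaDeriv Q P B)) =
      (MvPowerSeries.X 0 * MvPowerSeries.X 1) ^ 2 * MvPowerSeries.pderiv K 0
        (MvPowerSeries.pderiv K 1 (logSeries (normalizedRatio (lambdaRatio Q P B)))) := by
  have h0 := constantCoeff_lambdaRatio_ne_zero Q P hB
  have hQ' : (Q : K) ^ 2 ≠ 0 := pow_ne_zero _ (Nat.cast_ne_zero.2 hQ.ne')
  have hinv : lambdaRatio Q P B * (lambdaRatio Q P B)⁻¹ = 1 := PowerSeries.mul_inv_cancel _ h0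
  have hd : lambdaDeriv Q P B = logDerivFactor (lambdaRatio Q P B) * lambdaRatio Q P B :=
    (logDerivFactor_mul h0).symm
  -- The test series carry one power of `ρ` less and no logarithmic factor, because `dΛ/dU` supplies
  -- both and completes them to the residue kernel.
  refine sub_eq_zero.1 (eq_zero_of_coeff_mul_eq_zero (fun e =>
    PowerSeries.toMvPowerSeries 0 (lambdaRatio Q P B ^ e 0 * (lambdaRatio Q P B)⁻¹) *
      PowerSeries.toMvPowerSeries 1 (lambdaRatio Q P B ^ e 1 * (lambdaRatio Q P B)⁻¹))
    (fun e => ?_) fun e => ?_)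
  · rw [map_mul, constantCoeff_toMvPowerSeries, constantCoeff_toMvPowerSeries, map_mul, map_mul,
      map_pow, map_pow, PowerSeries.constantCoeff_inv]
    exact mul_ne_zero (mul_ne_zero (pow_ne_zero _ h0) (inv_ne_zero h0))
      (mul_ne_zero (pow_ne_zero _ h0) (inv_ne_zero h0))
  set M := MvPowerSeries.pderiv K 0
    (MvPowerSeries.pderiv K 1 (logSeries (normalizedRatio (lambdaRatio Q P B))))
  have e1 : onCurve Q P B (omegaSeries Q P B 0 2) *
        (PowerSeries.toMvPowerSeries 0 (lambdaDeriv Q P B) *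
          PowerSeries.toMvPowerSeries 1 (lambdaDeriv Q P B)) *
      (PowerSeries.toMvPowerSeries 0 (lambdaRatio Q P B ^ e 0 * (lambdaRatio Q P B)⁻¹) *
        PowerSeries.toMvPowerSeries 1 (lambdaRatio Q P B ^ e 1 * (lambdaRatio Q P B)⁻¹)) =
      onCurve Q P B (omegaSeries Q P B 0 2) * residueKernel (lambdaRatio Q P B) e := by
    have : ∀ n, logDerivFactor (lambdaRatio Q P B) * lambdaRatio Q P B *
        (lambdaRatio Q P B ^ n * (lambdaRatio Q P B)⁻¹) =
        lambdaRatio Q P B ^ n * logDerivFactor (lambdaRatio Q P B) := by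
      intro n
      linear_combination logDerivFactor (lambdaRatio Q P B) * lambdaRatio Q P B ^ n * hinv
    rw [mul_assoc, mul_mul_mul_comm, ← map_mul, ← map_mul, hd, this, this, residueKernel]
  have e2 : MvPowerSeries.coeff e (onCurve Q P B (omegaSeries Q P B 0 2) *
      residueKernel (lambdaRatio Q P B) e) = MvPowerSeries.coeff e (omegaSeries Q P B 0 2) :=
    coeff_subst_toMvPowerSeries_mul h0 _ e
  have hX : (MvPowerSeries.X 0 * MvPowerSeries.X 1 : MvPowerSeries (Fin 2) K) =
      MvPowerSeries.monomial unitPair 1 := by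
    rw [MvPowerSeries.X_def, MvPowerSeries.X_def, MvPowerSeries.monomial_mul_monomial, one_mul]
    rfl
  rw [sub_mul, map_sub, e1, e2, sub_eq_zero, pow_two, mul_assoc, mul_assoc]
  nth_rw 1 [hX]
  -- The differential has exponents `μ_i + 1`, so one factor `X 0 * X 1` is removed and the
  -- coefficient is compared with that of the free energy at `e - unitPair`. Without such a factor
  -- both sides vanish.
  by_cases hs : unitPair ≤ e
  · obtain ⟨d, rfl⟩ := exists_add_of_le hs
    rw [MvPowerSeries.coeff_add_monomial_mul, one_mul, add_comm _ d]
    have hde := add_unitPair_apply d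
    have e3 : MvPowerSeries.X 0 * MvPowerSeries.X 1 * (M *
        (PowerSeries.toMvPowerSeries 0 (lambdaRatio Q P B ^
            (d + unitPair) 0 * (lambdaRatio Q P B)⁻¹) *
          PowerSeries.toMvPowerSeries 1 (lambdaRatio Q P B ^
            (d + unitPair) 1 * (lambdaRatio Q P B)⁻¹))) =
        MvPowerSeries.X 0 * MvPowerSeries.X 1 * M *
          (PowerSeries.toMvPowerSeries 0 (lambdaRatio Q P B ^ d 0) *
            PowerSeries.toMvPowerSeries 1 (lambdaRatio Q P B ^ d 1)) := by
      have : ∀ n, lambdaRatio Q P B ^ (n + 1) * (lambdaRatio Q P B)⁻¹ = lambdaRatio Q P B ^ n := by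
        intro n
        rw [pow_succ, mul_assoc, hinv, mul_one]
      rw [hde, hde, this, this, mul_assoc (_ * _) M]
    rw [e3, ← mul_coeff_mul_residueKernel h0]
    by_cases hd : ∀ i, 0 < d i
    · rw [coeff_omegaSeries_two Q P B d hd, coeff_freeEnergy Q P hB, inv_mul_cancel_left₀ hQ']
      ring
    · rw [coeff_omegaSeries_of_not]
      · have hz : d 0 = 0 ∨ d 1 = 0 := by
          by_contra hn
          rw [not_or] at hn
          refine hd fun i => ?_
          fin_cases i
          · exact Nat.pos_of_ne_zero hn.1
          · exact Nat.pos_of_ne_zero hn.2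
        rcases hz with hz | hz <;> simp [hz]
      · intro h'
        refine hd fun i => ?_
        have := h' i
        rw [hde] at this
        omega
  · rw [MvPowerSeries.coeff_monomial_mul, if_neg hs, coeff_omegaSeries_of_not]
    intro h'
    refine hs fun i => ?_
    have := h' i
    fin_cases i <;> simp [unitPair] at this ⊢ <;> omega

end Pairing

end TorusKnotOV

end

noncomputable section

namespace TorusKnotOV

/-! ### Passage to the fraction field -/

section Frac

variable {K : Type*} [Field K]

theorem toFrac2_injective : Function.Injective (toFrac2 (K := K)) :=
  IsFractionRing.injective (MvPowerSeries (Fin 2) K) (Frac2 K)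

theorem toFrac2_ne_zero {f : MvPowerSeries (Fin 2) K} (h : f ≠ 0) : toFrac2 f ≠ 0 := fun h0 =>
  h (toFrac2_injective (h0.trans (map_zero (algebraMap _ _)).symm))

theorem toFrac2_mul (f g : MvPowerSeries (Fin 2) K) : toFrac2 (f * g) = toFrac2 f * toFrac2 g :=
  map_mul (algebraMap _ _) f g

theorem toFrac2_sub (f g : MvPowerSeries (Fin 2) K) : toFrac2 (f - g) = toFrac2 f - toFrac2 g :=
  map_sub (algebraMap _ _) f g

theorem toFrac2_pow (f : MvPowerSeries (Fin 2) K) (n : ℕ) : toFrac2 (f ^ n) = toFrac2 f ^ n :=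
  map_pow (algebraMap _ _) f n

theorem toFrac2_X_ne_zero (i : Fin 2) :
    toFrac2 (MvPowerSeries.X i : MvPowerSeries (Fin 2) K) ≠ 0 := by
  refine toFrac2_ne_zero fun h => ?_
  have := congrArg (MvPowerSeries.coeff (Finsupp.single i 1)) h
  simp [MvPowerSeries.coeff_X] at this

theorem coordU_sub_coordU : coordU K 0 - coordU K 1 =
    toFrac2 (MvPowerSeries.X 1 - MvPowerSeries.X 0) /
      toFrac2 (MvPowerSeries.X 0 * MvPowerSeries.X 1) := by
  have h0 := toFrac2_X_ne_zero (K := K) 0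
  have h1 := toFrac2_X_ne_zero (K := K) 1
  rw [coordU, coordU, toFrac2_sub, toFrac2_mul]
  field_simp

variable [CharZero K] (Q : ℕ) (P : ℤ) {B : K}

theorem coordLambda_sub_coordLambda (B : K) : coordLambda Q P B 0 - coordLambda Q P B 1 =
    toFrac2 ((MvPowerSeries.X 1 - MvPowerSeries.X 0) * ratioSeries (lambdaRatio Q P B)) /
      toFrac2 (MvPowerSeries.X 0 * MvPowerSeries.X 1) := by
  have h0 := toFrac2_X_ne_zero (K := K) 0
  have h1 := toFrac2_X_ne_zero (K := K) 1
  rw [coordLambda, coordLambda, coordU, coordU, X_sub_X_mul_ratioSeries, toFrac2_sub, toFrac2_mul,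
    toFrac2_mul, toFrac2_mul]
  field_simp

theorem toFrac2_normalizedRatio (hB : B ≠ 0) : toFrac2 (normalizedRatio (lambdaRatio Q P B)) =
    toFrac2 (MvPowerSeries.C (B ^ (2 * P))) * (coordU K 0 - coordU K 1) /
      (coordLambda Q P B 0 - coordLambda Q P B 1) := by
  have h := constantCoeff_lambdaRatio_ne_zero Q P hB
  have hT := toFrac2_ne_zero (ratioSeries_ne_zero h)
  have hδ := toFrac2_ne_zero (X_sub_X_ne_zero (K := K))
  have hX := mul_ne_zero (toFrac2_X_ne_zero (K := K) 0) (toFrac2_X_ne_zero (K := K) 1)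
  rw [← toFrac2_mul] at hX
  have e := congrArg toFrac2 (normalizedRatio_mul h)
  rw [toFrac2_mul, constantCoeff_lambdaRatio Q P hB] at e
  rw [coordU_sub_coordU, coordLambda_sub_coordLambda, toFrac2_mul (_ - _), ← e]
  field_simp

theorem toFrac2_onCurve_omegaSeries (hQ : 0 < Q) (hB : B ≠ 0) :
    toFrac2 (onCurve Q P B (omegaSeries Q P B 0 2)) *
        (coordLambdaDeriv Q P B 0 * coordLambdaDeriv Q P B 1) =
      1 / (coordU K 0 - coordU K 1) ^ 2 -
        coordLambdaDeriv Q P B 0 * coordLambdaDeriv Q P B 1 /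
          (coordLambda Q P B 0 - coordLambda Q P B 1) ^ 2 := by
  have h := constantCoeff_lambdaRatio_ne_zero Q P hB
  have hT := toFrac2_ne_zero (ratioSeries_ne_zero h)
  have hδ := toFrac2_ne_zero (X_sub_X_ne_zero (K := K))
  have hX := mul_ne_zero (toFrac2_X_ne_zero (K := K) 0) (toFrac2_X_ne_zero (K := K) 1)
  rw [← toFrac2_mul] at hX
  have e1 := congrArg toFrac2 (onCurve_omegaSeries_mul Q P hQ hB)
  have e2 := congrArg toFrac2 (mul_pderiv_pderiv_log_normalizedRatio h)
  rw [← lambdaDeriv] at e2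
  rw [toFrac2_mul, toFrac2_mul, toFrac2_mul, toFrac2_pow] at e1
  rw [toFrac2_mul, toFrac2_pow, toFrac2_mul (_ - _), toFrac2_sub (_ ^ 2), toFrac2_pow,
    toFrac2_mul] at e2
  rw [coordLambdaDeriv, coordLambdaDeriv, e1, coordU_sub_coordU, coordLambda_sub_coordLambda,
    toFrac2_mul (_ - _)]
  field_simp
  linear_combination e2

end Frac

end TorusKnotOV

end

open TorusKnotOV in
theorem theorem9p2 {K : Type*} [Field K] [CharZero K] (Q : ℕ) (hQ : 0 < Q) (P : ℤ)
    (A B : K) (hB : B ≠ 0) (hAB : B ^ Q = A) (a b : K) (ha : a = A ^ 2) (hb : b = (P : K) / Q) :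
    -- the genus zero connected two-point correlators
    (∀ μ₁ μ₂ : ℕ+,
      correlator Q P B 0 [μ₁, μ₂] =
        (Q : K) ^ 2 * ((a - 1) * b) / ((μ₁ : K) + (μ₂ : K)) *
          (((a + 1) + (a - 1) * b) * (xi1 Q P B μ₁ * xi1 Q P B μ₂) +
            a * (xi1 Q P B μ₁ * xi2 Q P B μ₂ + xi2 Q P B μ₁ * xi1 Q P B μ₂))) ∧
    -- the two-point free energy; the constant `B ^ (2 * P)` is `A^{2P/Q}`
    (∃ R : MvPowerSeries (Fin 2) K,
      MvPowerSeries.constantCoeff R = 1 ∧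
      toFrac2 R = toFrac2 (MvPowerSeries.C (B ^ (2 * P))) * (coordU K 0 - coordU K 1) /
        (coordLambda Q P B 0 - coordLambda Q P B 1) ∧
      onCurve Q P B (freeEnergy Q P B 0 2) = ((Q : K) ^ 2) • logSeries R) ∧
    -- agreement with the Bergman kernel (coefficients of `dU_1 dU_2`)
    (toFrac2 (onCurve Q P B (omegaSeries Q P B 0 2)) *
        (coordLambdaDeriv Q P B 0 * coordLambdaDeriv Q P B 1) =
      1 / (coordU K 0 - coordU K 1) ^ 2 -
        coordLambdaDeriv Q P B 0 * coordLambdaDeriv Q P B 1 /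
          (coordLambda Q P B 0 - coordLambda Q P B 1) ^ 2) := by
  subst ha hb hAB
  exact ⟨correlator_eq_xi Q P hB, ⟨normalizedRatio (lambdaRatio Q P B),
    constantCoeff_normalizedRatio (constantCoeff_lambdaRatio_ne_zero Q P hB),
    toFrac2_normalizedRatio Q P hB, onCurve_freeEnergy Q P hB⟩,
    toFrac2_onCurve_omegaSeries Q P hQ hB⟩
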